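/- Let $n\ge 1$ be an integer, $p\in(1,\infty)$, $m\in[p,\infty)$, $\Omega\subset\mathbb{R}^n$ open, and write $B_r$ for the open ball of radius $r$ centred at the origin, $B_r(x)$ for the one centred at $x$, and $\mathcal L^n$ for Lebesgue measure. Let $W:[-1,1]\to[0,\infty)$ be lower semicontinuous and suppose that for some $\lambda\in(0,1]$, $\Lambda\in[1,\infty)$, $\theta\in(-1,1)$, $q\in(0,1)$, $c_1\in(0,\infty)$ $$\lambda\,\chi_{(-\infty,\theta]}(x)\,|1+x|^m\le W(x)\le\Lambda|1+x|^m\qquad\text{for all }x\in[-1,1],$$ $$W(t)-W(r)\ge c_1(t-r)|1+r|^{m-1}+c_1(t-r)^{\lceil m\rceil}\qquad\text{for all }-1\le r\le t\le -1+q.$$ For $s\in(0,1)$ and measurable $u:\mathbb{R}^n\to\mathbb{R}$ put $$\mathcal K_s^p(u,\Omega)=\frac12\int_\Omega\int_\Omega\frac{|u(x)-u(y)|^p}{|x-y|^{n+sp}}\,dx\,dy+\int_\Omega\int_{\mathbb{R}^n\setminus\Omega}\frac{|u(x)-u(y)|^p}{|x-y|^{n+sp}}\,dx\,dy,$$ $$\mathcal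 E_s^p(u,\Omega)=(1-s)\mathcal K_s^p(u,\Omega)+\int_\Omega W(u)\,dx,$$ and let $X^{s,p}(\Omega)$ be the set of measurable $u:\mathbb{R}^n\to\mathbb{R}$ with $\mathcal K_s^p(u,\Omega)<\infty$ and $\|u\|_{L^\infty(\mathbb{R}^n)}\le1$. For $\epsilon\ge0$ and $\Omega$ bounded, $u\in X^{s,p}(\Omega)$ is an $\epsilon$-minimizer for $\mathcal E_s^p$ in $\Omega$ if $\mathcal E_s^p(u,\Omega)\le\epsilon+\mathcal E_s^p(v,\Omega)$ for every $v\in X^{s,p}(\Omega)$ with $v=u$ a.e. in $\mathbb{R}^n\setminus\Omega$; for $\Omega$ unbounded, $u\in X^{s,p}(\Omega)$ is an $\epsilon$-minimizer in $\Omega$ if it is one in every open $\Omega'\subset\subset\Omega$. For $\alpha\in(0,1)$ and $u\in C^\alpha_{\rm loc}(\Omega)$ put $$[u]_{B,\alpha}=\sup\bigl\{[u]_{C^\alpha(B_1(x_0))}:\ x_0\in B_R,\ R>0,\ B_{R+2}\subset\Omega\bigr\}$$ ($0$ if there is no such $R$), and let $C^\alpha_B(\Omega)$ be the set of $u\in C^\alpha_{\rm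 loc}(\Omega)$ with $[u]_{B,\alpha}<\infty$. **Theorem (stable density estimates for $\epsilon$-minimizers).** Let $s_0\in(\tfrac1p,1)$, $s\in[s_0,1)$, $\theta_1,\theta_2\in(-1,\theta]$, $\theta_*=\min\{\theta_1,\theta_2,-1+q\}$, $\theta^*=\max\{\theta_1,\theta_2,-1+q\}$, $\alpha\in(0,1)$, $M\in[0,\infty)$. Let $u\in C^\alpha_B(\Omega)\cap X^{s,p}(\Omega)$ with $[u]_{B,\alpha}\le M$, and let $c_0,r_0\in(0,\infty)$ satisfy $B_{r_0}\subset\Omega$ and $$\mathcal L^n\bigl(B_{r_0}\cap\{u>\theta_1\}\bigr)>c_0.$$ Then there are constants - $c>0$ depending only on $m,\theta_*$, - $\delta>0$ depending only on $s_0,n,p,m,c_1,\theta_*,c_0,\alpha,M$, - $R^*\in[r_0,\infty)$ depending only on $s_0,n,p,m,c_1,\theta_*,r_0$, - $\tilde c\in(0,1)$ depending only on $s_0,n,p,m,\Lambda,c_1,\theta_*,r_0,c_0,\alpha,M$ (in particular, none of them depends on $s$) such that, if $\epsilon\in[0,\delta)$ and $u$ is an $\epsilon$-minimizer for $\mathcal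 E_s^p$ in $\Omega$, then for every $r\in[R^*,\infty)$ with $B_{4r}\subset\Omega$ $$c\int_{B_r\cap\{\theta_*<u\le\theta^*\}}|1+u(x)|^m\,dx+\mathcal L^n\bigl(B_r\cap\{u>\theta_2\}\bigr)>\tilde c\,r^n.$$ -/

import Mathlib

open MeasureTheory Set

namespace DensityEstimates

noncomputable section

/-- Euclidean space `ℝⁿ`. -/
abbrev E (n : ℕ) := EuclideanSpace ℝ (Fin n)

/-- Hypotheses on the degenerate double-well potential `W : [-1,1] → [0,∞)`. Only the values of
`W` on `[-1,1]` are constrained (and used). The exponent `⌈m⌉₊` is `m` if `m` is an integer and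
`⌊m⌋ + 1` otherwise. -/
structure IsPotential (W : ℝ → ℝ) (m lam Lam θ q c₁ : ℝ) : Prop where
  lam_pos : 0 < lam
  lam_le_one : lam ≤ 1
  one_le_Lam : 1 ≤ Lam
  neg_one_lt_θ : -1 < θ
  θ_lt_one : θ < 1
  q_pos : 0 < q
  q_lt_one : q < 1
  c₁_pos : 0 < c₁
  lsc : LowerSemicontinuousOn W (Icc (-1) 1)
  lower : ∀ x ∈ Icc (-1 : ℝ) 1, (Iic θ).indicator (fun x => lam * |1 + x| ^ m) x ≤ W x
  upper : ∀ x ∈ Icc (-1 : ℝ) 1, W x ≤ Lam * |1 + x| ^ m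
  growth : ∀ r t : ℝ, -1 ≤ r → r ≤ t → t ≤ -1 + q →
    c₁ * (t - r) * |1 + r| ^ (m - 1) + c₁ * (t - r) ^ ⌈m⌉₊ ≤ W t - W r

/-- The Gagliardo interaction `∫_A ∫_B |u(x)-u(y)|^p / |x-y|^{n+sp} dy dx` in `[0,∞]`. -/
def interaction {n : ℕ} (s p : ℝ) (u : E n → ℝ) (A B : Set (E n)) : ENNReal :=
  ∫⁻ x in A, ∫⁻ y in B, ENNReal.ofReal (|u x - u y| ^ p / ‖x - y‖ ^ ((n : ℝ) + s * p))

/-- The kinetic energy `𝒦_s^p(u,Ω)`. -/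
def kinetic {n : ℕ} (s p : ℝ) (u : E n → ℝ) (Ω : Set (E n)) : ENNReal :=
  (1 / 2) * interaction s p u Ω Ω + interaction s p u Ω Ωᶜ

/-- The energy `ℰ_s^p(u,Ω) = (1-s) 𝒦_s^p(u,Ω) + ∫_Ω W(u)`. -/
def energy {n : ℕ} (W : ℝ → ℝ) (s p : ℝ) (u : E n → ℝ) (Ω : Set (E n)) : ENNReal :=
  ENNReal.ofReal (1 - s) * kinetic s p u Ω + ∫⁻ x in Ω, ENNReal.ofReal (W (u x))

/-- `u ∈ X^{s,p}(Ω)`: Lebesgue measurable on `ℝⁿ`, finite kinetic energy, `‖u‖_{L^∞(ℝⁿ)} ≤ 1`. -/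
structure MemX {n : ℕ} (s p : ℝ) (Ω : Set (E n)) (u : E n → ℝ) : Prop where
  aemeasurable : AEMeasurable u volume
  kinetic_lt_top : kinetic s p u Ω < ⊤
  bound : ∀ᵐ x ∂(volume : Measure (E n)), |u x| ≤ 1

/-- `v ∈ X_f^{s,p}(Ω)`: `v ∈ X^{s,p}(Ω)` and `v = f` a.e. in `ℝⁿ ∖ Ω`. -/
def MemXTrace {n : ℕ} (s p : ℝ) (Ω : Set (E n)) (f v : E n → ℝ) : Prop :=
  MemX s p Ω v ∧ ∀ᵐ x ∂(volume : Measure (E n)), x ∉ Ω → v x = f x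

/-- `u ∈ X^{s,p}(Ω)` minimizes `ℰ_s^p(·,Ω)` up to `ε` among all competitors with the same
exterior datum. -/
def MinimizesUpTo {n : ℕ} (W : ℝ → ℝ) (s p ε : ℝ) (Ω : Set (E n)) (u : E n → ℝ) : Prop :=
  MemX s p Ω u ∧
    ∀ v, MemXTrace s p Ω u v → energy W s p u Ω ≤ ENNReal.ofReal ε + energy W s p v Ω

/-- `ε`-minimizer in `Ω`: in `Ω` itself if `Ω` is bounded, and in every open `Ω' ⊂⊂ Ω`
if `Ω` is unbounded. -/
def IsEpsMinimizer {n : ℕ} (W : ℝ → ℝ) (s p ε : ℝ) (Ω : Set (E n)) (u : E n → ℝ) : Prop :=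
  MemX s p Ω u ∧
    (Bornology.IsBounded Ω → MinimizesUpTo W s p ε Ω u) ∧
    (¬ Bornology.IsBounded Ω → ∀ Ω' : Set (E n), IsOpen Ω' → IsCompact (closure Ω') →
      closure Ω' ⊆ Ω → MinimizesUpTo W s p ε Ω' u)

/-- The Hölder seminorm `[u]_{C^α(S)}` in `[0,∞]`; pairs `x = y` contribute `0 / 0 = 0`. -/
def holderSeminorm {n : ℕ} (α : ℝ) (u : E n → ℝ) (S : Set (E n)) : ENNReal :=
  ⨆ x ∈ S, ⨆ y ∈ S, edist (u x) (u y) / edist x y ^ α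

/-- `[u]_{B,α}`: the supremum of `[u]_{C^α(B_1(x₀))}` over all `x₀ ∈ B_R` and all `R > 0`
with `B_{R+2} ⊂ Ω`. -/
def ballHolderSeminorm {n : ℕ} (α : ℝ) (u : E n → ℝ) (Ω : Set (E n)) : ENNReal :=
  ⨆ (R : ℝ) (_ : 0 < R ∧ Metric.ball (0 : E n) (R + 2) ⊆ Ω) (x₀ ∈ Metric.ball (0 : E n) R),
    holderSeminorm α u (Metric.ball x₀ 1)

/-- `u ∈ C^α_loc(Ω)`. -/
def MemHolderLoc {n : ℕ} (α : ℝ) (Ω : Set (E n)) (u : E n → ℝ) : Prop :=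
  ∀ K : Set (E n), IsCompact K → K ⊆ Ω → holderSeminorm α u K < ⊤

/-- `u ∈ C_B^α(Ω)`. -/
def MemCB {n : ℕ} (α : ℝ) (Ω : Set (E n)) (u : E n → ℝ) : Prop :=
  MemHolderLoc α Ω u ∧ ballHolderSeminorm α u Ω < ⊤

end

end DensityEstimates

namespace DensityEstimates
noncomputable section

/-! Write ϑ for θ_* and V(ρ) for the measure of B_ρ ∩ {u > ϑ}. The core of the theorem is V(ρ) ≥ C
ρ^n. The integral in the conclusion enters only at the end, when {u > ϑ} is covered by {θ_* < u ≤
θ^*} and {u > θ₂} and the first set is measured by Chebyshev's inequality. The growth of V comes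
from two opposite estimates on the layer D where (ϑ - 1)/2 < u ≤ ϑ, inside a cube of half side ρ.

From below (`exists_transition_layer`): on an axis-parallel line through a point of {u > ϑ}, either
u stays above (ϑ - 1)/2 across the whole cube, or Hölder continuity makes it spend a definite length
in the layer. A Loomis–Whitney type inequality turns this into V^{(n-1)/n} ≲ |D| + V/ρ.

From above (`layer_measure_le`): compare u with min(u, z - 1), where z is a positive barrier equal
to 2 outside a ball and satisfying (1-s) ∫ k(x-y) |z(y)-z(x)|^{p-2}(z(y)-z(x)) dy ≤ (c₁/p) z^{m-1}
for every truncation k of the kernel. By convexity (`kinetic_min_le`) the kinetic cost of the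
competitor is at most ∫ c₁ (u - w) z^{m-1} over {u > w}, with w = z - 1. This is exactly what the
first term of the growth condition on W repays. The second term is left over and controls |D|.
Points with u > -1 + q contribute an error ≲ z^{m-1}, so |D| ≲ ε + ∫ z^{m-1} over the part of the
ball where u > ϑ.

The barrier is a minimum of radial bowls of dyadic widths (`exists_barrier`), and z^{m-1} decays
like the distance to the boundary sphere to the power -s₀p. Since s₀p > 1, this is summable over
concentric unit steps. Averaging over N concentric balls therefore gives |D| ≲ ε + V/N, with V taken
on the doubled ball (`exists_layer_estimate`).

Since V ≥ c₀ from the start, a small ε is absorbed, and the two estimates combine to N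
V(N)^{(n-1)/n} ≲ V(CN). Iterating yields N^n (`growth_of_recursion`). Uniformity in s holds because
the near part of the kernel costs 1/(1-s), which the prefactor 1-s cancels
(`exists_nonlocal_bowl_le`), while the far part only needs sp > 1. -/

/-! ### Convexity of `|t|^p` and second differences of its derivative. -/

/-- The odd power `|t|^{p-2} t`, which is `1/p` times the derivative of `|t|^p`. -/
def flux (p t : ℝ) : ℝ := |t| ^ (p - 2) * t

lemma flux_neg (p t : ℝ) : flux p (-t) = -flux p t := by simp [flux]

lemma flux_of_nonneg {p t : ℝ} (hp : 1 < p) (ht : 0 ≤ t) : flux p t = t ^ (p - 1) := by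
  rcases ht.eq_or_lt with rfl | ht
  · simp [flux, Real.zero_rpow (by linarith : p - 1 ≠ 0)]
  · rw [flux, abs_of_pos ht, show p - 1 = p - 2 + 1 by ring, Real.rpow_add_one ht.ne']

lemma flux_of_nonpos {p t : ℝ} (hp : 1 < p) (ht : t ≤ 0) : flux p t = -(-t) ^ (p - 1) := by
  rw [← flux_of_nonneg hp (neg_nonneg.2 ht), flux_neg, neg_neg]

lemma abs_flux {p t : ℝ} (hp : 1 < p) : |flux p t| = |t| ^ (p - 1) := by
  rcases le_total 0 t with h | h
  · rw [flux_of_nonneg hp h, abs_of_nonneg (Real.rpow_nonneg h _), abs_of_nonneg h]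
  · rw [flux_of_nonpos hp h, abs_neg, abs_of_nonneg (Real.rpow_nonneg (by linarith) _),
      abs_of_nonpos h]

lemma measurable_flux (p : ℝ) : Measurable (flux p) := by
  unfold flux; fun_prop

lemma hasDerivAt_abs_rpow_flux {p : ℝ} (hp : 1 < p) (x : ℝ) :
    HasDerivAt (fun x : ℝ => |x| ^ p) (p * flux p x) x := by
  have := hasDerivAt_abs_rpow x hp
  rwa [mul_assoc] at this

lemma convexOn_abs_rpow {p : ℝ} (hp : 1 < p) : ConvexOn ℝ univ (fun x : ℝ => |x| ^ p) := by
  refine ⟨convex_univ, fun x _ y _ a b ha hb hab => ?_⟩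
  have h1 : |a • x + b • y| ≤ a * |x| + b * |y| := by
    refine (abs_add_le _ _).trans ?_
    simp [abs_mul, abs_of_nonneg ha, abs_of_nonneg hb]
  calc |a • x + b • y| ^ p ≤ (a * |x| + b * |y|) ^ p :=
        Real.rpow_le_rpow (abs_nonneg _) h1 (by linarith)
    _ ≤ a • |x| ^ p + b • |y| ^ p :=
        (convexOn_rpow hp.le).2 (abs_nonneg x) (abs_nonneg y) ha hb hab

lemma flux_mono {p : ℝ} (hp : 1 < p) : Monotone (flux p) := by
  have h := (convexOn_abs_rpow hp).monotoneOn_deriv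
    (fun x _ => (hasDerivAt_abs_rpow_flux hp x).differentiableAt)
  intro x y hxy
  have h2 := h (mem_univ x) (mem_univ y) hxy
  rw [(hasDerivAt_abs_rpow_flux hp x).deriv, (hasDerivAt_abs_rpow_flux hp y).deriv] at h2
  exact le_of_mul_le_mul_left h2 (by linarith)

lemma abs_rpow_tangent_le {p : ℝ} (hp : 1 < p) (b c : ℝ) :
    |b| ^ p + p * flux p b * (c - b) ≤ |c| ^ p := by
  have hc := convexOn_abs_rpow hp
  have hd := hasDerivAt_abs_rpow_flux hp b
  rcases lt_trichotomy b c with h | h | h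
  · have := hc.le_slope_of_hasDerivAt (mem_univ b) (mem_univ c) h hd
    rw [slope_def_field, le_div_iff₀ (by linarith)] at this
    linarith
  · simp [h]
  · have := hc.slope_le_of_hasDerivAt (mem_univ c) (mem_univ b) h hd
    rw [slope_def_field, div_le_iff₀ (by linarith)] at this
    linarith

/-- Put v = min(u, w) and φ = u - v. The tangent inequality at v₁ - v₂ gives the claim with `flux`
evaluated at v₂ - v₁. Passing to w₂ - w₁ only helps, because `flux` is monotone and φ is nonzero
only where v = w, while v ≤ w at the other point. The error is thus linear in φ with a coefficient
that involves w alone. -/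
lemma abs_sub_min_rpow_le {p : ℝ} (hp : 1 < p) (u₁ u₂ w₁ w₂ : ℝ) :
    |min u₁ w₁ - min u₂ w₂| ^ p ≤ |u₁ - u₂| ^ p +
      p * flux p (w₂ - w₁) * ((u₁ - min u₁ w₁) - (u₂ - min u₂ w₂)) := by
  have hodd : flux p (w₂ - w₁) = -flux p (w₁ - w₂) := by rw [← flux_neg]; congr 1; ring
  have hp0 : 0 < p := by linarith
  rcases le_total u₁ w₁ with h1 | h1 <;> rcases le_total u₂ w₂ with h2 | h2
  · simp [min_eq_left h1, min_eq_left h2]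
  · rw [min_eq_left h1, min_eq_right h2]
    have h3 := abs_rpow_tangent_le hp (u₁ - w₂) (u₁ - u₂)
    have h4 : flux p (u₁ - w₂) ≤ flux p (w₁ - w₂) := flux_mono hp (by linarith)
    have h5 : 0 ≤ p * (flux p (w₁ - w₂) - flux p (u₁ - w₂)) * (u₂ - w₂) :=
      mul_nonneg (mul_nonneg hp0.le (by linarith)) (by linarith)
    rw [hodd]; nlinarith
  · rw [min_eq_right h1, min_eq_left h2]
    have h3 := abs_rpow_tangent_le hp (w₁ - u₂) (u₁ - u₂)
    have h4 : flux p (w₁ - w₂) ≤ flux p (w₁ - u₂) := flux_mono hp (by linarith)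
    have h5 : 0 ≤ p * (flux p (w₁ - u₂) - flux p (w₁ - w₂)) * (u₁ - w₁) :=
      mul_nonneg (mul_nonneg hp0.le (by linarith)) (by linarith)
    rw [hodd]; nlinarith
  · rw [min_eq_right h1, min_eq_right h2]
    have h3 := abs_rpow_tangent_le hp (w₁ - w₂) (u₁ - u₂)
    rw [hodd]; nlinarith

/-- For `p ≤ 2` the second difference of the flux is controlled by its derivative. -/
lemma flux_second_difference_le_of_le_two {p t a : ℝ} (hp : 1 < p) (hp2 : p ≤ 2) (ht : t ≠ 0)
    (ha : 0 ≤ a) : flux p (t + a) + flux p (-t + a) ≤ 4 * |t| ^ (p - 2) * a := by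
  wlog htp : 0 < t generalizing t
  · have := this (t := -t) (neg_ne_zero.2 ht) (by
      rcases lt_or_gt_of_ne ht with h | h
      · linarith
      · exact absurd h htp)
    rw [neg_neg, abs_neg] at this
    linarith
  rw [abs_of_pos htp, flux_of_nonneg hp (by linarith : 0 ≤ t + a)]
  have hq : 0 < p - 1 := by linarith
  have hpow : ∀ y : ℝ, 0 < y → y ^ (p - 1) = y ^ (p - 2) * y := fun y hy => by
    rw [← Real.rpow_add_one hy.ne']; ring_nf
  have hdec : ∀ x y : ℝ, 0 < x → x ≤ y → y ^ (p - 2) ≤ x ^ (p - 2) := fun x y hx hxy =>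
    Real.rpow_le_rpow_of_nonpos hx hxy (by linarith)
  have ht2 : 0 ≤ t ^ (p - 2) := Real.rpow_nonneg htp.le _
  rcases lt_or_ge a t with h | h
  · rw [flux_of_nonpos hp (by linarith : -t + a ≤ 0), show -(-t + a) = t - a by ring,
      hpow _ (by linarith), hpow (t - a) (by linarith)]
    have h1 := hdec t (t + a) htp (by linarith)
    have h2 := hdec (t - a) (t + a) (by linarith) (by linarith)
    nlinarith [mul_le_mul_of_nonneg_right h2 (by linarith : 0 ≤ t - a),
      mul_le_mul_of_nonneg_right h1 ha]
  · have hapos : 0 < a := by linarith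
    rw [flux_of_nonneg hp (by linarith : 0 ≤ -t + a), hpow (t + a) (by linarith)]
    have h1 := hdec t (t + a) htp (by linarith)
    have h2 : (-t + a) ^ (p - 1) ≤ a ^ (p - 1) :=
      Real.rpow_le_rpow (by linarith) (by linarith) hq.le
    rw [hpow a hapos] at h2
    have h3 := hdec t a htp h
    nlinarith [mul_le_mul_of_nonneg_right h3 ha, mul_le_mul_of_nonneg_right h1
      (by linarith : 0 ≤ t + a)]

/-- For p ≥ 2 the derivative of the flux increases with the modulus, so it is controlled by its size
at |t| + a and no singularity at t = 0 appears. -/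
lemma flux_second_difference_le_of_two_le {p t a : ℝ} (hp2 : 2 ≤ p)
    (ha : 0 ≤ a) : flux p (t + a) + flux p (-t + a) ≤ 2 * p * (|t| + a) ^ (p - 2) * a := by
  wlog htp : 0 ≤ t generalizing t
  · have := this (t := -t) (by linarith)
    rw [neg_neg, abs_neg] at this
    linarith
  have hp : 1 < p := by linarith
  rw [abs_of_nonneg htp, flux_of_nonneg hp (by linarith : 0 ≤ t + a)]
  rcases ha.eq_or_lt with rfl | hapos
  · rw [add_zero, add_zero, flux_neg, flux_of_nonneg hp htp]; simp
  have hs : 0 < t + a := by linarith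
  have hpow : ∀ y : ℝ, 0 < y → y ^ (p - 1) = y ^ (p - 2) * y := fun y hy => by
    rw [← Real.rpow_add_one hy.ne']; ring_nf
  have hX : 0 ≤ (t + a) ^ (p - 2) := Real.rpow_nonneg hs.le _
  rcases lt_or_ge a t with h | h
  · rw [flux_of_nonpos hp (by linarith : -t + a ≤ 0), show -(-t + a) = t - a by ring]
    -- Bernoulli at the ratio (t-a)/(t+a) bounds (t-a)^{p-1} below by (t+a)^{p-1} - 2(p-1) a
    -- (t+a)^{p-2}.
    have hb := one_add_mul_self_le_rpow_one_add (s := (t - a) / (t + a) - 1)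
      (by have : 0 ≤ (t - a) / (t + a) := div_nonneg (by linarith) hs.le
          linarith) (p := p - 1) (by linarith)
    rw [show 1 + ((t - a) / (t + a) - 1) = (t - a) / (t + a) by ring,
      Real.div_rpow (by linarith) hs.le, le_div_iff₀ (Real.rpow_pos_of_pos hs _),
      hpow _ hs] at hb
    rw [hpow _ hs]
    have e : (1 + (p - 1) * ((t - a) / (t + a) - 1)) * ((t + a) ^ (p - 2) * (t + a)) =
        (t + a) ^ (p - 2) * (t + a) - (p - 1) * (t + a) ^ (p - 2) * (2 * a) := by
      field_simp; ring
    rw [e] at hb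
    nlinarith [mul_nonneg hX ha]
  · rw [flux_of_nonneg hp (by linarith : 0 ≤ -t + a)]
    have h1 : (-t + a) ^ (p - 1) ≤ (t + a) ^ (p - 2) * (-t + a) := by
      rcases (by linarith : 0 ≤ -t + a).eq_or_lt with h0 | h0
      · rw [← h0, Real.zero_rpow (by linarith)]; simp
      · rw [hpow _ h0]
        exact mul_le_mul_of_nonneg_right
          (Real.rpow_le_rpow h0.le (by linarith) (by linarith)) h0.le
    rw [hpow _ hs]
    nlinarith [mul_nonneg hX ha]

/-- Second-order expansion of a power from above. -/
lemma one_add_rpow_le {β r : ℝ} (hβ : 2 ≤ β) (hr : -1 < r) (hr1 : r ≤ 1) :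
    (1 + r) ^ β ≤ 1 + β * r + β * (β - 1) * 2 ^ (β - 2) * r ^ 2 := by
  have hs : 0 < 1 + r := by linarith
  -- The tangent line to y^b at y = 1 + r, read at y = 1, bounds (1+r)^b from above. It is used for
  -- β and, when r ≥ 0, once more for β - 1.
  have key : ∀ b : ℝ, 1 ≤ b → (1 + r) ^ b ≤ 1 + b * r * (1 + r) ^ (b - 1) := fun b hb => by
    have h := one_add_mul_self_le_rpow_one_add (s := 1 / (1 + r) - 1)
      (by have : 0 ≤ 1 / (1 + r) := by positivity
          linarith) (p := b) hb
    rw [show 1 + (1 / (1 + r) - 1) = 1 / (1 + r) by ring, Real.div_rpow (by norm_num) hs.le,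
      le_div_iff₀ (Real.rpow_pos_of_pos hs _), Real.one_rpow,
      show b = b - 1 + 1 by ring, Real.rpow_add_one hs.ne'] at h
    have e : (1 + (b - 1 + 1) * (1 / (1 + r) - 1)) * ((1 + r) ^ (b - 1) * (1 + r)) =
      (1 + r) ^ (b - 1) * (1 + r) - b * r * (1 + r) ^ (b - 1) := by
      field_simp; ring
    rw [e] at h
    conv_lhs => rw [show b = b - 1 + 1 by ring, Real.rpow_add_one hs.ne']
    linarith
  have h2 : (1:ℝ) ≤ 2 ^ (β - 2) := Real.one_le_rpow (by norm_num) (by linarith)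
  have h1 := key β (by linarith)
  suffices r * (1 + r) ^ (β - 1) ≤ r + (β - 1) * 2 ^ (β - 2) * r ^ 2 by nlinarith
  rcases le_total 0 r with h | h
  · have h3 := key (β - 1) (by linarith)
    have h4 : (1 + r) ^ (β - 1 - 1) ≤ 2 ^ (β - 2) := by
      rw [show β - 1 - 1 = β - 2 by ring]
      exact Real.rpow_le_rpow hs.le (by linarith) (by linarith)
    have h5 : (1 + r) ^ (β - 1) ≤ 1 + (β - 1) * r * 2 ^ (β - 2) :=
      h3.trans (by
        have : 0 ≤ (β - 1) * r := mul_nonneg (by linarith) h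
        nlinarith)
    nlinarith [mul_le_mul_of_nonneg_left h5 h]
  · have h3 := one_add_mul_self_le_rpow_one_add (s := r) hr.le (p := β - 1) (by linarith)
    have h5 := mul_le_mul_of_nonpos_left h3 h
    have h6 : 0 ≤ (β - 1) * r ^ 2 := mul_nonneg (by linarith) (sq_nonneg r)
    nlinarith

/-! ### Kernel integrals in polar coordinates, with explicit dependence on the exponent. -/

/-- Separates the angular singularity |e·ω|^{p-2}, whose integral does not involve s, from the
radial factor, which carries all dependence on s. -/
lemma lintegral_polar {n : ℕ} (hn : 1 ≤ n) {Θ : E n → ENNReal} (hΘ : Measurable Θ)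
    {ρ : ℝ → ENNReal} (hρ : Measurable ρ) :
    ∫⁻ h : E n, Θ (‖h‖⁻¹ • h) * ρ ‖h‖ =
      (∫⁻ ω, Θ ω ∂((volume : Measure (E n)).toSphere)) *
        ∫⁻ r in Ioi (0 : ℝ), ENNReal.ofReal (r ^ (n - 1)) * ρ r := by
  have : Nonempty (Fin n) := ⟨⟨0, hn⟩⟩
  have hm := (volume : Measure (E n)).measurePreserving_homeomorphUnitSphereProd
  have h1 : ∫⁻ h : E n, Θ (‖h‖⁻¹ • h) * ρ ‖h‖ =
      ∫⁻ x : ({0}ᶜ : Set (E n)), Θ (‖x.1‖⁻¹ • x.1) * ρ ‖x.1‖ ∂(Measure.comap Subtype.val volume) := by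
    rw [lintegral_subtype_comap (measurableSet_singleton _).compl
      (fun h : E n => Θ (‖h‖⁻¹ • h) * ρ ‖h‖), restrict_compl_singleton]
  rw [h1]
  have h2 := hm.lintegral_comp_emb (Homeomorph.measurableEmbedding _)
    (fun z : Metric.sphere (0 : E n) 1 × Ioi (0 : ℝ) => Θ z.1 * ρ z.2)
  have h3 : ∀ x : ({0}ᶜ : Set (E n)), Θ (‖x.1‖⁻¹ • x.1) * ρ ‖x.1‖ =
      Θ ((homeomorphUnitSphereProd (E n) x).1 : E n) *
        ρ ((homeomorphUnitSphereProd (E n) x).2 : ℝ) := fun x => by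
    simp [homeomorphUnitSphereProd]
  simp_rw [h3]
  rw [h2, lintegral_prod_mul (f := fun ω : Metric.sphere (0 : E n) 1 => Θ ω)
    (g := fun r : Ioi (0 : ℝ) => ρ r) (hΘ.comp measurable_subtype_coe).aemeasurable
    (hρ.comp measurable_subtype_coe).aemeasurable]
  congr 1
  rw [Measure.volumeIoiPow, lintegral_withDensity_eq_lintegral_mul _ (by fun_prop)
    (g := fun r : Ioi (0 : ℝ) => ρ r) (hρ.comp measurable_subtype_coe)]
  simp only [finrank_euclideanSpace, Fintype.card_fin, Pi.mul_apply]
  rw [← lintegral_subtype_comap measurableSet_Ioi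
    (fun r : ℝ => ENNReal.ofReal (r ^ (n - 1)) * ρ r)]

/-- The factor 1/a is kept explicit: for a = p(1-s) it is the blow-up that the prefactor 1-s of the
energy cancels. -/
lemma lintegral_Ioi_rpow_near {n : ℕ} (hn : 1 ≤ n) {a L : ℝ} (ha : 0 < a) (hL : 0 < L) :
    ∫⁻ r in Ioi (0 : ℝ), ENNReal.ofReal (r ^ (n - 1)) *
      (Iio L).indicator (fun r => ENNReal.ofReal (r ^ (a - n))) r = ENNReal.ofReal (L ^ a / a) := by
  have hi : IntervalIntegrable (fun r : ℝ => r ^ (a - 1)) volume 0 L :=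
    intervalIntegral.intervalIntegrable_rpow' (by linarith)
  have h2 : ∫⁻ r in Ioc (0 : ℝ) L, ENNReal.ofReal (r ^ (a - 1)) = ENNReal.ofReal (L ^ a / a) := by
    rw [← ofReal_integral_eq_lintegral_ofReal
      ((intervalIntegrable_iff_integrableOn_Ioc_of_le hL.le).1 hi),
      ← intervalIntegral.integral_of_le hL.le, integral_rpow (Or.inl (by linarith))]
    · simp [Real.zero_rpow ha.ne']
    · filter_upwards [ae_restrict_mem measurableSet_Ioc] with r hr
      exact Real.rpow_nonneg hr.1.le _
  rw [← h2, setLIntegral_congr (Ioo_ae_eq_Ioc (a := (0 : ℝ)) (b := L)).symm,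
    ← lintegral_indicator measurableSet_Ioi, ← lintegral_indicator measurableSet_Ioo]
  congr 1 with r
  by_cases h0 : 0 < r <;> by_cases hr : r < L <;> simp [h0, hr]
  rw [← ENNReal.ofReal_mul (by positivity), ← Real.rpow_natCast, ← Real.rpow_add h0]
  congr 2
  push_cast [Nat.cast_sub hn]; ring

lemma lintegral_Ioi_rpow_far {n : ℕ} (hn : 1 ≤ n) {a L : ℝ} (ha : 0 < a) (hL : 0 < L) :
    ∫⁻ r in Ioi (0 : ℝ), ENNReal.ofReal (r ^ (n - 1)) *
      (Ici L).indicator (fun r => ENNReal.ofReal (r ^ (-(n + a)))) r =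
      ENNReal.ofReal (L ^ (-a) / a) := by
  have h2 : ∫⁻ r in Ioi L, ENNReal.ofReal (r ^ (-a - 1)) = ENNReal.ofReal (L ^ (-a) / a) := by
    rw [← ofReal_integral_eq_lintegral_ofReal (integrableOn_Ioi_rpow_of_lt (by linarith) hL),
      integral_Ioi_rpow_of_lt (by linarith) hL]
    · congr 1
      rw [show -a - 1 + 1 = -a by ring, neg_div_neg_eq]
    · filter_upwards [ae_restrict_mem measurableSet_Ioi] with r hr
      exact Real.rpow_nonneg (hL.trans hr).le _
  rw [← h2, setLIntegral_congr (Ioi_ae_eq_Ici (a := L)),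
    ← lintegral_indicator measurableSet_Ioi, ← lintegral_indicator measurableSet_Ici]
  congr 1 with r
  by_cases hr : L ≤ r
  · have h0 : 0 < r := hL.trans_le hr
    simp only [mem_Ioi, h0, indicator_of_mem, mem_Ici, hr]
    rw [← ENNReal.ofReal_mul (by positivity), ← Real.rpow_natCast, ← Real.rpow_add h0]
    congr 2
    push_cast [Nat.cast_sub hn]; ring
  · by_cases h0 : 0 < r <;> simp [h0, hr]

/-- Tail of the kernel. -/
lemma exists_lintegral_kernel_far_le {n : ℕ} (hn : 1 ≤ n) :
    ∃ C : ℝ, 0 < C ∧ ∀ a L : ℝ, 0 < a → 0 < L →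
      ∫⁻ h in (Metric.ball (0 : E n) L)ᶜ, ENNReal.ofReal (‖h‖ ^ (-(n + a))) ≤
        ENNReal.ofReal (C * (L ^ (-a) / a)) := by
  refine ⟨((volume : Measure (E n)).toSphere univ).toReal + 1, by positivity,
    fun a L ha hL => ?_⟩
  have h := lintegral_polar hn (Θ := fun _ => 1) measurable_const
    (ρ := (Ici L).indicator (fun r => ENNReal.ofReal (r ^ (-(n + a)))))
    (Measurable.indicator (by fun_prop) measurableSet_Ici)
  rw [lintegral_Ioi_rpow_far hn ha hL] at h
  rw [← lintegral_indicator measurableSet_ball.compl]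
  calc _ = ∫⁻ h : E n, 1 * (Ici L).indicator (fun r => ENNReal.ofReal (r ^ (-(n + a)))) ‖h‖ := by
        congr 1 with x
        by_cases hx : L ≤ ‖x‖ <;> simp [indicator, hx]
    _ = _ := h
    _ ≤ _ := by
        rw [ENNReal.ofReal_mul (by positivity)]
        gcongr
        simp only [lintegral_const, one_mul]
        rw [← ENNReal.ofReal_toReal (measure_ne_top (volume : Measure (E n)).toSphere univ)]
        exact ENNReal.ofReal_le_ofReal (by simp)

/-- A reflection carries e to a coordinate vector, which makes the bound independent of e. The unit
ball lies in a cube on which the integrand is a product of one-variable functions, and |t|^{p-2} is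
integrable near 0 because p > 1. -/
lemma lintegral_ball_abs_inner_rpow {n : ℕ} (hn : 1 ≤ n) {p : ℝ} (hp : 1 < p) :
    ∃ C : ENNReal, C ≠ ⊤ ∧ ∀ e : E n, ‖e‖ = 1 →
      ∫⁻ h in Metric.ball (0 : E n) 1, ENNReal.ofReal (|inner ℝ e h| ^ (p - 2)) ≤ C := by
  let i₀ : Fin n := ⟨0, hn⟩
  let f : Fin n → ℝ → ℝ := fun i =>
    (Ioo (-1 : ℝ) 1).indicator (fun t => if i = i₀ then |t| ^ (p - 2) else 1)
  have hf : ∀ i, Integrable (f i) := by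
    intro i
    rw [integrable_indicator_iff measurableSet_Ioo]
    by_cases hi : i = i₀
    · simp only [hi, if_true]
      have h1 : IntegrableOn (fun t : ℝ => |t| ^ (p - 2)) (Ioo (0:ℝ) 1) := by
        have : IntegrableOn (fun t : ℝ => t ^ (p - 2)) (Ioo (0:ℝ) 1) :=
          (intervalIntegral.integrableOn_Ioo_rpow_iff one_pos).2 (by linarith)
        exact this.congr_fun (fun t ht => by rw [abs_of_pos ht.1]) measurableSet_Ioo
      have h2 : IntegrableOn (fun t : ℝ => |t| ^ (p - 2)) (Ioo (-1:ℝ) 0) := by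
        have := h1.comp_neg
        simpa using this
      have h3 : IntegrableOn (fun t : ℝ => |t| ^ (p - 2)) (Ioo (-1:ℝ) 0 ∪ Ico 0 1) :=
        h2.union ((integrableOn_Ico_iff_integrableOn_Ioo (by simp)).2 h1)
      exact h3.mono_set (fun t ht => by
        rcases lt_or_ge t 0 with h | h
        · exact Or.inl ⟨ht.1, h⟩
        · exact Or.inr ⟨h, ht.2⟩)
    · simp only [hi, if_false]
      simp
  have hprod : Integrable (fun x : Fin n → ℝ => ∏ i, f i (x i)) := Integrable.fintype_prod hf
  have hprod' : Integrable (fun x : E n => ∏ i, f i (x i)) := by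
    have := (PiLp.volume_preserving_ofLp (Fin n)).integrable_comp_of_integrable hprod
    exact this
  refine ⟨∫⁻ x : E n, ENNReal.ofReal (∏ i, f i (x i)), hprod'.lintegral_lt_top.ne, fun e he => ?_⟩
  let b : E n := EuclideanSpace.single i₀ 1
  have hb : ‖b‖ = 1 := by simp [b]
  let O := (ℝ ∙ (e - b))ᗮ.reflection
  have hO : O e = b := Submodule.reflection_sub (by rw [he, hb])
  have hOb : O b = e := by rw [← hO]; exact Submodule.reflection_reflection _ _
  rw [← lintegral_indicator measurableSet_ball, ← O.measurePreserving.lintegral_comp_emb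
    O.toHomeomorph.measurableEmbedding]
  refine lintegral_mono fun x => ?_
  by_cases hx : ‖x‖ < 1
  · have hx' : O x ∈ Metric.ball (0 : E n) 1 := by simpa using hx
    rw [indicator_of_mem hx']
    have hin : inner ℝ e (O x) = x i₀ := by
      rw [← hOb, LinearIsometryEquiv.inner_map_map]
      simp [b, EuclideanSpace.inner_single_left]
    rw [hin]
    have hxi : ∀ i, x i ∈ Ioo (-1:ℝ) 1 := fun i => by
      have := (PiLp.norm_apply_le x i).trans_lt hx
      rwa [Real.norm_eq_abs, abs_lt] at this
    apply ENNReal.ofReal_le_ofReal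
    have : ∀ i, f i (x i) = if i = i₀ then |x i₀| ^ (p - 2) else 1 := fun i => by
      simp only [f, indicator_of_mem (hxi i)]
      split_ifs with h <;> simp [h]
    simp [this]
  · have hx' : O x ∉ Metric.ball (0 : E n) 1 := by simpa using hx
    rw [indicator_of_notMem hx']
    exact zero_le

/-- Near part of the kernel, with an angular singularity. -/
lemma exists_lintegral_kernel_near_le {n : ℕ} (hn : 1 ≤ n) {p : ℝ} (hp : 1 < p) :
    ∃ C : ℝ, 0 < C ∧ ∀ e : E n, ‖e‖ = 1 → ∀ a L : ℝ, 0 < a → 0 < L →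
      ∫⁻ h in Metric.ball (0 : E n) L,
        ENNReal.ofReal (|inner ℝ e h| ^ (p - 2) * ‖h‖ ^ (a - n - (p - 2))) ≤
        ENNReal.ofReal (C * (L ^ a / a)) := by
  obtain ⟨C₁, hC₁, hC⟩ := lintegral_ball_abs_inner_rpow hn hp
  have hn' : (1 : ℝ) ≤ n := by exact_mod_cast hn
  have key : ∀ e : E n, ‖e‖ = 1 → ∀ a L : ℝ, 0 < a → 0 < L →
      ∫⁻ h in Metric.ball (0 : E n) L,
        ENNReal.ofReal (|inner ℝ e h| ^ (p - 2) * ‖h‖ ^ (a - n - (p - 2))) =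
      (∫⁻ ω, ENNReal.ofReal (|inner ℝ e (ω : E n)| ^ (p - 2)) ∂((volume : Measure (E n)).toSphere)) *
        ENNReal.ofReal (L ^ a / a) := by
    intro e he a L ha hL
    have h := lintegral_polar hn (Θ := fun h : E n => ENNReal.ofReal (|inner ℝ e h| ^ (p - 2)))
      (by fun_prop) (ρ := (Iio L).indicator (fun r => ENNReal.ofReal (r ^ (a - n))))
      (Measurable.indicator (by fun_prop) measurableSet_Iio)
    rw [lintegral_Ioi_rpow_near hn ha hL] at h
    rw [← h, ← lintegral_indicator measurableSet_ball]
    refine lintegral_congr_ae ?_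
    have : Nonempty (Fin n) := ⟨⟨0, hn⟩⟩
    filter_upwards [compl_mem_ae_iff.2 (measure_singleton (μ := (volume : Measure (E n))) 0)]
      with x hx0
    have hx0' : 0 < ‖x‖ := norm_pos_iff.2 hx0
    by_cases hx : ‖x‖ < L
    · rw [indicator_of_mem (by simpa using hx), indicator_of_mem (by simpa using hx),
        ← ENNReal.ofReal_mul (by positivity)]
      congr 1
      rw [real_inner_smul_right, abs_mul, abs_of_pos (inv_pos.2 hx0'),
        Real.mul_rpow (by positivity) (by positivity), Real.inv_rpow hx0'.le,
        ← Real.rpow_neg hx0'.le, show a - n - (p - 2) = -(p - 2) + (a - n) by ring,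
        Real.rpow_add hx0']
      ring
    · rw [indicator_of_notMem (by simpa using hx), indicator_of_notMem (by simpa using hx),
        mul_zero]
  have hS : ∀ e : E n, ‖e‖ = 1 →
      (∫⁻ ω, ENNReal.ofReal (|inner ℝ e (ω : E n)| ^ (p - 2)) ∂((volume : Measure (E n)).toSphere))
        ≤ C₁ * ENNReal.ofReal (n + (p - 2)) := by
    intro e he
    have hq : 0 < (n : ℝ) + (p - 2) := by linarith
    -- With this a and L = 1 the radial powers cancel, so the polar identity bounds the spherical
    -- integral by the integral over the unit ball.
    have h := key e he (n + (p - 2)) 1 hq one_pos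
    simp only [Real.one_rpow] at h
    have h2 := hC e he
    have h3 : ∫⁻ h in Metric.ball (0 : E n) 1,
        ENNReal.ofReal (|inner ℝ e h| ^ (p - 2) * ‖h‖ ^ ((n:ℝ) + (p - 2) - n - (p - 2))) =
        ∫⁻ h in Metric.ball (0 : E n) 1, ENNReal.ofReal (|inner ℝ e h| ^ (p - 2)) := by
      congr 1 with x
      rw [show (n:ℝ) + (p - 2) - n - (p - 2) = 0 by ring]; simp
    rw [← h3, h] at h2
    refine le_trans (le_of_eq ?_) (mul_le_mul_left h2 (ENNReal.ofReal (n + (p - 2))))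
    rw [mul_assoc, ← ENNReal.ofReal_mul (by positivity), one_div_mul_cancel hq.ne']; simp
  have hfin : C₁ * ENNReal.ofReal (n + (p - 2)) ≠ ⊤ := ENNReal.mul_ne_top hC₁ ENNReal.ofReal_ne_top
  refine ⟨(C₁ * ENNReal.ofReal (n + (p - 2))).toReal + 1, by positivity, fun e he a L ha hL => ?_⟩
  rw [key e he a L ha hL, ENNReal.ofReal_mul (by positivity)]
  gcongr
  refine (hS e he).trans ?_
  rw [← ENNReal.ofReal_toReal hfin]
  exact ENNReal.ofReal_le_ofReal (by simp)

/-! ### Bowls and their second-order expansion. -/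

/-- A radial bowl: constant `a` on the ball of radius `ℓ`, with value `a + 2` at radius `ℓ + L`. -/
def bowl {n : ℕ} (β ℓ L a : ℝ) (y : E n) : ℝ := a + 2 * (max (‖y‖ - ℓ) 0 / L) ^ β

lemma norm_add_le_of_inner {n : ℕ} {x h : E n} (hx : x ≠ 0) (hh : ‖h‖ ≤ ‖x‖) :
    ‖x + h‖ ≤ ‖x‖ + (inner ℝ (‖x‖⁻¹ • x) h + ‖h‖ ^ 2 / (2 * ‖x‖)) := by
  have hx0 : 0 < ‖x‖ := norm_pos_iff.2 hx
  have hi : |inner ℝ (‖x‖⁻¹ • x) h| ≤ ‖h‖ := by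
    refine (abs_real_inner_le_norm _ _).trans ?_
    rw [norm_smul, norm_inv, norm_norm, inv_mul_cancel₀ hx0.ne', one_mul]
  have hnn : 0 ≤ ‖x‖ + (inner ℝ (‖x‖⁻¹ • x) h + ‖h‖ ^ 2 / (2 * ‖x‖)) := by
    have := (abs_le.1 hi).1
    have : 0 ≤ ‖h‖ ^ 2 / (2 * ‖x‖) := by positivity
    linarith
  refine le_of_abs_le (abs_le_of_sq_le_sq ?_ hnn)
  rw [norm_add_sq_real]
  have h1 : inner ℝ x h = ‖x‖ * inner ℝ (‖x‖⁻¹ • x) h := by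
    rw [real_inner_smul_left]; field_simp
  rw [h1]
  have h2 : ‖x‖ * (‖h‖ ^ 2 / (2 * ‖x‖)) = ‖h‖ ^ 2 / 2 := by field_simp
  nlinarith [sq_nonneg (inner ℝ (‖x‖⁻¹ • x) h + ‖h‖ ^ 2 / (2 * ‖x‖))]

/-- Write t = ‖x‖ - ℓ and let r be (e·h + ‖h‖²/(2t))/t, with e the unit vector along x. Then ‖x+h‖ -
ℓ ≤ t(1+r), and `one_add_rpow_le` applies since 2‖h‖ < t keeps |r| < 1. The curvature term is
bounded by t instead of ‖x‖ (as ℓ ≥ 0), so the constant does not depend on ℓ. -/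
lemma bowl_expansion {n : ℕ} {β ℓ : ℝ} (hβ : 2 ≤ β) (hℓ : 0 ≤ ℓ) {x h : E n}
    (hh : 2 * ‖h‖ < ‖x‖ - ℓ) :
    (max (‖x + h‖ - ℓ) 0) ^ β ≤ (‖x‖ - ℓ) ^ β +
      β * (‖x‖ - ℓ) ^ (β - 1) * inner ℝ (‖x‖⁻¹ • x) h +
      (β / 2 + 2 * (β * (β - 1) * 2 ^ (β - 2))) * (‖x‖ - ℓ) ^ (β - 2) * ‖h‖ ^ 2 := by
  set t := ‖x‖ - ℓ with ht
  set i := inner ℝ (‖x‖⁻¹ • x) h with hi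
  have hh0 := norm_nonneg h
  have ht0 : 0 < t := by linarith
  have hx0 : 0 < ‖x‖ := by linarith
  have hx : x ≠ 0 := norm_pos_iff.1 hx0
  have hile : |i| ≤ ‖h‖ := by
    refine (abs_real_inner_le_norm _ _).trans ?_
    rw [norm_smul, norm_inv, norm_norm, inv_mul_cancel₀ hx0.ne', one_mul]
  have h1 := norm_add_le_of_inner hx (h := h) (by linarith)
  rw [← hi] at h1
  set q := i + ‖h‖ ^ 2 / (2 * t) with hq
  have h2 : ‖h‖ ^ 2 / (2 * ‖x‖) ≤ ‖h‖ ^ 2 / (2 * t) := by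
    gcongr; linarith
  have h3 : ‖h‖ ^ 2 / (2 * t) ≤ ‖h‖ / 4 := by
    rw [div_le_iff₀ (by positivity)]; nlinarith
  have h3' : 0 ≤ ‖h‖ ^ 2 / (2 * t) := by positivity
  have hqabs : |q| ≤ 5 / 4 * ‖h‖ := by
    rw [abs_le] at hile ⊢; constructor <;> linarith [hile.1, hile.2]
  have hq2 : q ^ 2 ≤ 2 * ‖h‖ ^ 2 := by
    have := sq_le_sq' (by linarith [(abs_le.1 hqabs).1]) (abs_le.1 hqabs).2
    nlinarith
  set r := q / t with hr
  have hqr : q = t * r := by rw [hr]; field_simp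
  have hr1 : |r| < 1 := by
    rw [hr, abs_div, abs_of_pos ht0, div_lt_one ht0]; linarith
  have hs : 0 < 1 + r := by linarith [(abs_lt.1 hr1).1]
  have h4 : max (‖x + h‖ - ℓ) 0 ≤ t * (1 + r) := by
    refine max_le ?_ (by positivity)
    have : t * (1 + r) = t + q := by rw [hqr]; ring
    rw [this]; linarith
  have h5 := one_add_rpow_le hβ (abs_lt.1 hr1).1 (abs_lt.1 hr1).2.le
  set K := β * (β - 1) * 2 ^ (β - 2) with hK
  have hK0 : 0 ≤ K := mul_nonneg (mul_nonneg (by linarith) (by linarith)) (by positivity)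
  have e1 : t ^ (β - 1) = t ^ (β - 2) * t := by rw [← Real.rpow_add_one ht0.ne']; ring_nf
  have e2 : t ^ β = t ^ (β - 2) * t ^ 2 := by
    rw [← Real.rpow_natCast, ← Real.rpow_add ht0]; norm_num
  have hP : 0 ≤ t ^ (β - 2) := by positivity
  calc (max (‖x + h‖ - ℓ) 0) ^ β ≤ (t * (1 + r)) ^ β :=
        Real.rpow_le_rpow (le_max_right _ _) h4 (by linarith)
    _ = t ^ β * (1 + r) ^ β := Real.mul_rpow ht0.le hs.le
    _ ≤ t ^ β * (1 + β * r + K * r ^ 2) := by gcongr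
    _ = t ^ β + t ^ (β - 2) * (β * t * q + K * q ^ 2) := by rw [e2, hqr]; ring
    _ ≤ t ^ β + t ^ (β - 2) * (β * t * i + (β / 2 + 2 * K) * ‖h‖ ^ 2) := by
        gcongr t ^ β + t ^ (β - 2) * ?_
        have : t * q = t * i + ‖h‖ ^ 2 / 2 := by rw [hq]; field_simp
        nlinarith
    _ = _ := by rw [e1]; ring

set_option maxHeartbeats 800000 in
/-- The symmetrized flux of a function touched from above by a bowl of unit width. -/
lemma exists_flux_bowl_le {p β : ℝ} (hp : 1 < p) (hβ : 2 ≤ β) (hβp : p ≤ β * (p - 1)) :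
    ∃ C : ℝ, 0 < C ∧ ∀ {n : ℕ} (x h e : E n) (ℓ D₁ D₂ : ℝ), 0 ≤ ℓ → max (‖x‖ - ℓ) 0 ≤ 1 →
      0 < ‖h‖ → ‖h‖ ≤ 1 → (x ≠ 0 → e = ‖x‖⁻¹ • x) → inner ℝ e h ≠ 0 →
      D₁ ≤ 2 * (max (‖x + h‖ - ℓ) 0) ^ β - 2 * (max (‖x‖ - ℓ) 0) ^ β →
      D₂ ≤ 2 * (max (‖x - h‖ - ℓ) 0) ^ β - 2 * (max (‖x‖ - ℓ) 0) ^ β →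
      flux p D₁ + flux p D₂ ≤ C * (‖h‖ ^ p + |inner ℝ e h| ^ (p - 2) * ‖h‖ ^ 2) := by
  set A₀ := β / 2 + 2 * (β * (β - 1) * 2 ^ (β - 2)) with hA₀
  have hA₀pos : 0 < A₀ := by
    have : 0 ≤ β * (β - 1) * 2 ^ (β - 2) :=
      mul_nonneg (mul_nonneg (by linarith) (by linarith)) (by positivity)
    linarith
  have hc1 : 0 < 2 * (2 * 3 ^ β : ℝ) ^ (p - 1) := by positivity
  have hc2 : 0 < 4 * (2 * β) ^ (p - 2) * (2 * A₀) := by positivity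
  have hc3 : 0 < 2 * p * (2 * β + 2 * A₀) ^ (p - 2) * (2 * A₀) := by positivity
  refine ⟨2 * (2 * 3 ^ β) ^ (p - 1) + 4 * (2 * β) ^ (p - 2) * (2 * A₀) +
    2 * p * (2 * β + 2 * A₀) ^ (p - 2) * (2 * A₀), by positivity, ?_⟩
  intro n x h e ℓ D₁ D₂ hℓ ht1 hh0 hh1 he hi hD₁ hD₂
  set c₁ := 2 * (2 * 3 ^ β : ℝ) ^ (p - 1)
  set c₂ := 4 * (2 * β) ^ (p - 2) * (2 * A₀)
  set c₃ := 2 * p * (2 * β + 2 * A₀) ^ (p - 2) * (2 * A₀)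
  have hX : 0 ≤ ‖h‖ ^ p := by positivity
  have hY : 0 ≤ |inner ℝ e h| ^ (p - 2) * ‖h‖ ^ 2 := by positivity
  have hg : ∀ c Z, 0 ≤ Z → c ≤ c₁ + c₂ + c₃ → Z ≤ ‖h‖ ^ p + |inner ℝ e h| ^ (p - 2) * ‖h‖ ^ 2 →
      c * Z ≤ (c₁ + c₂ + c₃) * (‖h‖ ^ p + |inner ℝ e h| ^ (p - 2) * ‖h‖ ^ 2) :=
    fun c Z hZ hc hZ' => mul_le_mul hc hZ' hZ (by positivity)
  -- Near the flat part, where the distance to it is at most 2‖h‖, the increment is O(‖h‖^β), and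
  -- β(p-1) ≥ p suffices. Farther away the bowl is expanded: the linear terms at h and -h are
  -- opposite, so only a second difference of the flux remains.
  rcases le_or_gt (max (‖x‖ - ℓ) 0) (2 * ‖h‖) with hcase | hcase
  · have key : ∀ (D : ℝ) (y : E n), ‖y‖ = ‖h‖ →
        D ≤ 2 * (max (‖x + y‖ - ℓ) 0) ^ β - 2 * (max (‖x‖ - ℓ) 0) ^ β →
        flux p D ≤ (2 * 3 ^ β : ℝ) ^ (p - 1) * ‖h‖ ^ p := by
      intro D y hy hD
      have h1 : max (‖x + y‖ - ℓ) 0 ≤ 3 * ‖h‖ := by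
        refine max_le ?_ (by positivity)
        have := norm_add_le x y
        have := le_max_left (‖x‖ - ℓ) 0
        linarith
      have h2 : (max (‖x + y‖ - ℓ) 0) ^ β ≤ (3 * ‖h‖) ^ β :=
        Real.rpow_le_rpow (le_max_right _ _) h1 (by linarith)
      have h3 : 0 ≤ (max (‖x‖ - ℓ) 0) ^ β := Real.rpow_nonneg (le_max_right _ _) _
      have h4 : D ≤ 2 * 3 ^ β * ‖h‖ ^ β := by
        rw [Real.mul_rpow (by norm_num) hh0.le] at h2
        linarith
      calc flux p D ≤ flux p (2 * 3 ^ β * ‖h‖ ^ β) := flux_mono hp h4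
        _ = (2 * 3 ^ β) ^ (p - 1) * ‖h‖ ^ (β * (p - 1)) := by
            rw [flux_of_nonneg hp (by positivity), Real.mul_rpow (by positivity) (by positivity),
              ← Real.rpow_mul hh0.le]
        _ ≤ _ := by
            gcongr ?_ * ?_
            exact Real.rpow_le_rpow_of_exponent_ge hh0 hh1 hβp
    have k1 := key D₁ h rfl hD₁
    have k2 := key D₂ (-h) (norm_neg h) (by rwa [← sub_eq_add_neg])
    have : flux p D₁ + flux p D₂ ≤ c₁ * ‖h‖ ^ p := by
      simp only [c₁]; linarith
    exact this.trans (hg c₁ _ hX (by linarith) (by linarith))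
  · have hmax : max (‖x‖ - ℓ) 0 = ‖x‖ - ℓ := by
      refine max_eq_left ?_
      by_contra hneg
      rw [max_eq_right (by linarith)] at hcase
      linarith
    rw [hmax] at hcase ht1 hD₁ hD₂
    have hx0 : 0 < ‖x‖ := by linarith
    have hx : x ≠ 0 := norm_pos_iff.1 hx0
    have hee := he hx
    have hile : |inner ℝ e h| ≤ ‖h‖ := by
      refine (abs_real_inner_le_norm _ _).trans ?_
      rw [hee, norm_smul, norm_inv, norm_norm, inv_mul_cancel₀ hx0.ne', one_mul]
    have b1 := bowl_expansion hβ hℓ hcase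
    have b2 := bowl_expansion (x := x) (h := -h) hβ hℓ (by rwa [norm_neg])
    rw [← hA₀, ← hee] at b1 b2
    rw [inner_neg_right, norm_neg, ← sub_eq_add_neg] at b2
    set t := ‖x‖ - ℓ with ht
    set i := inner ℝ e h with hidef
    have ht0 : 0 < t := by linarith
    set P := t ^ (β - 2) with hP
    have hP0 : 0 < P := by positivity
    have e1 : t ^ (β - 1) = P * t := by rw [hP, ← Real.rpow_add_one ht0.ne']; ring_nf
    rw [e1] at b1 b2
    have hA : 0 ≤ 2 * A₀ * P * ‖h‖ ^ 2 := by positivity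
    -- The total exponent of t is β(p-1) - p ≥ 0, and t ≤ 1. This is the second place where the
    -- choice of β is needed.
    have hPt : (P * t) ^ (p - 2) * P ≤ 1 := by
      rw [← e1, ← Real.rpow_mul ht0.le, hP, ← Real.rpow_add ht0]
      exact Real.rpow_le_one ht0.le ht1 (by nlinarith)
    have f1 : flux p D₁ ≤ flux p (2 * β * (P * t) * i + 2 * A₀ * P * ‖h‖ ^ 2) :=
      flux_mono hp (by linarith)
    have f2 : flux p D₂ ≤ flux p (-(2 * β * (P * t) * i) + 2 * A₀ * P * ‖h‖ ^ 2) :=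
      flux_mono hp (by linarith)
    rcases le_total p 2 with hp2 | hp2
    · have f3 := flux_second_difference_le_of_le_two (t := 2 * β * (P * t) * i) hp hp2
        (by positivity) hA
      have f4 : 4 * |2 * β * (P * t) * i| ^ (p - 2) * (2 * A₀ * P * ‖h‖ ^ 2) =
          c₂ * ((P * t) ^ (p - 2) * P) * (|i| ^ (p - 2) * ‖h‖ ^ 2) := by
        rw [abs_mul, abs_of_pos (by positivity : 0 < 2 * β * (P * t)),
          Real.mul_rpow (by positivity) (by positivity),
          Real.mul_rpow (by positivity) (by positivity)]
        simp only [c₂]; ring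
      have f5 : c₂ * ((P * t) ^ (p - 2) * P) * (|i| ^ (p - 2) * ‖h‖ ^ 2) ≤
          c₂ * 1 * (|i| ^ (p - 2) * ‖h‖ ^ 2) := by gcongr
      exact le_trans (by linarith) (hg c₂ _ hY (by linarith) (by linarith))
    · have f3 := flux_second_difference_le_of_two_le (t := 2 * β * (P * t) * i) hp2 hA
      have f4 : |2 * β * (P * t) * i| + 2 * A₀ * P * ‖h‖ ^ 2 ≤
          (2 * β + 2 * A₀) * ((P * t) * ‖h‖) := by
        rw [abs_mul, abs_of_pos (by positivity : 0 < 2 * β * (P * t))]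
        have g1 : 2 * β * (P * t) * |i| ≤ 2 * β * (P * t) * ‖h‖ := by gcongr
        have g2 : 2 * A₀ * P * ‖h‖ * ‖h‖ ≤ 2 * A₀ * P * ‖h‖ * t := by
          gcongr; linarith
        nlinarith
      have f5 : (|2 * β * (P * t) * i| + 2 * A₀ * P * ‖h‖ ^ 2) ^ (p - 2) ≤
          ((2 * β + 2 * A₀) * ((P * t) * ‖h‖)) ^ (p - 2) :=
        Real.rpow_le_rpow (by positivity) f4 (by linarith)
      have e3 : ‖h‖ ^ p = ‖h‖ ^ (p - 2) * ‖h‖ ^ 2 := by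
        rw [← Real.rpow_natCast, ← Real.rpow_add hh0]; norm_num
      have f6 : 2 * p * (|2 * β * (P * t) * i| + 2 * A₀ * P * ‖h‖ ^ 2) ^ (p - 2) *
          (2 * A₀ * P * ‖h‖ ^ 2) ≤ c₃ * ((P * t) ^ (p - 2) * P) * ‖h‖ ^ p := by
        calc _ ≤ 2 * p * ((2 * β + 2 * A₀) * ((P * t) * ‖h‖)) ^ (p - 2) *
              (2 * A₀ * P * ‖h‖ ^ 2) := by gcongr
          _ = _ := by
            rw [Real.mul_rpow (by positivity) (by positivity),
              Real.mul_rpow (by positivity) (by positivity), e3]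
            simp only [c₃]; ring
      have f7 : c₃ * ((P * t) ^ (p - 2) * P) * ‖h‖ ^ p ≤ c₃ * 1 * ‖h‖ ^ p := by gcongr
      exact le_trans (by linarith) (hg c₃ _ hX (by linarith) (by linarith))

/-! ### The truncated nonlocal operator on functions touched by a bowl. -/

/-- The kernel `|h|^{-n-sp}` truncated at distance `η`. -/
def truncKernel {n : ℕ} (s p η : ℝ) (h : E n) : ℝ :=
  {h : E n | η < ‖h‖}.indicator (fun h => (‖h‖ ^ ((n : ℝ) + s * p))⁻¹) h

lemma measurable_truncKernel {n : ℕ} (s p η : ℝ) : Measurable (truncKernel (n := n) s p η) :=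
  Measurable.indicator (by fun_prop) (measurableSet_lt measurable_const measurable_norm)

lemma truncKernel_nonneg {n : ℕ} (s p η : ℝ) (h : E n) : 0 ≤ truncKernel s p η h :=
  indicator_nonneg (fun _ _ => by positivity) _

lemma truncKernel_neg {n : ℕ} (s p η : ℝ) (h : E n) :
    truncKernel s p η (-h) = truncKernel s p η h := by
  simp [truncKernel, indicator]

lemma truncKernel_le {n : ℕ} (s p η : ℝ) (h : E n) :
    truncKernel s p η h ≤ (‖h‖ ^ ((n : ℝ) + s * p))⁻¹ :=
  indicator_le_self' (fun _ _ => by positivity) _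

lemma integrable_and_integral_le {α : Type*} [MeasurableSpace α] {μ : Measure α} {f : α → ℝ}
    {c : ℝ} (hc : 0 ≤ c) (hf : AEStronglyMeasurable f μ) (h0 : ∀ x, 0 ≤ f x)
    (h : ∫⁻ x, ENNReal.ofReal (f x) ∂μ ≤ ENNReal.ofReal c) : Integrable f μ ∧ ∫ x, f x ∂μ ≤ c := by
  have hi : Integrable f μ :=
    ⟨hf, (hasFiniteIntegral_iff_ofReal (Filter.Eventually.of_forall h0)).2
      (h.trans_lt ENNReal.ofReal_lt_top)⟩
  refine ⟨hi, ?_⟩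
  rw [← ofReal_integral_eq_lintegral_ofReal hi (Filter.Eventually.of_forall h0)] at h
  exact (ENNReal.ofReal_le_ofReal_iff hc).1 h

lemma integrable_truncKernel {n : ℕ} (hn : 1 ≤ n) {s p η : ℝ} (hsp : 0 < s * p) (hη : 0 < η) :
    Integrable (truncKernel (n := n) s p η) := by
  obtain ⟨C, hC, h⟩ := exists_lintegral_kernel_far_le hn
  refine (integrable_and_integral_le (c := C * (η ^ (-(s * p)) / (s * p))) (by positivity)
    (measurable_truncKernel s p η).aestronglyMeasurable (truncKernel_nonneg s p η) ?_).1
  refine le_trans ?_ (h (s * p) η hsp hη)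
  rw [← lintegral_indicator measurableSet_ball.compl]
  refine lintegral_mono fun x => ?_
  by_cases hx : η < ‖x‖
  · rw [indicator_of_mem (by simpa using hx.le), truncKernel,
      indicator_of_mem (show x ∈ {h : E n | η < ‖h‖} from hx), Real.rpow_neg (norm_nonneg x)]
  · simp [truncKernel, indicator, hx]

/-- Discards the null hyperplane on which the weight |e·h|^{p-2} is singular for p < 2. -/
lemma ae_inner_ne_zero {n : ℕ} {e : E n} (he : ‖e‖ = 1) :
    ∀ᵐ h : E n, inner ℝ e h ≠ 0 := by
  have h1 : (ℝ ∙ e)ᗮ ≠ ⊤ := by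
    intro h
    have : e ∈ (ℝ ∙ e)ᗮ := by rw [h]; trivial
    rw [Submodule.mem_orthogonal_singleton_iff_inner_right] at this
    rw [real_inner_self_eq_norm_sq, he] at this
    norm_num at this
  have h2 := Measure.addHaar_submodule (volume : Measure (E n)) _ h1
  refine measure_mono_null (fun h hh => ?_) h2
  simpa [Submodule.mem_orthogonal_singleton_iff_inner_right] using hh

/-- Upper bound, uniform in the truncation, for the nonlocal operator at a point where the
function is touched from above by a bowl. -/
lemma exists_nonlocal_bowl_le {n : ℕ} (hn : 1 ≤ n) {p β : ℝ} (hp : 1 < p) (hβ : 2 ≤ β)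
    (hβp : p ≤ β * (p - 1)) :
    ∃ C : ℝ, 0 < C ∧ ∀ s L ℓ a η : ℝ, 1 < s * p → s < 1 → 0 < L → 0 ≤ ℓ → 0 < η →
      ∀ z : E n → ℝ, Measurable z → (∀ y, 0 ≤ z y) → (∀ y, z y ≤ 2) →
      (∀ y, z y ≤ bowl β ℓ L a y) → ∀ x, z x = bowl β ℓ L a x → max (‖x‖ - ℓ) 0 ≤ L →
      (1 - s) * ∫ y, truncKernel s p η (x - y) * flux p (z y - z x) ≤ C * L ^ (-(s * p)) := by
  obtain ⟨C₁, hC₁, hflux⟩ := exists_flux_bowl_le hp hβ hβp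
  obtain ⟨C₂, hC₂, hnear₂⟩ := exists_lintegral_kernel_near_le hn (p := 2) (by norm_num)
  obtain ⟨C₃, hC₃, hnear⟩ := exists_lintegral_kernel_near_le hn hp
  obtain ⟨C₄, hC₄, hfar⟩ := exists_lintegral_kernel_far_le hn
  refine ⟨C₁ * (C₂ + C₃) / p + 2 * 2 ^ (p - 1) * C₄, by positivity, ?_⟩
  intro s L ℓ a η hsp hs hL hℓ hη z hz hz0 hz2 hzb x hx hxL
  have hp0 : 0 < p := by linarith
  have hs0 : 0 < 1 - s := by linarith
  -- At x = 0 any direction serves: the bowl is flat there, so the expansion along e is never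
  -- invoked.
  obtain ⟨e, he1, hex⟩ : ∃ e : E n, ‖e‖ = 1 ∧ (x ≠ 0 → e = ‖x‖⁻¹ • x) := by
    by_cases h0 : x = 0
    · exact ⟨EuclideanSpace.single ⟨0, hn⟩ 1, by simp, fun h => absurd h0 h⟩
    · refine ⟨‖x‖⁻¹ • x, ?_, fun _ => rfl⟩
      rw [norm_smul, norm_inv, norm_norm, inv_mul_cancel₀ (norm_ne_zero_iff.2 h0)]
  set q := p * (1 - s) with hq
  have hq0 : 0 < q := by positivity
  let F : E n → ℝ := fun h => truncKernel s p η h * flux p (z (x + h) - z x)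
  have hsub : ∫ y, truncKernel s p η (x - y) * flux p (z y - z x) = ∫ h, F h := by
    rw [← integral_add_left_eq_self _ x]
    congr 1 with h
    simp [F, truncKernel_neg]
  have hD2 : ∀ h, |z (x + h) - z x| ≤ 2 := fun h => by
    rw [abs_le]; constructor <;> linarith [hz0 (x + h), hz2 (x + h), hz0 x, hz2 x]
  have hfl2 : ∀ h, |flux p (z (x + h) - z x)| ≤ 2 ^ (p - 1) := fun h => by
    rw [abs_flux hp]
    exact Real.rpow_le_rpow (abs_nonneg _) (hD2 h) (by linarith)
  have hF : Integrable F := by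
    refine (integrable_truncKernel hn (by linarith) hη).mul_bdd (c := 2 ^ (p - 1)) ?_ ?_
    · exact ((measurable_flux p).comp ((hz.comp (measurable_const_add x)).sub_const _)).aestronglyMeasurable
    · exact Filter.Eventually.of_forall hfl2
  have hF' : Integrable (fun h => F (-h)) := hF.comp_neg
  -- Symmetrizing is legitimate because the truncation makes F integrable; it cancels the
  -- first-order part of the singularity.
  have h2 : 2 * ∫ h, F h = ∫ h, (F h + F (-h)) := by
    rw [integral_add hF hF', integral_neg_eq_self]; ring
  -- Taking the angular exponent equal to 2 trivializes the weight, so one form of the kernel lemma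
  -- handles both the ‖h‖^p term and, in `B₂`, the genuinely angular one.
  let B₁ : E n → ℝ := fun h => (Metric.ball (0 : E n) L).indicator
    (fun h => |inner ℝ e h| ^ ((2:ℝ) - 2) * ‖h‖ ^ (q - n - (2 - 2))) h
  let B₂ : E n → ℝ := fun h => (Metric.ball (0 : E n) L).indicator
    (fun h => |inner ℝ e h| ^ (p - 2) * ‖h‖ ^ (q - n - (p - 2))) h
  let B₃ : E n → ℝ := fun h => (Metric.ball (0 : E n) L)ᶜ.indicator
    (fun h => ‖h‖ ^ (-(n + s * p))) h
  have hB₁ : Integrable B₁ ∧ ∫ h, B₁ h ≤ C₂ * (L ^ q / q) := by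
    refine integrable_and_integral_le (by positivity)
      (Measurable.indicator (by fun_prop) measurableSet_ball).aestronglyMeasurable
      (fun h => indicator_nonneg (fun _ _ => by positivity) _) ?_
    refine le_trans (le_of_eq ?_) (hnear₂ e he1 q L hq0 hL)
    rw [← lintegral_indicator measurableSet_ball]
    congr 1 with h
    by_cases hh : ‖h‖ < L <;> simp [B₁, indicator, hh]
  have hB₂ : Integrable B₂ ∧ ∫ h, B₂ h ≤ C₃ * (L ^ q / q) := by
    refine integrable_and_integral_le (by positivity)
      (Measurable.indicator (by fun_prop) measurableSet_ball).aestronglyMeasurable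
      (fun h => indicator_nonneg (fun _ _ => by positivity) _) ?_
    refine le_trans (le_of_eq ?_) (hnear e he1 q L hq0 hL)
    rw [← lintegral_indicator measurableSet_ball]
    congr 1 with h
    by_cases hh : ‖h‖ < L <;> simp [B₂, indicator, hh]
  have hB₃ : Integrable B₃ ∧ ∫ h, B₃ h ≤ C₄ * (L ^ (-(s * p)) / (s * p)) := by
    refine integrable_and_integral_le (by positivity)
      (Measurable.indicator (by fun_prop) measurableSet_ball.compl).aestronglyMeasurable
      (fun h => indicator_nonneg (fun _ _ => by positivity) _) ?_
    refine le_trans (le_of_eq ?_) (hfar (s * p) L (by linarith) hL)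
    rw [← lintegral_indicator measurableSet_ball.compl]
    congr 1 with h
    by_cases hh : L ≤ ‖h‖ <;> simp [B₃, indicator, hh]
  have hpt : ∀ᵐ h : E n, F h + F (-h) ≤
      C₁ * L ^ (-p) * (B₁ h + B₂ h) + 2 * 2 ^ (p - 1) * B₃ h := by
    filter_upwards [ae_inner_ne_zero he1] with h hi
    have hh0 : 0 < ‖h‖ := norm_pos_iff.2 (by rintro rfl; simp at hi)
    have hFF : F h + F (-h) = truncKernel s p η h *
        (flux p (z (x + h) - z x) + flux p (z (x - h) - z x)) := by
      simp only [F, truncKernel_neg, ← sub_eq_add_neg]; ring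
    rw [hFF]
    have hk0 := truncKernel_nonneg s p η h
    have hk1 := truncKernel_le s p η h
    by_cases hh : ‖h‖ < L
    · have hb1 : B₁ h = ‖h‖ ^ (q - n) := by
        simp [B₁, indicator, hh]
      have hb2 : B₂ h = |inner ℝ e h| ^ (p - 2) * ‖h‖ ^ (q - n - (p - 2)) := by
        simp [B₂, indicator, hh]
      have hb3 : B₃ h = 0 := by simp [B₃, indicator, not_le.2 hh]
      rw [hb1, hb2, hb3, mul_zero, add_zero]
      -- Dilation by 1/L reduces to bowls of unit width; it produces the factor L^{-p}, which
      -- combines with L^{p(1-s)} to give L^{-sp}.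
      have hscale : ∀ y : E n, max (‖L⁻¹ • y‖ - ℓ / L) 0 = max (‖y‖ - ℓ) 0 / L := fun y => by
        rw [norm_smul, norm_inv, Real.norm_of_nonneg hL.le, ← max_div_div_right hL.le, sub_div,
          zero_div, inv_mul_eq_div]
      have hD : ∀ y, z y - z x ≤ 2 * (max (‖L⁻¹ • y‖ - ℓ / L) 0) ^ β -
          2 * (max (‖L⁻¹ • x‖ - ℓ / L) 0) ^ β := fun y => by
        rw [hscale, hscale, hx]
        have := hzb y
        simp only [bowl] at this ⊢
        linarith
      have hil : inner ℝ e (L⁻¹ • h) = L⁻¹ * inner ℝ e h := real_inner_smul_right _ _ _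
      have hnl : ‖L⁻¹ • h‖ = L⁻¹ * ‖h‖ := by
        rw [norm_smul, norm_inv, Real.norm_of_nonneg hL.le]
      have hk := hflux (L⁻¹ • x) (L⁻¹ • h) e (ℓ / L) (z (x + h) - z x) (z (x - h) - z x)
        (by positivity) (by rw [hscale]; exact (div_le_one hL).2 hxL)
        (by rw [hnl]; positivity)
        (by rw [hnl, inv_mul_eq_div]; exact (div_le_one hL).2 hh.le)
        (fun hx0 => by
          have hx0' : x ≠ 0 := fun h => hx0 (by rw [h, smul_zero])
          rw [hex hx0', norm_smul, norm_inv, Real.norm_of_nonneg hL.le, smul_smul]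
          congr 1
          have := norm_ne_zero_iff.2 hx0'
          field_simp)
        (by rw [hil]; exact mul_ne_zero (by positivity) hi)
        (by rw [← smul_add]; exact hD _) (by rw [← smul_sub]; exact hD _)
      have hLp : (L⁻¹) ^ p = L ^ (-p) := by rw [Real.inv_rpow hL.le, Real.rpow_neg hL.le]
      have hLp' : (L⁻¹) ^ (p - 2) * (L⁻¹) ^ 2 = L ^ (-p) := by
        rw [← hLp, ← Real.rpow_natCast, ← Real.rpow_add (by positivity)]; norm_num
      have hrhs : C₁ * (‖L⁻¹ • h‖ ^ p + |inner ℝ e (L⁻¹ • h)| ^ (p - 2) * ‖L⁻¹ • h‖ ^ 2) =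
          C₁ * L ^ (-p) * (‖h‖ ^ p + |inner ℝ e h| ^ (p - 2) * ‖h‖ ^ 2) := by
        rw [hil, hnl, abs_mul, abs_of_pos (inv_pos.2 hL), Real.mul_rpow (by positivity) hh0.le,
          Real.mul_rpow (by positivity) (abs_nonneg _), hLp, mul_pow, ← hLp']
        ring
      rw [hrhs] at hk
      calc _ ≤ truncKernel s p η h *
            (C₁ * L ^ (-p) * (‖h‖ ^ p + |inner ℝ e h| ^ (p - 2) * ‖h‖ ^ 2)) := by gcongr
        _ ≤ (‖h‖ ^ ((n : ℝ) + s * p))⁻¹ *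
            (C₁ * L ^ (-p) * (‖h‖ ^ p + |inner ℝ e h| ^ (p - 2) * ‖h‖ ^ 2)) := by gcongr
        _ = _ := by
            rw [← Real.rpow_neg hh0.le]
            have e1 : ‖h‖ ^ (q - n) = ‖h‖ ^ (-((n:ℝ) + s * p)) * ‖h‖ ^ p := by
              rw [← Real.rpow_add hh0]; congr 1; rw [hq]; ring
            have e2 : ‖h‖ ^ (q - n - (p - 2)) = ‖h‖ ^ (-((n:ℝ) + s * p)) * ‖h‖ ^ 2 := by
              rw [← Real.rpow_natCast, ← Real.rpow_add hh0]; congr 1; rw [hq]; push_cast; ring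
            rw [e1, e2]; ring
    · have hb1 : B₁ h = 0 := by simp [B₁, indicator, hh]
      have hb2 : B₂ h = 0 := by simp [B₂, indicator, hh]
      have hb3 : B₃ h = ‖h‖ ^ (-(n + s * p)) := by simp [B₃, indicator, not_lt.1 hh]
      rw [hb1, hb2, hb3, add_zero, mul_zero, zero_add, Real.rpow_neg hh0.le]
      have g1 := (abs_le.1 (hfl2 h)).2
      have g2 := (abs_le.1 (hfl2 (-h))).2
      rw [← sub_eq_add_neg] at g2
      calc _ ≤ truncKernel s p η h * (2 * 2 ^ (p - 1)) := by gcongr; linarith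
        _ ≤ (‖h‖ ^ ((n : ℝ) + s * p))⁻¹ * (2 * 2 ^ (p - 1)) := by gcongr
        _ = _ := by ring
  have h_integ : 2 * ∫ h, F h ≤ C₁ * L ^ (-p) * (C₂ * (L ^ q / q) + C₃ * (L ^ q / q)) +
      2 * 2 ^ (p - 1) * (C₄ * (L ^ (-(s * p)) / (s * p))) := by
    rw [h2]
    have i1 : Integrable (fun h => C₁ * L ^ (-p) * (B₁ h + B₂ h)) :=
      (hB₁.1.add hB₂.1).const_mul _
    have i2 : Integrable (fun h => 2 * 2 ^ (p - 1) * B₃ h) := hB₃.1.const_mul _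
    calc _ ≤ ∫ h, (C₁ * L ^ (-p) * (B₁ h + B₂ h) + 2 * 2 ^ (p - 1) * B₃ h) :=
          integral_mono_ae (hF.add hF') (i1.add i2) hpt
      _ = C₁ * L ^ (-p) * ((∫ h, B₁ h) + ∫ h, B₂ h) + 2 * 2 ^ (p - 1) * ∫ h, B₃ h := by
          rw [integral_add i1 i2, integral_const_mul, integral_const_mul, integral_add hB₁.1 hB₂.1]
      _ ≤ _ := by
          have := hB₁.2
          have := hB₂.2
          have := hB₃.2
          gcongr
  rw [hsub]
  set I := ∫ h, F h
  have hLL : L ^ (-p) * L ^ q = L ^ (-(s * p)) := by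
    rw [← Real.rpow_add hL]; congr 1; rw [hq]; ring
  set X := L ^ (-(s * p)) with hX
  have hX0 : 0 < X := by positivity
  -- Since q = p(1-s), the factor 1-s cancels exactly, and the constant stays bounded as s tends to
  -- 1.
  have e1 : (1 - s) * (C₁ * L ^ (-p) * (C₂ * (L ^ q / q) + C₃ * (L ^ q / q))) =
      C₁ * (C₂ + C₃) / p * X := by
    rw [← hLL, hq]; field_simp
  have e2 : (1 - s) * (2 * 2 ^ (p - 1) * (C₄ * (X / (s * p)))) ≤ 2 * 2 ^ (p - 1) * C₄ * X := by
    have h1 : X / (s * p) ≤ X := div_le_self hX0.le hsp.le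
    have h3 : 1 - s ≤ 1 := by
      have : 0 < s := by by_contra hneg; nlinarith
      linarith
    calc _ ≤ 1 * (2 * 2 ^ (p - 1) * (C₄ * X)) := by gcongr
      _ = _ := by ring
  have h3 := mul_le_mul_of_nonneg_left h_integ hs0.le
  rw [mul_add, e1] at h3
  have h4 : 0 ≤ C₁ * (C₂ + C₃) / p * X + 2 * 2 ^ (p - 1) * C₄ * X := by positivity
  nlinarith

/-! ### First variation of the kinetic energy and the competitor min(u, w). -/

/-- The weight turning the kinetic energy into a single integral over `Ω × ℝⁿ`. -/
def halfWeight {n : ℕ} (Ω : Set (E n)) (y : E n) : ℝ := 1 - Ω.indicator (fun _ => 1 / 2) y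

lemma halfWeight_nonneg {n : ℕ} (Ω : Set (E n)) (y : E n) : 0 ≤ halfWeight Ω y := by
  by_cases h : y ∈ Ω
  · norm_num [halfWeight, h]
  · simp [halfWeight, h]

lemma halfWeight_le_one {n : ℕ} (Ω : Set (E n)) (y : E n) : halfWeight Ω y ≤ 1 := by
  by_cases h : y ∈ Ω <;> simp [halfWeight, h]

lemma measurable_halfWeight {n : ℕ} {Ω : Set (E n)} (hΩ : MeasurableSet Ω) :
    Measurable (halfWeight Ω) :=
  measurable_const.sub (measurable_const.indicator hΩ)

lemma kinetic_eq_lintegral_prod {n : ℕ} {s p : ℝ} {Ω : Set (E n)} (hΩ : MeasurableSet Ω)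
    {u : E n → ℝ} (hu : Measurable u) :
    kinetic s p u Ω = ∫⁻ z : E n × E n, ENNReal.ofReal (halfWeight Ω z.2 *
      (|u z.1 - u z.2| ^ p / ‖z.1 - z.2‖ ^ ((n : ℝ) + s * p))) ∂((volume.restrict Ω).prod volume) := by
  have hm : Measurable (fun z : E n × E n =>
      ENNReal.ofReal (|u z.1 - u z.2| ^ p / ‖z.1 - z.2‖ ^ ((n : ℝ) + s * p))) := by fun_prop
  have hw := measurable_halfWeight hΩ
  rw [lintegral_prod _ (by fun_prop)]
  have h1 : ∀ x, ∫⁻ y, ENNReal.ofReal (halfWeight Ω y *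
      (|u x - u y| ^ p / ‖x - y‖ ^ ((n : ℝ) + s * p))) =
      (1 / 2) * (∫⁻ y in Ω, ENNReal.ofReal (|u x - u y| ^ p / ‖x - y‖ ^ ((n : ℝ) + s * p))) +
      ∫⁻ y in Ωᶜ, ENNReal.ofReal (|u x - u y| ^ p / ‖x - y‖ ^ ((n : ℝ) + s * p)) := by
    intro x
    rw [← lintegral_add_compl _ hΩ, ← lintegral_const_mul' _ _ (by simp)]
    congr 1
    · refine setLIntegral_congr_fun hΩ fun y hy => ?_
      have : halfWeight Ω y = 1 / 2 := by simp [halfWeight, hy]; norm_num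
      simp only [this]
      rw [ENNReal.ofReal_mul (by norm_num)]
      congr 1
      rw [ENNReal.ofReal_div_of_pos (by norm_num)]; simp
    · refine setLIntegral_congr_fun hΩ.compl fun y hy => ?_
      have : halfWeight Ω y = 1 := by simp [halfWeight, notMem_of_mem_compl hy]
      simp only [this, one_mul]
  simp_rw [h1]
  have hm1 : Measurable (fun x : E n =>
      ∫⁻ y in Ω, ENNReal.ofReal (|u x - u y| ^ p / ‖x - y‖ ^ ((n : ℝ) + s * p))) :=
    Measurable.lintegral_prod_right' hm
  rw [lintegral_add_left (hm1.const_mul _), lintegral_const_mul _ hm1]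
  rfl

lemma integrable_truncKernel_prod {n : ℕ} (hn : 1 ≤ n) {s p η : ℝ} (hsp : 0 < s * p) (hη : 0 < η)
    (μ : Measure (E n)) [IsFiniteMeasure μ] :
    Integrable (fun z : E n × E n => truncKernel s p η (z.1 - z.2)) (μ.prod volume) := by
  have hk := integrable_truncKernel hn (n := n) hsp hη
  have hm : Measurable (fun z : E n × E n => truncKernel s p η (z.1 - z.2)) :=
    (measurable_truncKernel s p η).comp (by fun_prop)
  rw [integrable_prod_iff hm.aestronglyMeasurable]
  refine ⟨Filter.Eventually.of_forall fun x => hk.comp_sub_left x, ?_⟩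
  have : (fun x : E n => ∫ y, ‖truncKernel s p η (x - y)‖) =
      fun _ => ∫ y : E n, ‖truncKernel s p η y‖ := by
    funext x
    exact integral_sub_left_eq_self (fun y => ‖truncKernel s p η y‖) volume x
  simp only [this]
  exact integrable_const _

lemma ofReal_integral_le_lintegral_ofReal {α : Type*} [MeasurableSpace α] {μ : Measure α}
    {f : α → ℝ} (hf : Integrable f μ) :
    ENNReal.ofReal (∫ x, f x ∂μ) ≤ ∫⁻ x, ENNReal.ofReal (f x) ∂μ := by
  calc ENNReal.ofReal (∫ x, f x ∂μ) ≤ ENNReal.ofReal (∫ x, max (f x) 0 ∂μ) :=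
        ENNReal.ofReal_le_ofReal (integral_mono hf hf.pos_part (fun x => le_max_left _ _))
    _ = ∫⁻ x, ENNReal.ofReal (max (f x) 0) ∂μ :=
        ofReal_integral_eq_lintegral_ofReal hf.pos_part
          (Filter.Eventually.of_forall fun x => le_max_right _ _)
    _ = _ := by simp

/-- First variation of the truncated kinetic energy, in non-divergence form. -/
lemma integral_first_variation {n : ℕ} (hn : 1 ≤ n) {s p η : ℝ} (hp : 1 < p) (hsp : 0 < s * p)
    (hη : 0 < η) {Ω : Set (E n)} (hΩ : MeasurableSet Ω) (hΩf : volume Ω ≠ ⊤)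
    {w φ : E n → ℝ} (hw : Measurable w) (hφ : Measurable φ) (hw1 : ∀ x, |w x| ≤ 1)
    (hφ2 : ∀ x, |φ x| ≤ 2) (hφ0 : ∀ x, x ∉ Ω → φ x = 0) :
    Integrable (fun z : E n × E n => halfWeight Ω z.2 * (truncKernel s p η (z.1 - z.2) *
      (flux p (w z.2 - w z.1) * (φ z.1 - φ z.2)))) ((volume.restrict Ω).prod volume) ∧
    Integrable (fun x => φ x * ∫ y, truncKernel s p η (x - y) * flux p (w y - w x))
      (volume.restrict Ω) ∧
    ∫ z : E n × E n, halfWeight Ω z.2 * (truncKernel s p η (z.1 - z.2) *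
      (flux p (w z.2 - w z.1) * (φ z.1 - φ z.2))) ∂((volume.restrict Ω).prod volume) =
    ∫ x in Ω, φ x * ∫ y, truncKernel s p η (x - y) * flux p (w y - w x) := by
  set μ := (volume : Measure (E n)).restrict Ω with hμ
  have : IsFiniteMeasure μ := ⟨by rw [hμ, Measure.restrict_apply_univ]; exact hΩf.lt_top⟩
  have hk := integrable_truncKernel_prod hn hsp hη μ
  have hfl : Measurable (fun z : E n × E n => flux p (w z.2 - w z.1)) :=
    (measurable_flux p).comp (by fun_prop)
  have hfl2 : ∀ z : E n × E n, |flux p (w z.2 - w z.1)| ≤ 2 ^ (p - 1) := fun z => by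
    rw [abs_flux hp]
    refine Real.rpow_le_rpow (abs_nonneg _) ?_ (by linarith)
    have h1 := abs_le.1 (hw1 z.1)
    have h2 := abs_le.1 (hw1 z.2)
    rw [abs_le]; constructor <;> linarith [h1.1, h1.2, h2.1, h2.2]
  have hcw := measurable_halfWeight hΩ
  have hI : ∀ g : E n × E n → ℝ, Measurable g → (∀ z, |g z| ≤ 4) →
      Integrable (fun z : E n × E n => truncKernel s p η (z.1 - z.2) *
        (flux p (w z.2 - w z.1) * g z)) (μ.prod volume) := fun g hg hg4 => by
    refine hk.mul_bdd (c := 2 ^ (p - 1) * 4) (hfl.mul hg).aestronglyMeasurable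
      (Filter.Eventually.of_forall fun z => ?_)
    rw [Real.norm_eq_abs, abs_mul]
    exact mul_le_mul (hfl2 z) (hg4 z) (abs_nonneg _) (by positivity)
  have hcabs : ∀ y, |halfWeight Ω y| ≤ 1 := fun y => by
    rw [abs_of_nonneg (halfWeight_nonneg Ω y)]; exact halfWeight_le_one Ω y
  have hi0 := hI (fun z => halfWeight Ω z.2 * (φ z.1 - φ z.2)) (by fun_prop) (fun z => by
    rw [abs_mul]
    have h1 := abs_sub (φ z.1) (φ z.2)
    have h2 := hφ2 z.1
    have h3 := hφ2 z.2
    have h4 := hcabs z.2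
    calc _ ≤ 1 * |φ z.1 - φ z.2| := by gcongr
      _ ≤ 4 := by linarith)
  have hi1 := hI (fun z => halfWeight Ω z.2 * φ z.1) (by fun_prop) (fun z => by
    rw [abs_mul]
    have h2 := hφ2 z.1
    have h4 := hcabs z.2
    calc _ ≤ 1 * (2 : ℝ) := by gcongr
      _ ≤ 4 := by norm_num)
  have hi2 := hI (fun z => halfWeight Ω z.2 * φ z.2) (by fun_prop) (fun z => by
    rw [abs_mul]
    have h2 := hφ2 z.2
    have h4 := hcabs z.2
    calc _ ≤ 1 * (2 : ℝ) := by gcongr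
      _ ≤ 4 := by norm_num)
  have hi3 := hI (fun z => φ z.1) (by fun_prop) (fun z => (hφ2 z.1).trans (by norm_num))
  have hi4 := hI (fun z => Ω.indicator (fun _ => 1 / 2) z.2 * φ z.1)
    (((measurable_const.indicator hΩ).comp measurable_snd).mul (by fun_prop)) (fun z => by
    rw [abs_mul]
    have h2 := hφ2 z.1
    have h4 : |Ω.indicator (fun _ => (1 / 2 : ℝ)) z.2| ≤ 1 := by
      by_cases h : z.2 ∈ Ω <;> simp [h]
      norm_num [abs_of_pos]
    calc _ ≤ 1 * (2 : ℝ) := by gcongr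
      _ ≤ 4 := by norm_num)
  -- φ vanishes off Ω, so only Ω × Ω counts, where the weight is 1/2. Exchanging the variables and
  -- using oddness of the flux moves φ to the first variable; there the two weights add up to 1 on
  -- the whole space.
  have hswap : ∫ z : E n × E n, truncKernel s p η (z.1 - z.2) *
        (flux p (w z.2 - w z.1) * (halfWeight Ω z.2 * φ z.2)) ∂(μ.prod volume) =
      -∫ z : E n × E n, truncKernel s p η (z.1 - z.2) *
        (flux p (w z.2 - w z.1) * (Ω.indicator (fun _ => 1 / 2) z.2 * φ z.1)) ∂(μ.prod volume) := by
    have hrestr : ∀ f : E n × E n → ℝ, (∀ z, z.2 ∉ Ω → f z = 0) →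
        ∫ z, f z ∂(μ.prod volume) = ∫ z, f z ∂(μ.prod μ) := fun f hf => by
      have : μ.prod μ = (μ.prod volume).restrict (univ ×ˢ Ω) := by
        rw [← Measure.prod_restrict, Measure.restrict_univ]
      rw [this, setIntegral_eq_integral_of_forall_compl_eq_zero]
      intro z hz
      exact hf z (by simpa using hz)
    rw [hrestr _ (fun z hz => by simp [hφ0 z.2 hz]), hrestr _ (fun z hz => by simp [hz]),
      ← integral_prod_swap, ← integral_neg]
    refine integral_congr_ae ?_
    have hmem : ∀ᵐ z ∂(μ.prod μ), z.1 ∈ Ω ∧ z.2 ∈ Ω := by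
      rw [hμ, Measure.prod_restrict]
      exact ae_restrict_mem (hΩ.prod hΩ)
    filter_upwards [hmem] with z hz
    have h1 : truncKernel s p η (z.2 - z.1) = truncKernel s p η (z.1 - z.2) := by
      rw [← truncKernel_neg, neg_sub]
    have h2 : flux p (w z.1 - w z.2) = -flux p (w z.2 - w z.1) := by rw [← flux_neg, neg_sub]
    simp only [Prod.fst_swap, Prod.snd_swap, h1, h2, halfWeight, indicator_of_mem hz.1,
      indicator_of_mem hz.2]
    ring
  have hprod := integral_prod _ hi3
  have hpull : ∀ x, ∫ y, truncKernel s p η (x - y) * (flux p (w y - w x) * φ x) =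
      φ x * ∫ y, truncKernel s p η (x - y) * flux p (w y - w x) := fun x => by
    rw [← integral_const_mul]; congr 1 with y; ring
  have h_integ := hi3.integral_prod_left
  simp only [hpull] at hprod h_integ
  refine ⟨?_, h_integ, ?_⟩
  · refine hi0.congr (Filter.Eventually.of_forall fun z => ?_)
    ring
  · rw [← hprod]
    calc _ = ∫ z : E n × E n, (truncKernel s p η (z.1 - z.2) *
          (flux p (w z.2 - w z.1) * (halfWeight Ω z.2 * φ z.1)) -
          truncKernel s p η (z.1 - z.2) *
          (flux p (w z.2 - w z.1) * (halfWeight Ω z.2 * φ z.2))) ∂(μ.prod volume) := by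
          congr 1 with z; ring
      _ = ∫ z : E n × E n, (truncKernel s p η (z.1 - z.2) *
          (flux p (w z.2 - w z.1) * (halfWeight Ω z.2 * φ z.1)) +
          truncKernel s p η (z.1 - z.2) *
          (flux p (w z.2 - w z.1) * (Ω.indicator (fun _ => 1 / 2) z.2 * φ z.1)))
            ∂(μ.prod volume) := by
          rw [integral_sub hi1 hi2, hswap, sub_neg_eq_add, integral_add hi1 hi4]
      _ = _ := by
          congr 1 with z; simp only [halfWeight]; ring

/-- `abs_sub_min_rpow_le` is integrated against the truncated kernel; its linear term is the first
variation at w in the direction u - min(u, w) ≥ 0, so an upper bound on the operator at w suffices.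
As H does not depend on η, the truncation is removed by monotone convergence, and no principal value
is ever formed. -/
lemma kinetic_min_le {n : ℕ} (hn : 1 ≤ n) {s p : ℝ} (hp : 1 < p) (hsp : 0 < s * p)
    {Ω : Set (E n)} (hΩ : MeasurableSet Ω) (hΩf : volume Ω ≠ ⊤)
    {u w H : E n → ℝ} (hu : Measurable u) (hw : Measurable w) (hu1 : ∀ x, |u x| ≤ 1)
    (hw1 : ∀ x, |w x| ≤ 1) (hwΩ : ∀ x, x ∉ Ω → w x = 1)
    (hH : ∀ η > 0, ∀ x, w x < 1 → ∫ y, truncKernel s p η (x - y) * flux p (w y - w x) ≤ H x) :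
    kinetic s p (fun x => min (u x) (w x)) Ω ≤ kinetic s p u Ω +
      ∫⁻ x in Ω, ENNReal.ofReal (p * ((u x - min (u x) (w x)) * H x)) := by
  have hv : Measurable (fun x => min (u x) (w x)) := hu.min hw
  set v : E n → ℝ := fun x => min (u x) (w x) with hvdef
  set φ : E n → ℝ := fun x => u x - v x with hφdef
  have hφm : Measurable φ := hu.sub hv
  have hv1 : ∀ x, |v x| ≤ 1 := fun x => by
    rcases min_choice (u x) (w x) with h | h <;> simp only [hvdef, h]
    exacts [hu1 x, hw1 x]
  have hφnn : ∀ x, 0 ≤ φ x := fun x => sub_nonneg.2 (min_le_left _ _)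
  have hφ2 : ∀ x, |φ x| ≤ 2 := fun x => by
    have h1 := abs_le.1 (hu1 x)
    have h2 := abs_le.1 (hv1 x)
    rw [abs_le]; simp only [hφdef]; constructor <;> linarith [h1.1, h1.2, h2.1, h2.2]
  have hφw : ∀ x, ¬ w x < 1 → φ x = 0 := fun x hx => by
    have : u x ≤ w x := ((abs_le.1 (hu1 x)).2).trans (not_lt.1 hx)
    simp [hφdef, hvdef, this]
  have hφ0 : ∀ x, x ∉ Ω → φ x = 0 := fun x hx => hφw x (by rw [hwΩ x hx]; exact lt_irrefl _)
  set μ := (volume : Measure (E n)).restrict Ω with hμ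
  have : IsFiniteMeasure μ := ⟨by rw [hμ, Measure.restrict_apply_univ]; exact hΩf.lt_top⟩
  have hcw := measurable_halfWeight hΩ
  let G : ℝ → (E n → ℝ) → E n × E n → ℝ := fun η f z =>
    halfWeight Ω z.2 * (truncKernel s p η (z.1 - z.2) * |f z.1 - f z.2| ^ p)
  have hGm : ∀ η f, Measurable f → Measurable (G η f) := fun η f hf => by
    have : Measurable (fun z : E n × E n => truncKernel s p η (z.1 - z.2)) :=
      (measurable_truncKernel s p η).comp (by fun_prop)
    fun_prop
  have hGnn : ∀ η f z, 0 ≤ G η f z := fun η f z =>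
    mul_nonneg (halfWeight_nonneg _ _) (mul_nonneg (truncKernel_nonneg _ _ _ _) (by positivity))
  have hGi : ∀ η > 0, ∀ f, Measurable f → (∀ x, |f x| ≤ 1) → Integrable (G η f) (μ.prod volume) := by
    intro η hη f hf hf1
    have h := (integrable_truncKernel_prod hn hsp hη μ).mul_bdd
      (g := fun z : E n × E n => halfWeight Ω z.2 * |f z.1 - f z.2| ^ p) (c := 1 * 2 ^ p)
      (by fun_prop) (Filter.Eventually.of_forall fun z => by
        rw [Real.norm_eq_abs, abs_mul, abs_of_nonneg (halfWeight_nonneg _ _),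
          abs_of_nonneg (by positivity : 0 ≤ |f z.1 - f z.2| ^ p)]
        refine mul_le_mul (halfWeight_le_one _ _) ?_ (by positivity) zero_le_one
        refine Real.rpow_le_rpow (abs_nonneg _) ?_ (by linarith)
        have h1 := abs_le.1 (hf1 z.1)
        have h2 := abs_le.1 (hf1 z.2)
        rw [abs_le]; constructor <;> linarith [h1.1, h1.2, h2.1, h2.2])
    refine h.congr (Filter.Eventually.of_forall fun z => ?_)
    simp only [G]; ring
  have hker : ∀ η f z, G η f z ≤ halfWeight Ω z.2 *
      (|f z.1 - f z.2| ^ p / ‖z.1 - z.2‖ ^ ((n : ℝ) + s * p)) := fun η f z => by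
    refine mul_le_mul_of_nonneg_left ?_ (halfWeight_nonneg _ _)
    rw [div_eq_inv_mul]
    exact mul_le_mul_of_nonneg_right (truncKernel_le _ _ _ _) (by positivity)
  have hstep : ∀ η > 0, ∫⁻ z, ENNReal.ofReal (G η v z) ∂(μ.prod volume) ≤ kinetic s p u Ω +
      ∫⁻ x in Ω, ENNReal.ofReal (p * ((u x - min (u x) (w x)) * H x)) := by
    intro η hη
    obtain ⟨hi1, hi2, hi3⟩ := integral_first_variation hn hp hsp hη hΩ hΩf hw hφm hw1 hφ2 hφ0
    rw [← hμ] at hi1 hi2 hi3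
    have hle : ∫ z, G η v z ∂(μ.prod volume) ≤ (∫ z, G η u z ∂(μ.prod volume)) +
        p * ∫ x, φ x * (∫ y, truncKernel s p η (x - y) * flux p (w y - w x)) ∂μ := by
      rw [← hi3, ← integral_const_mul, ← integral_add (hGi η hη u hu hu1) (hi1.const_mul p)]
      refine integral_mono (hGi η hη v hv hv1) ((hGi η hη u hu hu1).add (hi1.const_mul p)) fun z => ?_
      have h := abs_sub_min_rpow_le hp (u z.1) (u z.2) (w z.1) (w z.2)
      have h0 : 0 ≤ halfWeight Ω z.2 * truncKernel s p η (z.1 - z.2) :=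
        mul_nonneg (halfWeight_nonneg _ _) (truncKernel_nonneg _ _ _ _)
      have h2 := mul_le_mul_of_nonneg_left h h0
      simp only [G, hvdef, hφdef]
      linarith
    rw [← ofReal_integral_eq_lintegral_ofReal (hGi η hη v hv hv1)
      (Filter.Eventually.of_forall (hGnn η v))]
    refine (ENNReal.ofReal_le_ofReal hle).trans (ENNReal.ofReal_add_le.trans ?_)
    gcongr ?_ + ?_
    · rw [ofReal_integral_eq_lintegral_ofReal (hGi η hη u hu hu1)
        (Filter.Eventually.of_forall (hGnn η u)), kinetic_eq_lintegral_prod hΩ hu]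
      exact lintegral_mono fun z => ENNReal.ofReal_le_ofReal (hker η u z)
    · rw [← integral_const_mul]
      refine (ofReal_integral_le_lintegral_ofReal (hi2.const_mul p)).trans ?_
      refine lintegral_mono fun x => ENNReal.ofReal_le_ofReal ?_
      refine mul_le_mul_of_nonneg_left ?_ (by linarith)
      change φ x * _ ≤ φ x * H x
      by_cases hx : w x < 1
      · exact mul_le_mul_of_nonneg_left (hH η hη x hx) (hφnn x)
      · simp [hφw x hx]
  rw [kinetic_eq_lintegral_prod hΩ hv]
  -- As the truncation radius decreases to 0 the integrands increase to the full kernel off the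
  -- diagonal; on the diagonal the integrand vanishes.
  let ηs : ℕ → ℝ := fun N => 1 / ((N : ℝ) + 1)
  have hη0 : ∀ N, 0 < ηs N := fun N => by positivity
  calc _ ≤ ∫⁻ z, ⨆ N, ENNReal.ofReal (G (ηs N) v z) ∂(μ.prod volume) := by
        refine lintegral_mono fun z => ?_
        by_cases hz : z.1 = z.2
        · simp [hz, Real.zero_rpow (by linarith : p ≠ 0)]
        · obtain ⟨N, hN⟩ := exists_nat_one_div_lt (norm_pos_iff.2 (sub_ne_zero.2 hz))
          refine le_trans (le_of_eq ?_) (le_iSup _ N)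
          congr 2
          rw [truncKernel, indicator_of_mem (show z.1 - z.2 ∈ {h : E n | ηs N < ‖h‖} from hN),
            div_eq_inv_mul]
    _ = ⨆ N, ∫⁻ z, ENNReal.ofReal (G (ηs N) v z) ∂(μ.prod volume) := by
        refine lintegral_iSup (fun N => (hGm _ v hv).ennreal_ofReal) fun N N' hNN' z => ?_
        refine ENNReal.ofReal_le_ofReal (mul_le_mul_of_nonneg_left
          (mul_le_mul_of_nonneg_right ?_ (by positivity)) (halfWeight_nonneg _ _))
        refine indicator_le_indicator_of_subset (fun h hh => ?_) (fun h => by positivity) _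
        have hh' : ηs N < ‖h‖ := hh
        exact lt_of_le_of_lt (Nat.one_div_le_one_div hNN') hh'
    _ ≤ _ := iSup_le fun N => hstep _ (hη0 N)

/-! ### Almost everywhere representatives. -/

lemma interaction_congr_ae {n : ℕ} {s p : ℝ} {u u' : E n → ℝ} (h : u =ᵐ[volume] u')
    (A B : Set (E n)) : interaction s p u A B = interaction s p u' A B := by
  unfold interaction
  refine lintegral_congr_ae (ae_restrict_of_ae ?_)
  filter_upwards [h] with x hx
  refine lintegral_congr_ae (ae_restrict_of_ae ?_)
  filter_upwards [h] with y hy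
  rw [hx, hy]

lemma kinetic_congr_ae {n : ℕ} {s p : ℝ} {u u' : E n → ℝ} (h : u =ᵐ[volume] u')
    (Ω : Set (E n)) : kinetic s p u Ω = kinetic s p u' Ω := by
  unfold kinetic
  rw [interaction_congr_ae h, interaction_congr_ae h]

lemma energy_congr_ae {n : ℕ} {W : ℝ → ℝ} {s p : ℝ} {u u' : E n → ℝ} (h : u =ᵐ[volume] u')
    (Ω : Set (E n)) : energy W s p u Ω = energy W s p u' Ω := by
  unfold energy
  rw [kinetic_congr_ae h]
  congr 1
  refine lintegral_congr_ae (ae_restrict_of_ae ?_)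
  filter_upwards [h] with x hx
  rw [hx]

lemma MinimizesUpTo.congr_ae {n : ℕ} {W : ℝ → ℝ} {s p ε : ℝ} {Ω : Set (E n)} {u u' : E n → ℝ}
    (hu : MinimizesUpTo W s p ε Ω u) (h : u =ᵐ[volume] u') : MinimizesUpTo W s p ε Ω u' := by
  refine ⟨⟨hu.1.aemeasurable.congr h, kinetic_congr_ae h Ω ▸ hu.1.kinetic_lt_top, ?_⟩, ?_⟩
  · filter_upwards [hu.1.bound, h] with x hx hxx
    rwa [← hxx]
  · intro v hv
    rw [← energy_congr_ae h]
    refine hu.2 v ⟨hv.1, ?_⟩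
    filter_upwards [hv.2, h] with x hx hxx hxΩ
    rw [hx hxΩ, hxx]

/-- Measurability and the bound by 1 hold only almost everywhere in `MemX`. The comparison argument
wants them everywhere, W being controlled only on [-1,1]; clamping a measurable version provides
both. -/
lemma MemX.exists_measurable_rep {n : ℕ} {s p : ℝ} {Ω : Set (E n)} {u : E n → ℝ}
    (hu : MemX s p Ω u) : ∃ u' : E n → ℝ, Measurable u' ∧ (∀ x, |u' x| ≤ 1) ∧ u =ᵐ[volume] u' := by
  refine ⟨fun x => max (-1) (min 1 (hu.aemeasurable.mk u x)), ?_, fun x => ?_, ?_⟩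
  · exact measurable_const.max (measurable_const.min hu.aemeasurable.measurable_mk)
  · rw [abs_le]
    exact ⟨le_max_left _ _, max_le (by norm_num) (min_le_left _ _)⟩
  · filter_upwards [hu.bound, hu.aemeasurable.ae_eq_mk] with x h1 h2
    rw [← h2, min_eq_right (abs_le.1 h1).2, max_eq_right (abs_le.1 h1).1]

/-! ### Energy comparison with a barrier. -/

namespace IsPotential
variable {W : ℝ → ℝ} {m lam Lam θ q c₁ : ℝ}

lemma nonneg (hW : IsPotential W m lam Lam θ q c₁) {x : ℝ} (hx : x ∈ Icc (-1 : ℝ) 1) :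
    0 ≤ W x := by
  refine le_trans ?_ (hW.lower x hx)
  have := hW.lam_pos
  exact indicator_nonneg (fun _ _ => by positivity) _

lemma measurable_comp (hW : IsPotential W m lam Lam θ q c₁) {α : Type*} [MeasurableSpace α]
    {u : α → ℝ} (hu : Measurable u) (hu1 : ∀ x, u x ∈ Icc (-1 : ℝ) 1) :
    Measurable (fun x => W (u x)) := by
  have h1 : LowerSemicontinuous ((Icc (-1 : ℝ) 1).domRestrict W) :=
    lowerSemicontinuous_restrict_iff.2 hW.lsc
  exact h1.measurable.comp (hu.subtype_mk (h := hu1))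

end IsPotential

/-- Test minimality with v = min(u, z - 1). The barrier inequality bounds the kinetic increase by Y,
and the linear term of the growth condition on W repays Y wherever u ≤ -1 + q. The power term
survives as the measure of D; the rest is an error supported in {u > ϑ}. -/
lemma layer_measure_le_of_measurable {n : ℕ} (hn : 1 ≤ n) {W : ℝ → ℝ}
    {m lam Lam θ q c₁ s p ε ϑ a₀ : ℝ} (hW : IsPotential W m lam Lam θ q c₁) (hp : 1 < p)
    (hpm : p ≤ m) (hsp : 0 < s * p) (hs : s < 1) (ha₀ : 0 < a₀) (hϑ : ϑ ≤ -1 + q)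
    {Ω : Set (E n)} (hΩ : MeasurableSet Ω) (hΩf : volume Ω ≠ ⊤) {u : E n → ℝ}
    (hmin : MinimizesUpTo W s p ε Ω u) (hu : Measurable u) (hu1 : ∀ x, |u x| ≤ 1)
    {z : E n → ℝ} (hz : Measurable z) (hz0 : ∀ x, 0 < z x) (hz2 : ∀ x, z x ≤ 2)
    {A : Set (E n)} (hA : MeasurableSet A) (hAΩ : A ⊆ Ω) (hzA : ∀ x, x ∉ A → z x = 2)
    (hbar : ∀ η > 0, ∀ x, z x < 2 →
      (1 - s) * ∫ y, truncKernel s p η (x - y) * flux p (z y - z x) ≤ c₁ / p * z x ^ (m - 1))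
    {D : Set (E n)} (hD : MeasurableSet D) (hDA : D ⊆ A)
    (hDu : ∀ᵐ x ∂(volume : Measure (E n)), x ∈ D → z x ≤ a₀ ∧ 2 * a₀ ≤ 1 + u x ∧ u x ≤ ϑ) :
    ENNReal.ofReal (c₁ * a₀ ^ ⌈m⌉₊) * volume D ≤ ENNReal.ofReal ε +
      ENNReal.ofReal (2 * Lam + 2 * c₁) *
        ∫⁻ x in A ∩ {x | ϑ < u x}, ENNReal.ofReal (z x ^ (m - 1)) := by
  have hc₁ := hW.c₁_pos
  have hLam : 0 < Lam := by linarith [hW.one_le_Lam]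
  have hs0 : 0 < 1 - s := by linarith
  have hp0 : 0 < p := by linarith
  set w : E n → ℝ := fun x => z x - 1 with hwdef
  set v : E n → ℝ := fun x => min (u x) (w x) with hvdef
  have hw : Measurable w := hz.sub_const 1
  have hv : Measurable v := hu.min hw
  have hw1 : ∀ x, |w x| ≤ 1 := fun x => by
    rw [abs_le]; constructor <;> simp only [hwdef] <;> linarith [hz0 x, hz2 x]
  have hv1 : ∀ x, |v x| ≤ 1 := fun x => by
    rcases min_choice (u x) (w x) with h | h <;> simp only [hvdef, h]
    exacts [hu1 x, hw1 x]
  have hmemu : ∀ x, u x ∈ Icc (-1 : ℝ) 1 := fun x => abs_le.1 (hu1 x)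
  have hmemv : ∀ x, v x ∈ Icc (-1 : ℝ) 1 := fun x => abs_le.1 (hv1 x)
  have hmemw : ∀ x, w x ∈ Icc (-1 : ℝ) 1 := fun x => abs_le.1 (hw1 x)
  have hφnn : ∀ x, 0 ≤ u x - v x := fun x => sub_nonneg.2 (min_le_left _ _)
  have hφ2 : ∀ x, u x - v x ≤ 2 := fun x => by linarith [(hmemu x).2, (hmemv x).1]
  have hzpow : ∀ x, 0 < z x ^ (m - 1) := fun x => Real.rpow_pos_of_pos (hz0 x) _
  have hvu : ∀ x, x ∉ A → v x = u x := fun x hx => by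
    have : w x = 1 := by simp only [hwdef, hzA x hx]; norm_num
    simp only [hvdef, this]
    exact min_eq_left (hmemu x).2
  let Y : ENNReal := ∫⁻ x in Ω, ENNReal.ofReal (c₁ * (u x - v x) * z x ^ (m - 1))
  have hkin : ENNReal.ofReal (1 - s) * kinetic s p v Ω ≤
      ENNReal.ofReal (1 - s) * kinetic s p u Ω + Y := by
    -- The constant c₁/p in the barrier inequality is chosen so that p times it is the coefficient
    -- c₁ of the growth condition.
    have h := kinetic_min_le hn hp hsp hΩ hΩf hu hw hu1 hw1
      (fun x hx => by simp only [hwdef, hzA x (fun h => hx (hAΩ h))]; norm_num)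
      (H := fun x => c₁ / p * z x ^ (m - 1) / (1 - s)) (fun η hη x hx => by
        rw [le_div_iff₀ hs0, mul_comm]
        have h := hbar η hη x (by simp only [hwdef] at hx; linarith)
        simpa only [hwdef, sub_sub_sub_cancel_right] using h)
    refine (mul_le_mul_right h (ENNReal.ofReal (1 - s))).trans (le_of_eq ?_)
    rw [mul_add, ← lintegral_const_mul' _ _ ENNReal.ofReal_ne_top]
    congr 1
    refine lintegral_congr fun x => ?_
    rw [← ENNReal.ofReal_mul hs0.le]
    congr 1
    simp only [hvdef]
    field_simp
  have hbdd : ∀ (f : E n → ℝ) (B : ℝ), (∀ x, f x ≤ B) → ∫⁻ x in Ω, ENNReal.ofReal (f x) ≠ ⊤ := by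
    intro f B hB
    refine ne_top_of_le_ne_top ?_ (lintegral_mono fun x => ENNReal.ofReal_le_ofReal (hB x))
    rw [lintegral_const, Measure.restrict_apply_univ]
    exact ENNReal.mul_ne_top ENNReal.ofReal_ne_top hΩf
  have hYfin : Y ≠ ⊤ := by
    refine hbdd _ (c₁ * 2 * 2 ^ (m - 1)) fun x => ?_
    have h1 : z x ^ (m - 1) ≤ 2 ^ (m - 1) := Real.rpow_le_rpow (hz0 x).le (hz2 x) (by linarith)
    have h2 := hφ2 x
    have := hzpow x
    gcongr
  have hWvfin : ∫⁻ x in Ω, ENNReal.ofReal (W (v x)) ≠ ⊤ := by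
    refine hbdd _ (Lam * 2 ^ m) fun x => (hW.upper _ (hmemv x)).trans ?_
    gcongr
    · linarith
    · rw [abs_le]; constructor <;> linarith [(hmemv x).1, (hmemv x).2]
  have hKfin : ENNReal.ofReal (1 - s) * kinetic s p u Ω ≠ ⊤ :=
    ENNReal.mul_ne_top ENNReal.ofReal_ne_top hmin.1.kinetic_lt_top.ne
  have hKvfin : kinetic s p v Ω < ⊤ := by
    have h1 : ENNReal.ofReal (1 - s) * kinetic s p v Ω < ⊤ :=
      hkin.trans_lt (ENNReal.add_lt_top.2 ⟨hKfin.lt_top, hYfin.lt_top⟩)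
    by_contra hne
    rw [not_lt_top_iff] at hne
    rw [hne, ENNReal.mul_top (by simpa using hs0)] at h1
    exact lt_irrefl _ h1
  have hcomp := hmin.2 v ⟨⟨hv.aemeasurable, hKvfin, Filter.Eventually.of_forall hv1⟩,
    Filter.Eventually.of_forall fun x hx => hvu x (fun h => hx (hAΩ h))⟩
  have hpot : ∫⁻ x in Ω, ENNReal.ofReal (W (u x)) ≤
      ENNReal.ofReal ε + (Y + ∫⁻ x in Ω, ENNReal.ofReal (W (v x))) := by
    unfold energy at hcomp
    have h2 : ENNReal.ofReal (1 - s) * kinetic s p u Ω + ∫⁻ x in Ω, ENNReal.ofReal (W (u x)) ≤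
        ENNReal.ofReal (1 - s) * kinetic s p u Ω +
          (ENNReal.ofReal ε + (Y + ∫⁻ x in Ω, ENNReal.ofReal (W (v x)))) := by
      refine hcomp.trans ?_
      calc _ ≤ ENNReal.ofReal ε + (ENNReal.ofReal (1 - s) * kinetic s p u Ω + Y +
            ∫⁻ x in Ω, ENNReal.ofReal (W (v x))) := by gcongr
        _ = _ := by ring
    exact (ENNReal.add_le_add_iff_left hKfin).1 h2
  have hpt : ∀ᵐ x ∂(volume : Measure (E n)),
      W (v x) + c₁ * (u x - v x) * z x ^ (m - 1) + D.indicator (fun _ => c₁ * a₀ ^ ⌈m⌉₊) x ≤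
      W (u x) + (A ∩ {x | ϑ < u x}).indicator
        (fun x => (2 * Lam + 2 * c₁) * z x ^ (m - 1)) x := by
    filter_upwards [hDu] with x hDx
    have hind0 : 0 ≤ (A ∩ {x | ϑ < u x}).indicator
        (fun x => (2 * Lam + 2 * c₁) * z x ^ (m - 1)) x :=
      indicator_nonneg (fun y _ => by have := hzpow y; positivity) _
    have hw1z : |1 + w x| = z x := by
      simp only [hwdef]; rw [show 1 + (z x - 1) = z x by ring, abs_of_pos (hz0 x)]
    rcases le_or_gt (u x) (w x) with huw | huw
    · have hvx : v x = u x := min_eq_left huw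
      -- On D one has z ≤ a₀ and 1 + u ≥ 2a₀, so u exceeds the barrier by at least a₀; hence D
      -- avoids {u ≤ w}.
      have hDn : x ∉ D := fun h => by
        obtain ⟨h1, h2, h3⟩ := hDx h
        simp only [hwdef] at huw
        linarith
      rw [hvx, indicator_of_notMem hDn]
      simpa using hind0
    · have hvx : v x = w x := min_eq_right huw.le
      have hxA : x ∈ A := by
        by_contra hxA
        have := hvu x hxA
        rw [hvx] at this; linarith
      rw [hvx]
      -- Below -1 + q the growth condition applies. Above it only W(u) ≥ 0 is used, and everything
      -- else is bounded by z^{m-1} through z ≤ 2; such points lie in {u > ϑ} because ϑ ≤ -1 + q.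
      rcases le_or_gt (u x) (-1 + q) with huq | huq
      · have hg := hW.growth (w x) (u x) (hmemw x).1 huw.le huq
        rw [hw1z] at hg
        have hDle : D.indicator (fun _ => c₁ * a₀ ^ ⌈m⌉₊) x ≤ c₁ * (u x - w x) ^ ⌈m⌉₊ := by
          by_cases hxD : x ∈ D
          · obtain ⟨h1, h2, h3⟩ := hDx hxD
            rw [indicator_of_mem hxD]
            gcongr
            simp only [hwdef]; linarith
          · rw [indicator_of_notMem hxD]
            have : 0 ≤ u x - w x := by linarith
            positivity
        linarith
      · have hDn : x ∉ D := fun h => by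
          obtain ⟨h1, h2, h3⟩ := hDx h
          linarith
        have hmem : x ∈ A ∩ {x | ϑ < u x} := ⟨hxA, lt_of_le_of_lt hϑ huq⟩
        rw [indicator_of_notMem hDn, indicator_of_mem hmem]
        have h1 := hW.upper (w x) (hmemw x)
        rw [hw1z] at h1
        have h2 : z x ^ m ≤ 2 * z x ^ (m - 1) := by
          rw [show m = m - 1 + 1 by ring, Real.rpow_add_one (hz0 x).ne', add_sub_cancel_right,
            mul_comm]
          have := hzpow x
          have := hz2 x
          gcongr
        have h3 : c₁ * (u x - w x) * z x ^ (m - 1) ≤ c₁ * 2 * z x ^ (m - 1) := by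
          have := hφ2 x
          rw [hvx] at this
          have := hzpow x
          gcongr
        have h4 := hW.nonneg (hmemu x)
        nlinarith [mul_le_mul_of_nonneg_left h2 hLam.le]
  have hWvm := hW.measurable_comp hv hmemv
  have hWum := hW.measurable_comp hu hmemu
  have hSm : MeasurableSet (A ∩ {x | ϑ < u x}) := hA.inter (measurableSet_lt measurable_const hu)
  have hYm : Measurable (fun x => c₁ * (u x - v x) * z x ^ (m - 1)) := by fun_prop
  have hsum : Measurable (fun x => ENNReal.ofReal (W (v x)) +
      ENNReal.ofReal (c₁ * (u x - v x) * z x ^ (m - 1))) :=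
    hWvm.ennreal_ofReal.add hYm.ennreal_ofReal
  have h_integ : (∫⁻ x in Ω, ENNReal.ofReal (W (v x))) + Y +
      ENNReal.ofReal (c₁ * a₀ ^ ⌈m⌉₊) * volume D ≤
      (∫⁻ x in Ω, ENNReal.ofReal (W (u x))) + ENNReal.ofReal (2 * Lam + 2 * c₁) *
        ∫⁻ x in A ∩ {x | ϑ < u x}, ENNReal.ofReal (z x ^ (m - 1)) := by
    have e1 : ENNReal.ofReal (c₁ * a₀ ^ ⌈m⌉₊) * volume D =
        ∫⁻ x in Ω, ENNReal.ofReal (D.indicator (fun _ => c₁ * a₀ ^ ⌈m⌉₊) x) := by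
      have : (fun x => ENNReal.ofReal (D.indicator (fun _ => c₁ * a₀ ^ ⌈m⌉₊) x)) =
          D.indicator (fun _ => ENNReal.ofReal (c₁ * a₀ ^ ⌈m⌉₊)) := by
        funext x; by_cases h : x ∈ D <;> simp [h]
      rw [this, lintegral_indicator hD, lintegral_const, Measure.restrict_restrict hD,
        inter_eq_left.2 (hDA.trans hAΩ), Measure.restrict_apply_univ]
    have e2 : ENNReal.ofReal (2 * Lam + 2 * c₁) *
        ∫⁻ x in A ∩ {x | ϑ < u x}, ENNReal.ofReal (z x ^ (m - 1)) =
        ∫⁻ x in Ω, ENNReal.ofReal ((A ∩ {x | ϑ < u x}).indicator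
          (fun x => (2 * Lam + 2 * c₁) * z x ^ (m - 1)) x) := by
      have : (fun x => ENNReal.ofReal ((A ∩ {x | ϑ < u x}).indicator
          (fun x => (2 * Lam + 2 * c₁) * z x ^ (m - 1)) x)) =
          (A ∩ {x | ϑ < u x}).indicator
            (fun x => ENNReal.ofReal (2 * Lam + 2 * c₁) * ENNReal.ofReal (z x ^ (m - 1))) := by
        funext x
        by_cases h : x ∈ A ∩ {x | ϑ < u x}
        · rw [indicator_of_mem h, indicator_of_mem h, ENNReal.ofReal_mul (by positivity)]
        · rw [indicator_of_notMem h, indicator_of_notMem h, ENNReal.ofReal_zero]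
      rw [this, lintegral_indicator hSm, Measure.restrict_restrict hSm,
        inter_eq_left.2 (inter_subset_left.trans hAΩ),
        lintegral_const_mul' _ _ ENNReal.ofReal_ne_top]
    rw [e1, e2, ← lintegral_add_left hWvm.ennreal_ofReal, ← lintegral_add_left hsum,
      ← lintegral_add_left hWum.ennreal_ofReal]
    refine lintegral_mono_ae (ae_restrict_of_ae ?_)
    filter_upwards [hpt] with x hx
    have hφx := hφnn x
    have hzx := hzpow x
    rw [← ENNReal.ofReal_add (hW.nonneg (hmemv x)) (by positivity),
      ← ENNReal.ofReal_add (add_nonneg (hW.nonneg (hmemv x)) (by positivity))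
        (indicator_nonneg (fun _ _ => by positivity) _),
      ← ENNReal.ofReal_add (hW.nonneg (hmemu x))
        (indicator_nonneg (fun y _ => by have := hzpow y; positivity) _)]
    exact ENNReal.ofReal_le_ofReal hx
  have hfin : (∫⁻ x in Ω, ENNReal.ofReal (W (v x))) + Y ≠ ⊤ := ENNReal.add_ne_top.2 ⟨hWvfin, hYfin⟩
  refine (ENNReal.add_le_add_iff_left hfin).1 (h_integ.trans ?_)
  calc _ ≤ ENNReal.ofReal ε + (Y + ∫⁻ x in Ω, ENNReal.ofReal (W (v x))) +
        ENNReal.ofReal (2 * Lam + 2 * c₁) *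
        ∫⁻ x in A ∩ {x | ϑ < u x}, ENNReal.ofReal (z x ^ (m - 1)) := by gcongr
    _ = _ := by ring

/-- Comparison of an almost minimizer with a barrier `z - 1`. -/
lemma layer_measure_le {n : ℕ} (hn : 1 ≤ n) {W : ℝ → ℝ}
    {m lam Lam θ q c₁ s p ε ϑ a₀ : ℝ} (hW : IsPotential W m lam Lam θ q c₁) (hp : 1 < p)
    (hpm : p ≤ m) (hsp : 0 < s * p) (hs : s < 1) (ha₀ : 0 < a₀) (hϑ : ϑ ≤ -1 + q)
    {Ω : Set (E n)} (hΩ : MeasurableSet Ω) (hΩf : volume Ω ≠ ⊤) {u : E n → ℝ}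
    (hmin : MinimizesUpTo W s p ε Ω u)
    {z : E n → ℝ} (hz : Measurable z) (hz0 : ∀ x, 0 < z x) (hz2 : ∀ x, z x ≤ 2)
    {A : Set (E n)} (hA : MeasurableSet A) (hAΩ : A ⊆ Ω) (hzA : ∀ x, x ∉ A → z x = 2)
    (hbar : ∀ η > 0, ∀ x, z x < 2 →
      (1 - s) * ∫ y, truncKernel s p η (x - y) * flux p (z y - z x) ≤ c₁ / p * z x ^ (m - 1))
    {D : Set (E n)} (hD : MeasurableSet D) (hDA : D ⊆ A)
    (hDu : ∀ x ∈ D, z x ≤ a₀ ∧ 2 * a₀ ≤ 1 + u x ∧ u x ≤ ϑ) :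
    ENNReal.ofReal (c₁ * a₀ ^ ⌈m⌉₊) * volume D ≤ ENNReal.ofReal ε +
      ENNReal.ofReal (2 * Lam + 2 * c₁) *
        ∫⁻ x in A ∩ {x | ϑ < u x}, ENNReal.ofReal (z x ^ (m - 1)) := by
  obtain ⟨u', hu', hu1, huu⟩ := hmin.1.exists_measurable_rep
  have h := layer_measure_le_of_measurable hn hW hp hpm hsp hs ha₀ hϑ hΩ hΩf (hmin.congr_ae huu)
    hu' hu1 hz hz0 hz2 hA hAΩ hzA hbar hD hDA (by
      filter_upwards [huu] with x hx hxD
      rw [← hx]; exact hDu x hxD)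
  have hset : (A ∩ {x | ϑ < u' x} : Set (E n)) =ᵐ[volume] (A ∩ {x | ϑ < u x} : Set (E n)) := by
    filter_upwards [huu] with x hx
    apply propext
    change x ∈ A ∧ ϑ < u' x ↔ x ∈ A ∧ ϑ < u x
    rw [hx]
  rwa [setLIntegral_congr hset] at h

/-! ### Construction of the barrier from dyadic bowls. -/

/-- The barrier for the ball of radius `j T`: a truncated infimum of bowls of dyadic widths. -/
def barrier {n : ℕ} (β γ T a₀ : ℝ) (j : ℕ) (y : E n) : ℝ :=
  min 2 ((Finset.range (Nat.log 2 j + 1)).inf' Finset.nonempty_range_add_one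
    fun k => bowl β ((j - 2 ^ k) * T) (2 ^ k * T) (a₀ * 2 ^ (-(γ * k))) y)

lemma measurable_bowl {n : ℕ} (β ℓ L a : ℝ) : Measurable (bowl (n := n) β ℓ L a) := by
  unfold bowl; fun_prop

lemma le_bowl {n : ℕ} {β ℓ L a : ℝ} (hL : 0 < L) (y : E n) : a ≤ bowl β ℓ L a y := by
  have : 0 ≤ (max (‖y‖ - ℓ) 0 / L) ^ β :=
    Real.rpow_nonneg (div_nonneg (le_max_right _ _) hL.le) _
  simp only [bowl]; linarith

lemma two_lt_bowl {n : ℕ} {β ℓ L a : ℝ} (hβ : 0 ≤ β) (hL : 0 < L) (ha : 0 < a) {y : E n}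
    (hy : L ≤ max (‖y‖ - ℓ) 0) : 2 < bowl β ℓ L a y := by
  have : 1 ≤ (max (‖y‖ - ℓ) 0 / L) ^ β :=
    Real.one_le_rpow ((one_le_div hL).2 hy) hβ
  simp only [bowl]; linarith

lemma bowl_eq {n : ℕ} {β ℓ L a : ℝ} (hβ : 0 < β) {y : E n} (hy : ‖y‖ ≤ ℓ) :
    bowl β ℓ L a y = a := by
  simp [bowl, max_eq_right (sub_nonpos.2 hy), Real.zero_rpow hβ.ne']

lemma two_pow_log_le {j k : ℕ} (hj : 1 ≤ j) (hk : k ∈ Finset.range (Nat.log 2 j + 1)) :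
    (2 : ℝ) ^ k ≤ j := by
  have h1 : 2 ^ k ≤ j := Nat.pow_le_of_le_log (by omega) (by simpa [Nat.lt_succ_iff] using hk)
  exact_mod_cast h1

lemma barrier_le_bowl {n : ℕ} {β γ T a₀ : ℝ} {j k : ℕ} (hk : k ∈ Finset.range (Nat.log 2 j + 1))
    (y : E n) :
    barrier β γ T a₀ j y ≤ bowl β ((j - 2 ^ k) * T) (2 ^ k * T) (a₀ * 2 ^ (-(γ * k))) y :=
  (min_le_right _ _).trans (Finset.inf'_le _ hk)

lemma measurable_barrier {n : ℕ} (β γ T a₀ : ℝ) (j : ℕ) :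
    Measurable (barrier (n := n) β γ T a₀ j) := by
  refine measurable_const.min ?_
  have h := Finset.inf'_induction (p := fun f : E n → ℝ => Measurable f)
    (Finset.nonempty_range_add_one (n := Nat.log 2 j))
    (fun k => bowl (n := n) β ((j - 2 ^ k) * T) (2 ^ k * T) (a₀ * 2 ^ (-(γ * k))))
    (fun f hf g hg => hf.inf hg) (fun k _ => measurable_bowl _ _ _ _)
  convert h using 1
  funext y
  rw [Finset.inf'_apply]

lemma barrier_pos {n : ℕ} {β γ T a₀ : ℝ} (hT : 0 < T) (ha₀ : 0 < a₀) (j : ℕ) (y : E n) :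
    0 < barrier β γ T a₀ j y := by
  refine lt_min two_pos ?_
  rw [Finset.lt_inf'_iff]
  intro k _
  exact lt_of_lt_of_le (by positivity) (le_bowl (by positivity) y)

lemma barrier_eq_two {n : ℕ} {β γ T a₀ : ℝ} (hβ : 0 ≤ β) (hT : 0 < T) (ha₀ : 0 < a₀) {j : ℕ}
    {y : E n} (hy : j * T ≤ ‖y‖) : barrier β γ T a₀ j y = 2 := by
  refine min_eq_left ?_
  rw [Finset.le_inf'_iff]
  intro k _
  refine (two_lt_bowl hβ (by positivity) (by positivity) ?_).le
  refine le_trans ?_ (le_max_left _ _)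
  linarith

/-- Decay of the barrier, and the differential inequality it satisfies. -/
lemma exists_barrier {n : ℕ} (hn : 1 ≤ n) {p m s₀ c₁ a₀ : ℝ} (hp : 1 < p) (hpm : p ≤ m)
    (hs₀ : 1 < s₀ * p) (hc₁ : 0 < c₁) (ha₀ : 0 < a₀) :
    ∃ T K : ℝ, 1 ≤ T ∧ 0 < K ∧ ∀ j : ℕ, 1 ≤ j → ∃ z : E n → ℝ, Measurable z ∧ (∀ x, 0 < z x) ∧
      (∀ x, z x ≤ 2) ∧ (∀ x, j * T ≤ ‖x‖ → z x = 2) ∧ (∀ x, ‖x‖ ≤ (j - 1) * T → z x ≤ a₀) ∧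
      (∀ i : ℕ, 1 ≤ i → i ≤ j → ∀ x, ‖x‖ ≤ (j - i) * T →
        z x ^ (m - 1) ≤ K * (i : ℝ) ^ (-(s₀ * p))) ∧
      ∀ s, s₀ ≤ s → s < 1 → ∀ η > 0, ∀ x, z x < 2 →
        (1 - s) * ∫ y, truncKernel s p η (x - y) * flux p (z y - z x) ≤
          c₁ / p * z x ^ (m - 1) := by
  have hp0 : 0 < p := by linarith
  have hm1 : 0 < m - 1 := by linarith
  -- β ≥ 2 allows second-order expansion; β(p-1) ≥ p compensates the singularity of the flux for p <
  -- 2.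
  set β := max 2 (p / (p - 1)) with hβdef
  have hβ : 2 ≤ β := le_max_left _ _
  have hβp : p ≤ β * (p - 1) := by
    rw [← div_le_iff₀ (by linarith)]; exact le_max_right _ _
  obtain ⟨C, hC, hnl⟩ := exists_nonlocal_bowl_le hn hp hβ hβp
  set σ := s₀ * p with hσ
  -- With this decay rate of the bowl bottoms, z^{m-1} has the same order 2^{-σk} as the operator
  -- bound on a bowl of width 2^k.
  set γ := σ / (m - 1) with hγ
  have hγm : γ * (m - 1) = σ := by rw [hγ]; field_simp
  -- The unit of length is stretched until the operator constant C falls below the constant c₁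
  -- a₀^{m-1}/p available on the right.
  set T := max 1 (C * p / (c₁ * a₀ ^ (m - 1))) with hTdef
  have hT1 : 1 ≤ T := le_max_left _ _
  have hT0 : 0 < T := by linarith
  have hApos : 0 < a₀ ^ (m - 1) := by positivity
  have hpowγ : ∀ k : ℕ, (a₀ * 2 ^ (-(γ * k))) ^ (m - 1) = a₀ ^ (m - 1) * ((2:ℝ) ^ k) ^ (-σ) := by
    intro k
    rw [Real.mul_rpow ha₀.le (by positivity), ← Real.rpow_mul (by norm_num), ← Real.rpow_natCast,
      ← Real.rpow_mul (by norm_num)]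
    congr 2
    rw [← hγm]; ring
  refine ⟨T, a₀ ^ (m - 1) * 2 ^ σ, hT1, by positivity, fun j hj => ⟨barrier β γ T a₀ j,
    measurable_barrier _ _ _ _ _, fun x => barrier_pos hT0 ha₀ j x, fun x => min_le_left _ _,
    fun x hx => barrier_eq_two (by linarith) hT0 ha₀ hx, ?_, ?_, ?_⟩⟩
  · intro x hx
    have h := barrier_le_bowl (β := β) (γ := γ) (T := T) (a₀ := a₀) (j := j) (k := 0) (by simp) x
    rw [bowl_eq (by linarith) (by simpa using hx)] at h
    simpa using h
  · intro i hi hij x hx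
    -- At depth i the bowl of width 2^k with 2^k ≤ i < 2^{k+1} is still flat; rounding i down to a
    -- power of two costs the factor 2^σ in K.
    have hk : Nat.log 2 i ∈ Finset.range (Nat.log 2 j + 1) := by
      simpa [Nat.lt_succ_iff] using Nat.log_mono_right hij
    have h2i : (2 : ℝ) ^ Nat.log 2 i ≤ i := two_pow_log_le hi (by simp)
    have h := barrier_le_bowl (β := β) (γ := γ) (T := T) (a₀ := a₀) hk x
    rw [bowl_eq (by linarith) (hx.trans (by gcongr))] at h
    have h3 := Real.rpow_le_rpow (barrier_pos hT0 ha₀ j x).le h hm1.le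
    refine h3.trans ?_
    rw [hpowγ, mul_assoc]
    gcongr
    have hi0 : (0:ℝ) < i := by exact_mod_cast hi
    have h4 : (i : ℝ) / 2 ≤ 2 ^ Nat.log 2 i := by
      have : i < 2 ^ (Nat.log 2 i + 1) := Nat.lt_pow_succ_log_self (by norm_num) i
      have : (i : ℝ) < 2 ^ (Nat.log 2 i + 1) := by exact_mod_cast this
      rw [pow_succ] at this
      linarith
    calc ((2:ℝ) ^ Nat.log 2 i) ^ (-σ) ≤ ((i : ℝ) / 2) ^ (-σ) :=
          Real.rpow_le_rpow_of_nonpos (by positivity) h4 (by linarith)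
      _ = 2 ^ σ * (i : ℝ) ^ (-σ) := by
          rw [Real.div_rpow hi0.le (by norm_num), Real.rpow_neg (by norm_num : (0:ℝ) ≤ 2)]
          field_simp
  · intro s hs hs1 η hη x hx
    have hI : barrier β γ T a₀ j x = (Finset.range (Nat.log 2 j + 1)).inf'
        Finset.nonempty_range_add_one
        fun k => bowl β ((j - 2 ^ k) * T) (2 ^ k * T) (a₀ * 2 ^ (-(γ * k))) x := by
      rcases min_choice (2:ℝ) ((Finset.range (Nat.log 2 j + 1)).inf' Finset.nonempty_range_add_one
        fun k => bowl β ((j - 2 ^ k) * T) (2 ^ k * T) (a₀ * 2 ^ (-(γ * k))) x) with h | h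
      · exact absurd (h : barrier β γ T a₀ j x = 2) hx.ne
      · exact h
    -- The bowl attaining the minimum lies above the barrier everywhere and touches it at x, so the
    -- operator bound for that bowl transfers to the barrier.
    obtain ⟨k, hk, hkeq⟩ := Finset.exists_mem_eq_inf' (Finset.nonempty_range_add_one (n := Nat.log 2 j))
      fun k => bowl β ((j - 2 ^ k) * T) (2 ^ k * T) (a₀ * 2 ^ (-(γ * k))) x
    rw [hkeq] at hI
    have h2k : (1:ℝ) ≤ 2 ^ k := one_le_pow₀ (by norm_num)
    have hL0 : 0 < 2 ^ k * T := by positivity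
    have hL1 : 1 ≤ 2 ^ k * T := one_le_mul_of_one_le_of_one_le h2k hT1
    have hσs : σ ≤ s * p := by rw [hσ]; gcongr
    have h := hnl s (2 ^ k * T) ((j - 2 ^ k) * T) (a₀ * 2 ^ (-(γ * k))) η (by linarith) hs1 hL0
      (mul_nonneg (sub_nonneg.2 (two_pow_log_le hj hk)) hT0.le) hη (barrier β γ T a₀ j)
      (measurable_barrier _ _ _ _ _) (fun y => (barrier_pos hT0 ha₀ j y).le)
      (fun y => min_le_left _ _) (fun y => barrier_le_bowl hk y) x hI (by
        by_contra hcon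
        have := two_lt_bowl (β := β) (a := a₀ * 2 ^ (-(γ * k))) (by linarith) hL0 (by positivity)
          (not_le.1 hcon).le
        linarith)
    refine h.trans ?_
    have hzle : a₀ * 2 ^ (-(γ * k)) ≤ barrier β γ T a₀ j x := by
      rw [hI]; exact le_bowl hL0 x
    have hzp := Real.rpow_le_rpow (by positivity) hzle hm1.le
    rw [hpowγ] at hzp
    have h5 : (2 ^ k * T) ^ (-(s * p)) ≤ ((2:ℝ) ^ k) ^ (-σ) * T⁻¹ := by
      calc (2 ^ k * T) ^ (-(s * p)) ≤ (2 ^ k * T) ^ (-σ) :=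
            Real.rpow_le_rpow_of_exponent_le hL1 (by linarith)
        _ = ((2:ℝ) ^ k) ^ (-σ) * T ^ (-σ) := Real.mul_rpow (by positivity) hT0.le
        _ ≤ ((2:ℝ) ^ k) ^ (-σ) * T ^ (-1 : ℝ) := by
            gcongr ?_ * ?_
            exact Real.rpow_le_rpow_of_exponent_le hT1 (by linarith)
        _ = _ := by rw [Real.rpow_neg_one]
    have h6 : C * T⁻¹ ≤ c₁ / p * a₀ ^ (m - 1) := by
      have : C * p / (c₁ * a₀ ^ (m - 1)) ≤ T := le_max_right _ _
      rw [div_le_iff₀ (by positivity)] at this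
      rw [← div_eq_mul_inv, div_le_iff₀ hT0, div_mul_eq_mul_div, div_mul_eq_mul_div,
        le_div_iff₀ hp0]
      linarith
    calc C * (2 ^ k * T) ^ (-(s * p)) ≤ C * (((2:ℝ) ^ k) ^ (-σ) * T⁻¹) := by gcongr
      _ = C * T⁻¹ * ((2:ℝ) ^ k) ^ (-σ) := by ring
      _ ≤ c₁ / p * a₀ ^ (m - 1) * ((2:ℝ) ^ k) ^ (-σ) := by gcongr
      _ = c₁ / p * (a₀ ^ (m - 1) * ((2:ℝ) ^ k) ^ (-σ)) := by ring
      _ ≤ _ := by gcongr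

/-! ### Averaging the layer estimate over concentric balls. -/

lemma sum_shifted_le_tsum {b : ℕ → ℝ} (hb : Summable b) (hb0 : ∀ i, 0 ≤ b i) (F : Finset ℕ)
    (j₀ : ℕ) : ∑ j ∈ F with j₀ ≤ j, b (j - j₀) ≤ ∑' i, b i := by
  have hinj : Set.InjOn (fun j => j - j₀) ({j ∈ F | j₀ ≤ j} : Finset ℕ) := by
    intro a ha c hc h
    simp only [Finset.coe_filter, Set.mem_ofPred_eq] at ha hc h
    omega
  rw [← Finset.sum_image (f := b) hinj]
  exact hb.sum_le_tsum _ (fun i _ => hb0 i)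

/-- The layer estimate averaged over concentric balls. -/
lemma exists_layer_estimate {n : ℕ} (hn : 1 ≤ n) {p m s₀ c₁ ϑ : ℝ} (hp : 1 < p) (hpm : p ≤ m)
    (hs₀ : 1 < s₀ * p) (hc₁ : 0 < c₁) (hϑ : -1 < ϑ) :
    ∃ T S : ℝ, 1 ≤ T ∧ 0 < S ∧ ∀ s, s₀ ≤ s → s < 1 → ∀ (W : ℝ → ℝ) (lam Lam θ q : ℝ),
      IsPotential W m lam Lam θ q c₁ → ϑ ≤ -1 + q →
      ∀ Ω : Set (E n), MeasurableSet Ω → volume Ω ≠ ⊤ → ∀ (ε : ℝ), 0 ≤ ε → ∀ u : E n → ℝ,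
      MinimizesUpTo W s p ε Ω u → ∀ N : ℕ, Metric.ball 0 (2 * N * T) ⊆ Ω →
      ∀ D : Set (E n), MeasurableSet D → D ⊆ Metric.ball 0 (N * T) →
      (∀ x ∈ D, (1 + ϑ) / 2 ≤ 1 + u x ∧ u x ≤ ϑ) →
      N * (c₁ * ((1 + ϑ) / 4) ^ ⌈m⌉₊ * volume.real D) ≤ N * ε +
        (2 * Lam + 2 * c₁) * S * volume.real (Metric.ball 0 (2 * N * T) ∩ {x | ϑ < u x}) := by
  set a₀ := (1 + ϑ) / 4 with ha₀def
  have ha₀ : 0 < a₀ := by rw [ha₀def]; linarith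
  obtain ⟨T, K, hT1, hK, hbar⟩ := exists_barrier hn hp hpm hs₀ hc₁ ha₀
  have hT0 : 0 < T := by linarith
  -- Majorant of z^{m-1} at depth i steps: only z ≤ 2 is known in the outermost shell, i = 0, and
  -- the decay holds beyond it. Summability is where s₀p > 1 enters.
  let b : ℕ → ℝ := fun i => (if i = 0 then (2:ℝ) ^ (m - 1) else 0) + K * (i : ℝ) ^ (-(s₀ * p))
  have hb0 : ∀ i, 0 ≤ b i := fun i => by
    have : (0:ℝ) ≤ if i = 0 then (2:ℝ) ^ (m - 1) else 0 := by split_ifs <;> positivity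
    positivity
  have hbs : Summable b := by
    refine Summable.add ?_ ((Real.summable_nat_rpow.2 (by linarith)).mul_left K)
    exact summable_of_ne_finset_zero (s := {0}) (fun i hi => by simp at hi; simp [hi])
  have hS0 : 0 < ∑' i, b i := by
    refine hbs.tsum_pos hb0 0 ?_
    have : (0:ℝ) ≤ K * ((0:ℕ) : ℝ) ^ (-(s₀ * p)) := by positivity
    have h2 : (0:ℝ) < 2 ^ (m - 1) := by positivity
    simp only [b, if_true]; linarith
  refine ⟨T, ∑' i, b i, hT1, hS0, ?_⟩
  intro s hs hs1 W lam Lam θ q hW hϑq Ω hΩ hΩf ε hε u hmin N hNΩ D hD hDN hDu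
  have hLam : 0 < Lam := by linarith [hW.one_le_Lam]
  have hsp : 0 < s * p := by nlinarith
  -- The j-th barrier belongs to radius (j+1)T, so that it is already at most a₀ on the ball of
  -- radius jT, which contains D for all j ≥ N.
  choose z hzm hz0 hz2 hzout hzin hzdec hznl using fun j : ℕ => hbar (j + 1) (by omega)
  set U : Set (E n) := {x | ϑ < u x} with hU
  let F : Finset ℕ := Finset.Ico N (2 * N)
  have hstep : ∀ j ∈ F, ENNReal.ofReal (c₁ * a₀ ^ ⌈m⌉₊) * volume D ≤ ENNReal.ofReal ε +
      ENNReal.ofReal (2 * Lam + 2 * c₁) * ∫⁻ x in Metric.ball 0 (((j + 1 : ℕ) : ℝ) * T) ∩ U,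
        ENNReal.ofReal (z j x ^ (m - 1)) := by
    intro j hj
    have hj1 : N ≤ j := (Finset.mem_Ico.1 hj).1
    have hj2 : j + 1 ≤ 2 * N := (Finset.mem_Ico.1 hj).2
    have hj1' : (N:ℝ) ≤ j := by exact_mod_cast hj1
    have hj2' : ((j + 1 : ℕ) : ℝ) ≤ 2 * N := by exact_mod_cast hj2
    refine layer_measure_le hn hW hp hpm hsp hs1 ha₀ hϑq hΩ hΩf hmin (hzm j) (hz0 j) (hz2 j)
      measurableSet_ball ((Metric.ball_subset_ball (by gcongr)).trans hNΩ)
      (fun x hx => hzout j x (by simpa using hx)) (fun η hη x hx => hznl j s hs hs1 η hη x hx) hD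
      (hDN.trans (Metric.ball_subset_ball (by gcongr; linarith))) ?_
    intro x hx
    refine ⟨hzin j x ?_, ?_, (hDu x hx).2⟩
    · have h1 : ‖x‖ < N * T := by simpa using hDN hx
      have : (N:ℝ) * T ≤ j * T := by gcongr
      push_cast; linarith
    · have := (hDu x hx).1
      rw [ha₀def]; linarith
  have hptw : ∀ x : E n, ∑ j ∈ F, (Metric.ball (0 : E n) (((j + 1 : ℕ) : ℝ) * T)).indicator
      (fun x => z j x ^ (m - 1)) x ≤ ∑' i, b i := by
    intro x
    -- x lies in shell j₀, hence at depth j - j₀ in the j-th ball; a fixed point meets each depth at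
    -- most once as j varies, so the sum does not grow with N.
    set j₀ := ⌊‖x‖ / T⌋₊ with hj₀
    have hxlt : ‖x‖ < (j₀ + 1) * T := by
      rw [← div_lt_iff₀ hT0]; exact Nat.lt_floor_add_one _
    refine le_trans ?_ (sum_shifted_le_tsum hbs hb0 F j₀)
    rw [Finset.sum_filter]
    refine Finset.sum_le_sum fun j _ => ?_
    by_cases hx : x ∈ Metric.ball (0 : E n) (((j + 1 : ℕ) : ℝ) * T)
    · rw [indicator_of_mem hx]
      have hx' : ‖x‖ / T < ((j + 1 : ℕ) : ℝ) := by
        rw [div_lt_iff₀ hT0]; simpa using hx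
      have hjj : j₀ ≤ j := Nat.lt_succ_iff.1 ((Nat.floor_lt (by positivity)).2 hx')
      rw [if_pos hjj]
      rcases Nat.eq_zero_or_pos (j - j₀) with h0 | hpos
      · have : z j x ^ (m - 1) ≤ 2 ^ (m - 1) :=
          Real.rpow_le_rpow (hz0 j x).le (hz2 j x) (by linarith)
        have h3 : (0:ℝ) ≤ K * ((0:ℕ) : ℝ) ^ (-(s₀ * p)) := by positivity
        rw [h0]; simp only [b, if_true]; linarith
      · have h := hzdec j (j - j₀) hpos (by omega) x (by
          push_cast [Nat.cast_sub hjj]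
          refine hxlt.le.trans (le_of_eq ?_)
          ring)
        simp only [b, hpos.ne', if_false, zero_add]
        exact h
    · rw [indicator_of_notMem hx]
      split_ifs
      exacts [hb0 _, le_rfl]
  set V : ENNReal := volume (Metric.ball (0 : E n) (2 * N * T) ∩ U) with hV
  have hVfin : V ≠ ⊤ := measure_ne_top_of_subset inter_subset_left measure_ball_lt_top.ne
  have hDfin : volume D ≠ ⊤ := measure_ne_top_of_subset hDN measure_ball_lt_top.ne
  have hsumint : ∑ j ∈ F, ∫⁻ x in Metric.ball 0 (((j + 1 : ℕ) : ℝ) * T) ∩ U,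
      ENNReal.ofReal (z j x ^ (m - 1)) ≤ ENNReal.ofReal (∑' i, b i) * V := by
    have h1 : ∀ j ∈ F, ∫⁻ x in Metric.ball 0 (((j + 1 : ℕ) : ℝ) * T) ∩ U,
        ENNReal.ofReal (z j x ^ (m - 1)) =
        ∫⁻ x in Metric.ball 0 (2 * N * T) ∩ U, ENNReal.ofReal
          ((Metric.ball (0 : E n) (((j + 1 : ℕ) : ℝ) * T)).indicator
            (fun x => z j x ^ (m - 1)) x) := by
      intro j hj
      have hj2' : ((j + 1 : ℕ) : ℝ) ≤ 2 * N := by exact_mod_cast (Finset.mem_Ico.1 hj).2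
      have e : (fun x => ENNReal.ofReal ((Metric.ball (0 : E n) (((j + 1 : ℕ) : ℝ) * T)).indicator
            (fun x => z j x ^ (m - 1)) x)) =
          (Metric.ball (0 : E n) (((j + 1 : ℕ) : ℝ) * T)).indicator
            (fun x => ENNReal.ofReal (z j x ^ (m - 1))) := by
        funext x
        by_cases hx : x ∈ Metric.ball (0 : E n) (((j + 1 : ℕ) : ℝ) * T)
        · rw [indicator_of_mem hx, indicator_of_mem hx]
        · rw [indicator_of_notMem hx, indicator_of_notMem hx, ENNReal.ofReal_zero]
      rw [e, lintegral_indicator measurableSet_ball, Measure.restrict_restrict measurableSet_ball,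
        ← inter_assoc, inter_eq_left.2 (Metric.ball_subset_ball (by gcongr))]
    rw [Finset.sum_congr rfl h1, ← lintegral_finsetSum']
    · calc _ ≤ ∫⁻ _ in Metric.ball 0 (2 * N * T) ∩ U, ENNReal.ofReal (∑' i, b i) := by
            refine lintegral_mono fun x => ?_
            rw [← ENNReal.ofReal_sum_of_nonneg]
            · exact ENNReal.ofReal_le_ofReal (hptw x)
            · intro j _
              exact indicator_nonneg (fun y _ => Real.rpow_nonneg (hz0 j y).le _) _
        _ = _ := by rw [lintegral_const, Measure.restrict_apply_univ]
    · intro j _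
      exact (((hzm j).pow_const _).indicator measurableSet_ball).ennreal_ofReal.aemeasurable
  have htot : (N : ENNReal) * (ENNReal.ofReal (c₁ * a₀ ^ ⌈m⌉₊) * volume D) ≤
      N * ENNReal.ofReal ε +
      ENNReal.ofReal (2 * Lam + 2 * c₁) * (ENNReal.ofReal (∑' i, b i) * V) := by
    have h := Finset.sum_le_sum hstep
    have hcard : F.card = N := by simp [F]; omega
    rw [Finset.sum_add_distrib, ← Finset.mul_sum F _ (ENNReal.ofReal (2 * Lam + 2 * c₁)),
      Finset.sum_const, Finset.sum_const, hcard, nsmul_eq_mul, nsmul_eq_mul] at h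
    refine h.trans ?_
    gcongr
  have hreal := ENNReal.toReal_mono (by
    refine ENNReal.add_ne_top.2 ⟨ENNReal.mul_ne_top (by simp) ENNReal.ofReal_ne_top, ?_⟩
    exact ENNReal.mul_ne_top ENNReal.ofReal_ne_top
      (ENNReal.mul_ne_top ENNReal.ofReal_ne_top hVfin)) htot
  rw [ENNReal.toReal_add (ENNReal.mul_ne_top (by simp) ENNReal.ofReal_ne_top)
    (ENNReal.mul_ne_top ENNReal.ofReal_ne_top (ENNReal.mul_ne_top ENNReal.ofReal_ne_top hVfin))]
    at hreal
  simp only [ENNReal.toReal_mul, ENNReal.toReal_natCast] at hreal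
  rw [ENNReal.toReal_ofReal (by positivity), ENNReal.toReal_ofReal hε,
    ENNReal.toReal_ofReal (by positivity), ENNReal.toReal_ofReal hS0.le, ← mul_assoc (2 * Lam + _)]
    at hreal
  exact hreal

/-! ### Transition layers of Hölder functions and an isoperimetric inequality. -/

lemma continuousOn_of_local_holder {X : Type*} [PseudoMetricSpace X] {f : X → ℝ} {s : Set X}
    {M α : ℝ} (hα : 0 < α)
    (h : ∀ x ∈ s, ∀ y ∈ s, dist x y < 1 → |f x - f y| ≤ M * dist x y ^ α) : ContinuousOn f s := by
  intro x hx
  rw [ContinuousWithinAt, tendsto_iff_dist_tendsto_zero]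
  have h0 : Filter.Tendsto (fun y => M * dist y x ^ α) (nhdsWithin x s) (nhds 0) := by
    have h1 : Filter.Tendsto (fun y => dist y x) (nhdsWithin x s) (nhds 0) :=
      (tendsto_iff_dist_tendsto_zero.1 Filter.tendsto_id).mono_left nhdsWithin_le_nhds
    have h2 := (h1.rpow_const (p := α) (Or.inr hα.le)).const_mul M
    simpa [Real.zero_rpow hα.ne'] using h2
  refine squeeze_zero' (Filter.Eventually.of_forall fun _ => dist_nonneg) ?_ h0
  filter_upwards [self_mem_nhdsWithin, nhdsWithin_le_nhds (Metric.ball_mem_nhds x one_pos)]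
    with y hy hyx
  rw [Real.dist_eq]
  exact h y hy x hx hyx

/-- A Hölder function on an interval that takes a value above `b` and one not above `a` stays in
`(a, b]` for a definite amount of time. -/
lemma le_volume_crossing {γ : ℝ → ℝ} {h M α a b d t₀ t₁ : ℝ} (hα : 0 < α) (hM : 0 ≤ M)
    (hd1 : d ≤ 1) (hMd : M * d ^ α < b - a)
    (hγ : ∀ s ∈ Ioo (-h) h, ∀ t ∈ Ioo (-h) h, dist s t < 1 → |γ s - γ t| ≤ M * dist s t ^ α)
    (ht₀ : t₀ ∈ Ioo (-h) h) (ht₁ : t₁ ∈ Ioo (-h) h) (hγ₀ : b < γ t₀) (hγ₁ : γ t₁ ≤ a) :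
    ENNReal.ofReal d ≤ volume {t | t ∈ Ioo (-h) h ∧ a < γ t ∧ γ t ≤ b} := by
  wlog hlt : t₀ ≤ t₁ generalizing γ t₀ t₁
  · have hneg : ∀ t : ℝ, t ∈ Ioo (-h) h → -t ∈ Ioo (-h) h := fun t ht =>
      ⟨by linarith [ht.2], by linarith [ht.1]⟩
    have h1 := this (γ := fun t => γ (-t)) (t₀ := -t₀) (t₁ := -t₁)
      (fun s hs t ht hst => by
        have := hγ (-s) (hneg s hs) (-t) (hneg t ht) (by rwa [dist_neg_neg])
        rwa [dist_neg_neg] at this)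
      (hneg _ ht₀) (hneg _ ht₁) (by simpa using hγ₀) (by simpa using hγ₁) (by linarith)
    refine h1.trans (le_of_eq ?_)
    rw [← Measure.measure_preimage_neg volume {t | t ∈ Ioo (-h) h ∧ a < γ t ∧ γ t ≤ b}]
    congr 1
    ext t
    simp only [mem_ofPred_eq, mem_preimage, mem_Ioo]
    constructor
    · rintro ⟨⟨h1, h2⟩, h3, h4⟩; exact ⟨⟨by linarith, by linarith⟩, h3, h4⟩
    · rintro ⟨⟨h1, h2⟩, h3, h4⟩; exact ⟨⟨by linarith, by linarith⟩, h3, h4⟩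
  have hc : ContinuousOn γ (Ioo (-h) h) := continuousOn_of_local_holder hα hγ
  have hsub : Icc t₀ t₁ ⊆ Ioo (-h) h := fun t ht => ⟨ht₀.1.trans_le ht.1, ht.2.trans_lt ht₁.2⟩
  have hcB : IsCompact (Icc t₀ t₁ ∩ γ ⁻¹' Iic a) :=
    isCompact_Icc.of_isClosed_subset ((hc.mono hsub).preimage_isClosed_of_isClosed isClosed_Icc
      isClosed_Iic) inter_subset_left
  -- b' is the first time after t₀ with value at most a, and a' below is the last time before b'
  -- with value at least b. Strictly between them the values lie in (a, b), and the Hölder bound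
  -- makes b' - a' at least d.
  obtain ⟨b', hb', hb'min⟩ := hcB.exists_isLeast ⟨t₁, ⟨hlt, le_rfl⟩, hγ₁⟩
  have hsub2 : Icc t₀ b' ⊆ Ioo (-h) h := (Icc_subset_Icc_right hb'.1.2).trans hsub
  have hcA : IsCompact (Icc t₀ b' ∩ γ ⁻¹' Ici b) :=
    isCompact_Icc.of_isClosed_subset ((hc.mono hsub2).preimage_isClosed_of_isClosed isClosed_Icc
      isClosed_Ici) inter_subset_left
  obtain ⟨a', ha', ha'max⟩ := hcA.exists_isGreatest ⟨t₀, ⟨le_rfl, hb'.1.1⟩, hγ₀.le⟩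
  have hγb : γ b' ≤ a := hb'.2
  have hγa : b ≤ γ a' := ha'.2
  have hle : a' ≤ b' := ha'.1.2
  have hdd : d ≤ b' - a' := by
    by_contra hcon
    have hdist : dist a' b' = b' - a' := by
      rw [dist_comm, Real.dist_eq, abs_of_nonneg (by linarith)]
    have h1 := hγ a' (hsub2 ha'.1) b' (hsub hb'.1) (by rw [hdist]; linarith)
    rw [hdist] at h1
    have h2 : M * (b' - a') ^ α ≤ M * d ^ α :=
      mul_le_mul_of_nonneg_left (Real.rpow_le_rpow (by linarith) (by linarith) hα.le) hM
    have := le_abs_self (γ a' - γ b')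
    linarith
  calc ENNReal.ofReal d ≤ ENNReal.ofReal (b' - a') := ENNReal.ofReal_le_ofReal hdd
    _ = volume (Ioo a' b') := Real.volume_Ioo.symm
    _ ≤ _ := by
        refine measure_mono fun t ht => ?_
        have htm : t ∈ Icc t₀ b' := ⟨ha'.1.1.trans ht.1.le, ht.2.le⟩
        refine ⟨hsub2 htm, ?_, ?_⟩
        · by_contra hcon
          have := hb'min ⟨⟨htm.1, htm.2.trans hb'.1.2⟩, not_lt.1 hcon⟩
          linarith [ht.2]
        · by_contra hcon
          have := ha'max ⟨htm, (not_le.1 hcon).le⟩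
          linarith [ht.1]

/-- Isoperimetric inequality in a cube, from the behaviour of the sets along axis-parallel lines. -/
lemma cube_isoperimetric {n : ℕ} (hn : 1 ≤ n) {h d : ℝ} (hh : 0 < h) (hd1 : d ≤ 1)
    {G S : Set (Fin n → ℝ)} (hG : MeasurableSet G) (hS : MeasurableSet S)
    (hSne : S.Nonempty)
    (hline : ∀ x ∈ S, ∀ i, (∀ t ∈ Ioo (-h) h, Function.update x i t ∈ G) ∨
      ENNReal.ofReal d ≤ volume {t | Function.update x i t ∈ G \ S}) :
    ENNReal.ofReal d * volume S ^ (((n : ℝ) - 1) / n) ≤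
      volume (G \ S) + ENNReal.ofReal (1 / (2 * h)) * volume G := by
  -- The second term handles lines that never leave G: its integral over the full segment of length
  -- 2h is 1 ≥ d. Every line through S thus carries mass at least d.
  let f : (Fin n → ℝ) → ENNReal := fun x =>
    (G \ S).indicator (fun _ => 1) x + ENNReal.ofReal (1 / (2 * h)) * G.indicator (fun _ => 1) x
  have hf1 : Measurable ((G \ S).indicator (fun _ => (1 : ENNReal))) :=
    measurable_const.indicator (hG.diff hS)
  have hf2 : Measurable (G.indicator (fun _ => (1 : ENNReal))) := measurable_const.indicator hG
  have hf : Measurable f := hf1.add (hf2.const_mul _)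
  have hI : ∫⁻ x, f x = volume (G \ S) + ENNReal.ofReal (1 / (2 * h)) * volume G := by
    rw [lintegral_add_left hf1, lintegral_const_mul _ hf2, lintegral_indicator (hG.diff hS),
      lintegral_indicator hG]
    simp
  have hone : ∀ x ∈ S, ∀ i, ENNReal.ofReal d ≤ ∫⁻ t, f (Function.update x i t) := by
    intro x hx i
    have hup : Measurable (fun t : ℝ => Function.update x i t) := measurable_update x
    rcases hline x hx i with hfull | hcross
    · have h1 : ∫⁻ t in Ioo (-h) h, ENNReal.ofReal (1 / (2 * h)) ≤
          ∫⁻ t, f (Function.update x i t) := by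
        rw [← lintegral_indicator measurableSet_Ioo]
        refine lintegral_mono fun t => ?_
        by_cases ht : t ∈ Ioo (-h) h
        · rw [indicator_of_mem ht]
          simp only [f, indicator_of_mem (hfull t ht), mul_one]
          exact le_add_self
        · rw [indicator_of_notMem ht]; exact zero_le
      refine le_trans ?_ h1
      rw [lintegral_const, Measure.restrict_apply_univ, Real.volume_Ioo,
        ← ENNReal.ofReal_mul (by positivity)]
      refine ENNReal.ofReal_le_ofReal (hd1.trans (le_of_eq ?_))
      field_simp; ring
    · refine hcross.trans ?_
      have hm : MeasurableSet {t | Function.update x i t ∈ G \ S} := hup (hG.diff hS)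
      rw [← lintegral_indicator_one hm]
      refine lintegral_mono fun t => ?_
      by_cases ht : Function.update x i t ∈ G \ S
      · rw [indicator_of_mem (show t ∈ {t | Function.update x i t ∈ G \ S} from ht)]
        simp only [f, indicator_of_mem ht]
        exact le_self_add
      · rw [indicator_of_notMem (show t ∉ {t | Function.update x i t ∈ G \ S} from ht)]
        exact zero_le
  rw [← hI]
  -- In dimension one the exponent is 0, and a single line through a point of S, hence nonemptiness,
  -- is needed. Otherwise the grid-lines inequality bounds the product of line integrals by a power
  -- of ∫ f.
  rcases hn.eq_or_lt with h1 | h2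
  · subst h1
    obtain ⟨x, hx⟩ := hSne
    have h3 := hone x hx 0
    have h4 : ∫⁻ t, f (Function.update x 0 t) = ∫⁻ x, f x := by
      have e := lintegral_eq_lmarginal_univ (μ := fun _ : Fin 1 => (volume : Measure ℝ)) (f := f) x
      have hu : (Finset.univ : Finset (Fin 1)) = {0} := rfl
      rw [hu, lmarginal_singleton] at e
      rw [volume_pi, e]
    rw [h4] at h3
    simpa using h3
  · have hn1 : (1:ℝ) < n := by exact_mod_cast h2
    have hq : Real.HolderConjugate (n : ℝ) (n / (n - 1)) := Real.HolderConjugate.conjExponent hn1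
    have hgrid := lintegral_prod_lintegral_pow_le (ι := Fin n) (A := fun _ => ℝ)
      (fun _ => (volume : Measure ℝ)) (p := n / (n - 1)) (by simpa using hq) hf
    rw [← volume_pi] at hgrid
    simp only [Fintype.card_fin] at hgrid
    have hlow : ENNReal.ofReal d ^ ((n:ℝ) / (n - 1)) * volume S ≤
        ∫⁻ x, ∏ i, (∫⁻ t, f (Function.update x i t)) ^ ((1:ℝ) / (n - 1)) := by
      rw [← setLIntegral_const, ← lintegral_indicator hS]
      refine lintegral_mono fun x => ?_
      by_cases hx : x ∈ S
      · rw [indicator_of_mem hx]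
        calc ENNReal.ofReal d ^ ((n:ℝ) / (n - 1)) =
            ∏ _i : Fin n, ENNReal.ofReal d ^ ((1:ℝ) / (n - 1)) := by
              rw [Finset.prod_const, Finset.card_univ, Fintype.card_fin, ← ENNReal.rpow_mul_natCast]
              congr 1; ring
          _ ≤ _ := by
              refine Finset.prod_le_prod' fun i _ => ?_
              refine ENNReal.rpow_le_rpow (hone x hx i) ?_
              exact div_nonneg zero_le_one (by linarith)
      · rw [indicator_of_notMem hx]; exact zero_le
    have h5 := hlow.trans hgrid
    have hpos : 0 < (n:ℝ) / (n - 1) := div_pos (by linarith) (by linarith)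
    have h6 := ENNReal.rpow_le_rpow h5 (z := ((n:ℝ) - 1) / n)
      (div_nonneg (by linarith) (by linarith))
    have hinv : (n:ℝ) / (n - 1) * ((n - 1) / n) = 1 := by
      have : (n:ℝ) - 1 ≠ 0 := by linarith
      field_simp
    rwa [ENNReal.mul_rpow_of_nonneg _ _ (div_nonneg (by linarith) (by linarith)),
      ← ENNReal.rpow_mul, ← ENNReal.rpow_mul, hinv, ENNReal.rpow_one, ENNReal.rpow_one] at h6

/-- The open cube of half side `h`. -/
def cube (n : ℕ) (h : ℝ) : Set (E n) := {x | ∀ i, x i ∈ Ioo (-h) h}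

lemma isOpen_cube (n : ℕ) (h : ℝ) : IsOpen (cube n h) := by
  have : cube n h = ⋂ i, (fun x : E n => x i) ⁻¹' Ioo (-h) h := by
    ext x; simp [cube]
  rw [this]
  exact isOpen_iInter_of_finite fun i => isOpen_Ioo.preimage (by fun_prop)

lemma ball_subset_cube (n : ℕ) (h : ℝ) : Metric.ball 0 h ⊆ cube n h := by
  intro x hx i
  have h1 : ‖x‖ < h := by simpa using hx
  have := (PiLp.norm_apply_le x i).trans_lt h1
  rwa [Real.norm_eq_abs, abs_lt] at this

lemma cube_subset_ball {n : ℕ} (hn : 1 ≤ n) {h r : ℝ} (hh : 0 < h) (hr : (√n) * h ≤ r) :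
    cube n h ⊆ Metric.ball 0 r := by
  intro x hx
  rw [mem_ball_zero_iff]
  refine lt_of_lt_of_le ?_ hr
  rw [EuclideanSpace.norm_eq, ← Real.sqrt_sq hh.le, ← Real.sqrt_mul (by positivity)]
  refine Real.sqrt_lt_sqrt (by positivity) ?_
  have : ∑ i : Fin n, ‖x i‖ ^ 2 < ∑ _i : Fin n, h ^ 2 := by
    have : Nonempty (Fin n) := ⟨⟨0, hn⟩⟩
    refine Finset.sum_lt_sum_of_nonempty Finset.univ_nonempty fun i _ => ?_
    rw [Real.norm_eq_abs, sq_abs]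
    have := hx i
    exact sq_lt_sq' this.1 this.2
  simpa using this

/-- A Hölder function has a large transition layer in a cube. -/
lemma exists_transition_layer {n : ℕ} (hn : 1 ≤ n) (M : NNReal) {α a b : ℝ} (hα : 0 < α)
    (hab : a < b) :
    ∃ d : ℝ, 0 < d ∧ ∀ (u : E n → ℝ) (h : ℝ), 1 / 2 ≤ h →
      (∀ x ∈ cube n h, ∀ y ∈ cube n h, dist x y < 1 → |u x - u y| ≤ M * dist x y ^ α) →
      MeasurableSet (cube n h ∩ {x | a < u x ∧ u x ≤ b}) ∧
      ((cube n h ∩ {x | b < u x}).Nonempty →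
        d * volume.real (cube n h ∩ {x | b < u x}) ^ (((n:ℝ) - 1) / n) ≤
          2 * volume.real (cube n h ∩ {x | a < u x ∧ u x ≤ b}) +
            volume.real (cube n h ∩ {x | b < u x}) / (2 * h)) := by
  -- A crossing time below which the Hölder oscillation stays under b - a; the cap at 1 keeps the
  -- points within the range of the local Hölder bound.
  set d := min 1 (((b - a) / (2 * (M + 1))) ^ (1 / α)) with hd
  have hM : (0:ℝ) ≤ M := M.2
  have hba : 0 < (b - a) / (2 * (M + 1)) := div_pos (by linarith) (by positivity)
  have hd0 : 0 < d := lt_min one_pos (by positivity)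
  have hd1 : d ≤ 1 := min_le_left _ _
  have hMd : M * d ^ α < b - a := by
    have h1 : d ^ α ≤ (b - a) / (2 * (M + 1)) := by
      calc d ^ α ≤ (((b - a) / (2 * (M + 1))) ^ (1 / α)) ^ α :=
            Real.rpow_le_rpow hd0.le (min_le_right _ _) hα.le
        _ = _ := by rw [← Real.rpow_mul hba.le, one_div_mul_cancel hα.ne', Real.rpow_one]
    calc M * d ^ α ≤ M * ((b - a) / (2 * (M + 1))) := by gcongr
      _ < b - a := by
        rw [← mul_div_assoc, div_lt_iff₀ (by positivity)]; nlinarith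
  refine ⟨d, hd0, fun u h hh hol => ?_⟩
  have hh0 : 0 < h := by linarith
  have hc : ContinuousOn u (cube n h) := continuousOn_of_local_holder hα hol
  set S := cube n h ∩ {x | b < u x} with hSdef
  set G := cube n h ∩ {x | a < u x} with hGdef
  have hSm : MeasurableSet S :=
    (hc.isOpen_inter_preimage (isOpen_cube n h) isOpen_Ioi).measurableSet
  have hGm : MeasurableSet G :=
    (hc.isOpen_inter_preimage (isOpen_cube n h) isOpen_Ioi).measurableSet
  have hGS : G \ S = cube n h ∩ {x | a < u x ∧ u x ≤ b} := by
    ext x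
    simp only [hGdef, hSdef, mem_sdiff, mem_inter_iff, mem_ofPred_eq, not_and, not_lt]
    tauto
  rw [← hGS]
  refine ⟨hGm.diff hSm, fun hne => ?_⟩
  have hpres := (PiLp.volume_preserving_toLp (Fin n))
  let τ : (Fin n → ℝ) → E n := WithLp.toLp 2
  have hτ : MeasurePreserving τ := hpres
  have hvol : ∀ A : Set (E n), MeasurableSet A → volume (τ ⁻¹' A) = volume A := fun A hA =>
    hτ.measure_preimage hA.nullMeasurableSet
  have hbounded : cube n h ⊆ Metric.ball 0 (√n * h) := cube_subset_ball hn hh0 le_rfl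
  have hfin : ∀ A : Set (E n), A ⊆ cube n h → volume A ≠ ⊤ := fun A hA =>
    measure_ne_top_of_subset (hA.trans hbounded) measure_ball_lt_top.ne
  have hdist : ∀ (x : Fin n → ℝ) (i : Fin n) (s t : ℝ),
      dist (τ (Function.update x i s)) (τ (Function.update x i t)) = dist s t := by
    intro x i s t
    rw [EuclideanSpace.dist_eq, Finset.sum_eq_single i]
    · simp [τ, Real.sqrt_sq dist_nonneg]
    · intro j _ hj
      simp [τ, Function.update_of_ne hj]
    · simp
  have hmemc : ∀ (x : Fin n → ℝ) (i : Fin n) (t : ℝ), τ x ∈ cube n h → t ∈ Ioo (-h) h →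
      τ (Function.update x i t) ∈ cube n h := by
    intro x i t hx ht j
    by_cases hj : j = i
    · subst hj; simpa [τ] using ht
    · simpa [τ, Function.update_of_ne hj] using hx j
  have key := cube_isoperimetric hn hh0 hd1 (G := τ ⁻¹' G) (S := τ ⁻¹' S)
    (hτ.measurable hGm) (hτ.measurable hSm)
    (by obtain ⟨x, hx⟩ := hne; exact ⟨WithLp.ofLp x, by simpa [τ] using hx⟩) (by
      intro x hx i
      by_cases hfull : ∀ t ∈ Ioo (-h) h, Function.update x i t ∈ τ ⁻¹' G
      · exact Or.inl hfull
      · right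
        push Not at hfull
        obtain ⟨t₁, ht₁, hnot⟩ := hfull
        have hxc : τ x ∈ cube n h := hx.1
        have ht₀ : x i ∈ Ioo (-h) h := hxc i
        have hγ₁ : u (τ (Function.update x i t₁)) ≤ a := by
          by_contra hcon
          exact hnot ⟨hmemc x i t₁ hxc ht₁, not_le.1 hcon⟩
        have hγ₀ : b < u (τ (Function.update x i (x i))) := by
          rw [Function.update_eq_self]; exact hx.2
        refine (le_volume_crossing (γ := fun t => u (τ (Function.update x i t))) hα hM hd1 hMd
          (fun s hs t ht hst => ?_) ht₀ ht₁ hγ₀ hγ₁).trans (measure_mono ?_)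
        · have := hol _ (hmemc x i s hxc hs) _ (hmemc x i t hxc ht) (by rwa [hdist])
          rwa [hdist] at this
        · rintro t ⟨ht, h1, h2⟩
          exact ⟨⟨hmemc x i t hxc ht, h1⟩, fun hcon => absurd hcon.2 (not_lt.2 h2)⟩)
  rw [← preimage_sdiff, hvol _ hSm, hvol _ hGm, hvol _ (hGm.diff hSm)] at key
  have hGfin := hfin G inter_subset_left
  have hSfin := hfin S inter_subset_left
  have hDfin := hfin (G \ S) (sdiff_subset.trans inter_subset_left)
  have hreal := ENNReal.toReal_mono (ENNReal.add_ne_top.2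
    ⟨hDfin, ENNReal.mul_ne_top ENNReal.ofReal_ne_top hGfin⟩) key
  rw [ENNReal.toReal_add hDfin (ENNReal.mul_ne_top ENNReal.ofReal_ne_top hGfin),
    ENNReal.toReal_mul, ENNReal.toReal_mul, ENNReal.toReal_ofReal hd0.le,
    ENNReal.toReal_ofReal (by positivity), ← ENNReal.toReal_rpow] at hreal
  have hSG : S ⊆ G := fun x hx => ⟨hx.1, hab.trans hx.2⟩
  have hGsum : (volume G).toReal = volume.real (G \ S) + volume.real S := by
    have := measureReal_sdiff_add_inter (μ := volume) (s := G) (t := S) hSm hGfin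
    rw [inter_eq_right.2 hSG] at this
    exact this.symm
  rw [hGsum] at hreal
  have hD0 : 0 ≤ volume.real (G \ S) := measureReal_nonneg
  -- As 2h ≥ 1, the layer's share of |G|/(2h) is absorbed, which is the origin of the factor 2.
  have h1 : 1 / (2 * h) * volume.real (G \ S) ≤ 1 * volume.real (G \ S) := by
    gcongr
    rw [div_le_one (by positivity)]; linarith
  change d * volume.real S ^ _ ≤ volume.real (G \ S) + _ at hreal
  rw [div_eq_mul_one_div (volume.real S)]
  linarith

/-! ### From the recursion to the density of the superlevel set. -/

/-- A superlinear recursion along a geometric sequence forces growth of order `N ^ n`. -/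
lemma growth_of_recursion {n ν N₀ Nmax : ℕ} (hn : 1 ≤ n) (hν : 1 ≤ ν) (hN₀ : 1 ≤ N₀) {f : ℕ → ℝ}
    (hf : Monotone f) {c c₀ μ : ℝ} (hc : 0 < c) (hμ : 0 < μ) (hf₀ : c₀ ≤ f N₀)
    (hμ₀ : μ * ((ν : ℝ) * N₀) ^ n ≤ c₀) (hμc : μ ≤ (c / (2 * ν) ^ n) ^ n)
    (hrec : ∀ N, N₀ ≤ N → ν * N ≤ Nmax → c * N * f N ^ (((n : ℝ) - 1) / n) ≤ f (ν * N)) :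
    ∀ N, N₀ ≤ N → N ≤ Nmax → μ * (N : ℝ) ^ n ≤ f N := by
  have hn0 : (0 : ℝ) < n := by exact_mod_cast hn
  have hn1 : (1 : ℝ) ≤ n := by exact_mod_cast hn
  have hν0 : (0 : ℝ) < ν := by exact_mod_cast hν
  intro N
  induction N using Nat.strong_induction_on with
  | _ N ih =>
    intro hN hNmax
    rcases lt_or_ge N (ν * N₀) with hlt | hge
    · calc μ * (N : ℝ) ^ n ≤ μ * ((ν : ℝ) * N₀) ^ n := by
            have : (N : ℝ) ≤ ν * N₀ := by exact_mod_cast hlt.le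
            gcongr
        _ ≤ c₀ := hμ₀
        _ ≤ f N₀ := hf₀
        _ ≤ f N := hf hN
    -- Strong induction passes from N to N/ν, which fails to decrease only for ν = 1; then the
    -- recursion at N itself already gives f(N) ≥ (cN)^n.
    · by_cases hν1 : N / ν = N
      · have hν1' : ν = 1 := by
          by_contra hne
          exact absurd hν1 (Nat.div_lt_self (by omega) (by omega)).ne
        subst hν1'
        have h := hrec N hN (by simpa using hNmax)
        rw [one_mul] at h
        have hNpos : (0:ℝ) < N := by exact_mod_cast lt_of_lt_of_le hN₀ hN
        have hc0 : 0 < c₀ := lt_of_lt_of_le (by positivity) hμ₀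
        have hfN : 0 < f N := lt_of_lt_of_le hc0 (hf₀.trans (hf hN))
        have hfe : f N = f N ^ (((n : ℝ) - 1) / n) * f N ^ (1 / (n : ℝ)) := by
          rw [← Real.rpow_add hfN]
          have : ((n : ℝ) - 1) / n + 1 / n = 1 := by field_simp; ring
          rw [this, Real.rpow_one]
        have hcN : c * N ≤ f N ^ (1 / (n : ℝ)) := by
          have hpos : 0 < f N ^ (((n : ℝ) - 1) / n) := Real.rpow_pos_of_pos hfN _
          refine le_of_mul_le_mul_right ?_ hpos
          calc _ ≤ f N := h
            _ = _ := by rw [mul_comm]; exact hfe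
        have h2 : (c * N) ^ n ≤ f N := by
          calc (c * N) ^ n ≤ (f N ^ (1 / (n : ℝ))) ^ n := by gcongr
            _ = f N := by
              rw [← Real.rpow_natCast, ← Real.rpow_mul hfN.le, one_div_mul_cancel hn0.ne',
                Real.rpow_one]
        refine le_trans ?_ h2
        rw [mul_pow]
        gcongr
        refine hμc.trans ?_
        gcongr
        refine div_le_self hc.le (one_le_pow₀ (by norm_num))
      · set K := N / ν with hK
        have hKlt : K < N := lt_of_le_of_ne (Nat.div_le_self _ _) hν1
        have hKN₀ : N₀ ≤ K := (Nat.le_div_iff_mul_le (by omega)).2 (by rw [mul_comm]; exact hge)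
        have hKle : ν * K ≤ N := Nat.mul_div_le N ν
        have hK1 : (1:ℝ) ≤ K := by exact_mod_cast hN₀.trans hKN₀
        have hK0 : (0:ℝ) < K := by linarith
        -- Rounding in N/ν loses at most a factor 2, which explains (2ν)^n in the condition on μ.
        have hNlt : (N : ℝ) ≤ 2 * ν * K := by
          have h1 : N < ν * (K + 1) := Nat.lt_mul_div_succ N (by omega)
          have h2 : (N : ℝ) < ν * (K + 1) := by exact_mod_cast h1
          nlinarith
        have h1 := ih K hKlt hKN₀ (by omega)
        have h2 := hrec K hKN₀ (by omega)
        have h3 : f (ν * K) ≤ f N := hf hKle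
        have he : 0 ≤ ((n : ℝ) - 1) / n := div_nonneg (by linarith) hn0.le
        have h4 : (μ * (K : ℝ) ^ n) ^ (((n : ℝ) - 1) / n) ≤ f K ^ (((n : ℝ) - 1) / n) :=
          Real.rpow_le_rpow (by positivity) h1 he
        have h5 : (μ * (K : ℝ) ^ n) ^ (((n : ℝ) - 1) / n) * K =
            μ ^ (((n : ℝ) - 1) / n) * (K : ℝ) ^ n := by
          rw [Real.mul_rpow hμ.le (by positivity), ← Real.rpow_natCast, ← Real.rpow_mul hK0.le,
            mul_div_cancel₀ _ hn0.ne', mul_assoc, ← Real.rpow_add_one hK0.ne', sub_add_cancel]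
        have h6 : μ ^ (1 / (n : ℝ)) ≤ c / (2 * ν) ^ n := by
          calc μ ^ (1 / (n : ℝ)) ≤ ((c / (2 * ν) ^ n) ^ n) ^ (1 / (n : ℝ)) :=
                Real.rpow_le_rpow hμ.le hμc (by positivity)
            _ = _ := by
              rw [← Real.rpow_natCast (c / (2 * ν) ^ n), ← Real.rpow_mul (by positivity),
                mul_one_div_cancel hn0.ne', Real.rpow_one]
        have h7 : μ = μ ^ (((n : ℝ) - 1) / n) * μ ^ (1 / (n : ℝ)) := by
          rw [← Real.rpow_add hμ]
          have : ((n : ℝ) - 1) / n + 1 / n = 1 := by field_simp; ring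
          rw [this, Real.rpow_one]
        calc μ * (N : ℝ) ^ n ≤ μ * (2 * ν * K) ^ n := by gcongr
          _ = μ ^ (((n : ℝ) - 1) / n) * μ ^ (1 / (n : ℝ)) * ((2 * ν) ^ n * (K : ℝ) ^ n) := by
              rw [← h7, mul_pow]
          _ ≤ μ ^ (((n : ℝ) - 1) / n) * (c / (2 * ν) ^ n) * ((2 * ν) ^ n * (K : ℝ) ^ n) := by
              gcongr
          _ = c * (μ ^ (((n : ℝ) - 1) / n) * (K : ℝ) ^ n) := by field_simp
          _ = c * K * (μ * (K : ℝ) ^ n) ^ (((n : ℝ) - 1) / n) := by rw [← h5]; ring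
          _ ≤ c * K * f K ^ (((n : ℝ) - 1) / n) := by gcongr
          _ ≤ f N := h2.trans h3

/-- For r ≥ 1 the ball of radius r + 2 fits into that of radius 4r, so R = r is admissible in the
supremum. -/
lemma holder_of_ballHolderSeminorm_le {n : ℕ} {α r : ℝ} {M : NNReal} {Ω : Set (E n)}
    {u : E n → ℝ} (hu : ballHolderSeminorm α u Ω ≤ M) (hr : 1 ≤ r)
    (hΩ : Metric.ball 0 (4 * r) ⊆ Ω) {x y : E n} (hx : x ∈ Metric.ball 0 r) (hxy : dist x y < 1) :
    |u x - u y| ≤ M * dist x y ^ α := by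
  have hr0 : 0 < r := by linarith
  rcases eq_or_ne x y with rfl | hne
  · rw [sub_self, abs_zero]; positivity
  have h1 : edist (u x) (u y) / edist x y ^ α ≤ M := by
    refine le_trans ?_ hu
    refine le_trans ?_ (le_iSup₂_of_le (f := fun (R : ℝ)
      (_ : 0 < R ∧ Metric.ball (0 : E n) (R + 2) ⊆ Ω) => ⨆ x₀ ∈ Metric.ball (0 : E n) R,
        holderSeminorm α u (Metric.ball x₀ 1)) r
      ⟨hr0, (Metric.ball_subset_ball (by linarith)).trans hΩ⟩
      (le_iSup₂_of_le (f := fun (x₀ : E n) (_ : x₀ ∈ Metric.ball (0 : E n) r) =>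
        holderSeminorm α u (Metric.ball x₀ 1)) x hx le_rfl))
    unfold holderSeminorm
    refine le_iSup₂_of_le x (Metric.mem_ball_self one_pos) ?_
    refine le_iSup₂_of_le y ?_ le_rfl
    rw [Metric.mem_ball, dist_comm]; exact hxy
  have hd : 0 < dist x y := dist_pos.2 hne
  have hd' : edist x y ^ α = ENNReal.ofReal (dist x y ^ α) := by
    rw [edist_dist, ENNReal.ofReal_rpow_of_pos hd]
  have hpos : 0 < dist x y ^ α := Real.rpow_pos_of_pos hd _
  rw [hd', ENNReal.div_le_iff (by simpa using hpos) ENNReal.ofReal_ne_top, edist_dist,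
    ← ENNReal.ofReal_coe_nnreal, ← ENNReal.ofReal_mul (NNReal.coe_nonneg M),
    ENNReal.ofReal_le_ofReal_iff (by positivity), Real.dist_eq] at h1
  exact h1

set_option maxHeartbeats 1000000 in
/-- Density estimate for a superlevel set. -/
lemma exists_density_estimate {n : ℕ} (hn : 1 ≤ n) {p m s₀ c₁ ϑ : ℝ} (hp : 1 < p) (hpm : p ≤ m)
    (hs₀ : 1 < s₀ * p) (hc₁ : 0 < c₁) (hϑ : -1 < ϑ) {c₀ α : ℝ} (hc₀ : 0 < c₀) (hα : 0 < α)
    (M : NNReal) :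
    ∃ δ : ℝ, 0 < δ ∧ ∀ Lam r₀ : ℝ, 1 ≤ Lam → 0 < r₀ → ∃ ct : ℝ, 0 < ct ∧ ct < 1 ∧
      ∀ s, s₀ ≤ s → s < 1 → ∀ (W : ℝ → ℝ) (lam θ q : ℝ),
      IsPotential W m lam Lam θ q c₁ → ϑ ≤ -1 + q → ∀ (Ω : Set (E n)), IsOpen Ω →
      ∀ u : E n → ℝ, ballHolderSeminorm α u Ω ≤ M →
      c₀ < volume.real (Metric.ball 0 r₀ ∩ {x | ϑ < u x}) →
      ∀ ε, 0 ≤ ε → ε < δ → IsEpsMinimizer W s p ε Ω u → ∀ r, r₀ ≤ r →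
      Metric.ball 0 (4 * r) ⊆ Ω →
      ct * r ^ n < volume.real (Metric.ball 0 r ∩ {x | ϑ < u x}) := by
  obtain ⟨T, S, hT1, hS, hlayer⟩ := exists_layer_estimate hn hp hpm hs₀ hc₁ hϑ
  -- The lower level makes 1 + u > (1+ϑ)/2 on the layer, twice the value a₀ = (1+ϑ)/4 reached by the
  -- barriers.
  obtain ⟨d, hd, htrans⟩ := exists_transition_layer hn M (a := -1 + (1 + ϑ) / 2) (b := ϑ) hα
    (by linarith)
  have hT0 : 0 < T := by linarith
  have hn0 : (0:ℝ) < n := by exact_mod_cast hn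
  have hn1 : (1:ℝ) ≤ n := by exact_mod_cast hn
  set e := ((n : ℝ) - 1) / n with he
  have he0 : 0 ≤ e := div_nonneg (by linarith) hn0.le
  set κ := c₁ * ((1 + ϑ) / 4) ^ ⌈m⌉₊ with hκ
  have hκ0 : 0 < κ := mul_pos hc₁ (pow_pos (by linarith) _)
  -- Since f(N) ≥ c₀, this makes 2ε at most half of κ d f(N)^e, so it is absorbed on the left. It is
  -- fixed before Λ and r₀ are introduced.
  refine ⟨κ * d * c₀ ^ e / 4, by positivity, fun Lam r₀ hLam hr₀ => ?_⟩
  set ν := ⌈√n⌉₊ with hν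
  have hν1 : 1 ≤ ν := Nat.one_le_ceil_iff.2 (Real.sqrt_pos.2 hn0)
  have hνs : √n ≤ ν := Nat.le_ceil _
  set B := 2 * (2 * Lam + 2 * c₁) * S / κ + 1 with hB
  have hB0 : 0 < B := by positivity
  set c := d / (2 * B) with hc
  have hc0 : 0 < c := by positivity
  set N₀ := ⌈r₀⌉₊ with hN₀
  have hN₀1 : 1 ≤ N₀ := Nat.one_le_ceil_iff.2 hr₀
  have hN₀1' : (1:ℝ) ≤ N₀ := by exact_mod_cast hN₀1
  have hr₀N : r₀ ≤ N₀ * T := (Nat.le_ceil r₀).trans (le_mul_of_one_le_right (by positivity) hT1)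
  set μ := min (c₀ / (((2 * ν : ℕ) : ℝ) * N₀) ^ n) ((c / (2 * ((2 * ν : ℕ) : ℝ)) ^ n) ^ n) with hμ
  have hν0 : (0:ℝ) < ((2 * ν : ℕ) : ℝ) := by exact_mod_cast (by omega : 0 < 2 * ν)
  have hμ0 : 0 < μ := lt_min (by positivity) (by positivity)
  -- The inner two entries cover r < N₀T, where V ≥ c₀ suffices, and larger r, where the recursion
  -- is used; the half yields strict inequality.
  set ct := min 1 (min (c₀ / (N₀ * T) ^ n) (μ / (2 * T) ^ n)) / 2 with hct
  have hctpos : 0 < ct := half_pos (lt_min one_pos (lt_min (by positivity) (by positivity)))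
  have hct1 : 2 * ct ≤ 1 := by rw [hct, mul_div_cancel₀ _ two_ne_zero]; exact min_le_left _ _
  have hct2 : 2 * ct ≤ c₀ / (N₀ * T) ^ n := by
    rw [hct, mul_div_cancel₀ _ two_ne_zero]; exact (min_le_right _ _).trans (min_le_left _ _)
  have hct3 : 2 * ct ≤ μ / (2 * T) ^ n := by
    rw [hct, mul_div_cancel₀ _ two_ne_zero]; exact (min_le_right _ _).trans (min_le_right _ _)
  refine ⟨ct, hctpos, by linarith, ?_⟩
  intro s hs hs1 W lam θ q hW hϑq Ω hΩ u hu hu₀ ε hε hεδ hmin r hr hrΩ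
  have hr0 : 0 < r := hr₀.trans_le hr
  set U : Set (E n) := {x | ϑ < u x} with hU
  have hVfin : ∀ ρ : ℝ, volume (Metric.ball (0 : E n) ρ ∩ U) ≠ ⊤ := fun ρ =>
    measure_ne_top_of_subset inter_subset_left measure_ball_lt_top.ne
  have hVmono : ∀ ρ ρ' : ℝ, ρ ≤ ρ' → volume.real (Metric.ball (0 : E n) ρ ∩ U) ≤
      volume.real (Metric.ball (0 : E n) ρ' ∩ U) := fun ρ ρ' h =>
    measureReal_mono (inter_subset_inter_left _ (Metric.ball_subset_ball h)) (hVfin ρ')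
  suffices hgoal : 2 * ct * r ^ n ≤ volume.real (Metric.ball 0 r ∩ U) by
    have : 0 < ct * r ^ n := by positivity
    linarith
  rcases lt_or_ge r (N₀ * T) with hsmall | hlarge
  · calc 2 * ct * r ^ n ≤ c₀ / (N₀ * T) ^ n * (N₀ * T) ^ n := by gcongr
      _ = c₀ := by field_simp
      _ ≤ _ := hu₀.le.trans (hVmono _ _ hr)
  have hr1 : 1 ≤ r := (one_le_mul_of_one_le_of_one_le hN₀1' hT1).trans hlarge
  -- If Ω is unbounded, minimality is tested on the ball of radius 2r, whose closure lies in the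
  -- ball of radius 4r and so in Ω.
  obtain ⟨Ω', hΩ'm, hΩ'f, hrΩ', hmin'⟩ : ∃ Ω' : Set (E n), MeasurableSet Ω' ∧ volume Ω' ≠ ⊤ ∧
      Metric.ball 0 r ⊆ Ω' ∧ MinimizesUpTo W s p ε Ω' u := by
    by_cases hb : Bornology.IsBounded Ω
    · exact ⟨Ω, hΩ.measurableSet, hb.measure_lt_top.ne,
        (Metric.ball_subset_ball (by linarith)).trans hrΩ, hmin.2.1 hb⟩
    · refine ⟨Metric.ball 0 (2 * r), measurableSet_ball, measure_ball_lt_top.ne,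
        Metric.ball_subset_ball (by linarith), hmin.2.2 hb _ Metric.isOpen_ball ?_ ?_⟩
      · exact (isCompact_closedBall (0 : E n) (2 * r)).of_isClosed_subset isClosed_closure
          Metric.closure_ball_subset_closedBall
      · exact (Metric.closure_ball_subset_closedBall.trans
          (Metric.closedBall_subset_ball (by linarith))).trans hrΩ
  let f : ℕ → ℝ := fun N => volume.real (Metric.ball (0 : E n) (N * T) ∩ U)
  have hfmono : Monotone f := fun N N' h => hVmono _ _ (by
    have : (N:ℝ) ≤ N' := by exact_mod_cast h
    gcongr)
  have hf₀ : c₀ ≤ f N₀ := hu₀.le.trans (hVmono _ _ hr₀N)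
  set Nmax := ⌊r / T⌋₊ with hNmax
  have hNmaxle : (Nmax : ℝ) * T ≤ r := by
    rw [← le_div_iff₀ hT0]; exact Nat.floor_le (by positivity)
  -- The ball of radius NT sits in the cube of half side NT, which sits in the ball of radius νNT
  -- because ν ≥ √n; the layer estimate doubles the radius, giving the ratio 2ν.
  have hrec : ∀ N, N₀ ≤ N → 2 * ν * N ≤ Nmax → c * N * f N ^ e ≤ f (2 * ν * N) := by
    intro N hN hNle
    have hN1 : (1:ℝ) ≤ N := by exact_mod_cast hN₀1.trans hN
    have hNle' : ((2 * ν * N : ℕ) : ℝ) ≤ Nmax := by exact_mod_cast hNle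
    have hν1' : (1:ℝ) ≤ ν := by exact_mod_cast hν1
    have hbig : 2 * ((ν * N : ℕ) : ℝ) * T = ((2 * ν * N : ℕ) : ℝ) * T := by push_cast; ring
    have hbigr : 2 * ((ν * N : ℕ) : ℝ) * T ≤ r := by
      rw [hbig]; exact le_trans (by gcongr) hNmaxle
    have hNT : 1 ≤ (N:ℝ) * T := one_le_mul_of_one_le_of_one_le hN1 hT1
    have hcube : cube n (N * T) ⊆ Metric.ball 0 (((ν * N : ℕ) : ℝ) * T) :=
      cube_subset_ball hn (by linarith) (by push_cast; rw [← mul_assoc]; gcongr)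
    have hνN0 : 0 ≤ ((ν * N : ℕ) : ℝ) * T := by positivity
    have hcubebig : cube n (N * T) ⊆ Metric.ball 0 (2 * ((ν * N : ℕ) : ℝ) * T) :=
      hcube.trans (Metric.ball_subset_ball (by linarith))
    have hcuber : cube n (N * T) ⊆ Metric.ball 0 r :=
      hcubebig.trans (Metric.ball_subset_ball hbigr)
    obtain ⟨hDm, hiso⟩ := htrans u (N * T) (by linarith) (fun x hx y _ hxy =>
      holder_of_ballHolderSeminorm_le hu hr1 hrΩ (hcuber hx) hxy)
    set D := cube n (N * T) ∩ {x | -1 + (1 + ϑ) / 2 < u x ∧ u x ≤ ϑ} with hD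
    have hfN : c₀ ≤ f N := hf₀.trans (hfmono hN)
    have hfle : f N ≤ volume.real (cube n (N * T) ∩ U) :=
      measureReal_mono (inter_subset_inter_left _ (ball_subset_cube n _))
        (measure_ne_top_of_subset (inter_subset_inter_left _ hcubebig) (hVfin _))
    have hSbig : volume.real (cube n (N * T) ∩ U) ≤ f (2 * ν * N) := by
      simp only [f]
      rw [← hbig]
      exact measureReal_mono (inter_subset_inter_left _ hcubebig) (hVfin _)
    have hne : (cube n (N * T) ∩ U).Nonempty := by
      by_contra hemp
      rw [not_nonempty_iff_eq_empty] at hemp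
      rw [hemp, measureReal_empty] at hfle
      linarith
    have h1 := hiso hne
    have h2 := hlayer s hs hs1 W lam Lam θ q hW hϑq Ω' hΩ'm hΩ'f ε hε u hmin' (ν * N)
      ((Metric.ball_subset_ball hbigr).trans hrΩ') D hDm (inter_subset_left.trans hcube)
      (fun x hx => ⟨by linarith [hx.2.1], hx.2.2⟩)
    rw [hbig] at h2
    change _ ≤ _ + (2 * Lam + 2 * c₁) * S * f (2 * ν * N) at h2
    set V := f (2 * ν * N) with hV
    have hV0 : 0 ≤ V := measureReal_nonneg
    set Dv := volume.real D with hDv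
    have hνN : (N:ℝ) ≤ ((ν * N : ℕ) : ℝ) := by
      push_cast; exact le_mul_of_one_le_left (by linarith) hν1'
    have hνNpos : (0:ℝ) < ((ν * N : ℕ) : ℝ) := by linarith
    have h3 : κ * Dv ≤ ε + (2 * Lam + 2 * c₁) * S * V / N := by
      have h4 : κ * Dv ≤ ε + (2 * Lam + 2 * c₁) * S * V / ((ν * N : ℕ) : ℝ) := by
        rw [← sub_le_iff_le_add', le_div_iff₀ hνNpos]; linarith
      refine h4.trans ?_
      gcongr
    have hpow1 : c₀ ^ e ≤ f N ^ e := Real.rpow_le_rpow hc₀.le hfN he0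
    have hpow2 : f N ^ e ≤ volume.real (cube n (N * T) ∩ U) ^ e :=
      Real.rpow_le_rpow measureReal_nonneg hfle he0
    have h5 : volume.real (cube n (N * T) ∩ U) / (2 * (N * T)) ≤ V / N := by
      gcongr
      linarith [le_mul_of_one_le_right (zero_le_one.trans hN1) hT1]
    have h6 : d * f N ^ e ≤ 2 * Dv + V / N := by
      have := mul_le_mul_of_nonneg_left hpow2 hd.le
      linarith
    have h7 : κ * (d * f N ^ e) ≤ 2 * ε + 2 * (2 * Lam + 2 * c₁) * S * V / N + κ * (V / N) := by
      have := mul_le_mul_of_nonneg_left h6 hκ0.le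
      have e1 : 2 * (2 * Lam + 2 * c₁) * S * V / N = 2 * ((2 * Lam + 2 * c₁) * S * V / N) := by ring
      rw [e1]
      linarith
    have h8 : 2 * ε ≤ κ * (d * f N ^ e) / 2 := by
      have : κ * (d * c₀ ^ e) ≤ κ * (d * f N ^ e) := by gcongr
      linarith
    have h9 : κ * (d * f N ^ e) / 2 ≤ κ * (B * (V / N)) := by
      have e2 : κ * (B * (V / N)) = 2 * (2 * Lam + 2 * c₁) * S * V / N + κ * (V / N) := by
        rw [hB]; field_simp
      rw [e2]; linarith
    have h10 : d * f N ^ e / 2 ≤ B * (V / N) := by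
      refine le_of_mul_le_mul_left ?_ hκ0
      linarith
    rw [← mul_div_assoc, le_div_iff₀ (by linarith)] at h10
    rw [hc]
    rw [div_mul_eq_mul_div, div_mul_eq_mul_div, div_le_iff₀ (by positivity)]
    linarith
  have hNmaxge : N₀ ≤ Nmax := Nat.le_floor (by rw [le_div_iff₀ hT0]; exact hlarge)
  have hmain := growth_of_recursion hn (by omega : 1 ≤ 2 * ν) hN₀1 hfmono hc0 hμ0 hf₀
    (by
      have : μ ≤ c₀ / (((2 * ν : ℕ) : ℝ) * N₀) ^ n := min_le_left _ _
      rwa [le_div_iff₀ (by positivity)] at this)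
    (min_le_right _ _) hrec Nmax hNmaxge le_rfl
  have hNmax1 : (1:ℝ) ≤ Nmax := by exact_mod_cast hN₀1.trans hNmaxge
  have hrle : r ≤ 2 * T * Nmax := by
    have h := Nat.lt_floor_add_one (r / T)
    rw [div_lt_iff₀ hT0, add_mul, one_mul] at h
    have h' : T ≤ Nmax * T := le_mul_of_one_le_left hT0.le hNmax1
    linarith
  calc 2 * ct * r ^ n ≤ μ / (2 * T) ^ n * (2 * T * Nmax) ^ n := by gcongr
    _ = μ * (Nmax : ℝ) ^ n := by
        rw [mul_pow (2 * T), ← mul_assoc, div_mul_cancel₀ _ (by positivity)]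
    _ ≤ f Nmax := hmain
    _ ≤ _ := hVmono _ _ hNmaxle

/-! ### Splitting the superlevel set, and the conclusion. -/

/-- Chebyshev: where u > a the integrand is at least (1+a)^m, and the points above b are already
counted in {u > θ} or its complement lies below b. -/
lemma volume_superlevel_le {n : ℕ} {m a b θ r : ℝ} (hm : 0 ≤ m) (ha : -1 < a) (hb : θ ≤ b)
    {u : E n → ℝ} (hu : AEMeasurable u volume) (hu1 : ∀ᵐ x ∂(volume : Measure (E n)), |u x| ≤ 1) :
    volume.real (Metric.ball 0 r ∩ {x | a < u x}) ≤
      ((1 + a) ^ m)⁻¹ * (∫ x in Metric.ball 0 r ∩ {x | a < u x ∧ u x ≤ b}, |1 + u x| ^ m) +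
        volume.real (Metric.ball 0 r ∩ {x | θ < u x}) := by
  set A : Set (E n) := Metric.ball 0 r ∩ {x | a < u x ∧ u x ≤ b} with hA
  have hAn : NullMeasurableSet A volume :=
    measurableSet_ball.nullMeasurableSet.inter
      ((nullMeasurableSet_lt aemeasurable_const hu).inter
        (nullMeasurableSet_le hu aemeasurable_const))
  have hfin : ∀ s : Set (E n), volume (Metric.ball (0 : E n) r ∩ s) ≠ ⊤ := fun s =>
    measure_ne_top_of_subset inter_subset_left measure_ball_lt_top.ne
  have hAfin : volume A ≠ ⊤ := hfin _
  have hpos : 0 < (1 + a) ^ m := Real.rpow_pos_of_pos (by linarith) _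
  have : IsFiniteMeasure ((volume : Measure (E n)).restrict A) :=
    ⟨by rw [Measure.restrict_apply_univ]; exact hAfin.lt_top⟩
  have h_integ : Integrable (fun x => |1 + u x| ^ m) (volume.restrict A) := by
    refine Integrable.of_bound (C := 2 ^ m) ?_ ?_
    · have : AEMeasurable (fun x => |1 + u x| ^ m) (volume.restrict A) := by
        have := hu.restrict (s := A)
        fun_prop
      exact this.aestronglyMeasurable
    · filter_upwards [ae_restrict_of_ae hu1] with x hx
      rw [Real.norm_of_nonneg (by positivity)]
      have := abs_le.1 hx
      refine Real.rpow_le_rpow (abs_nonneg _) ?_ hm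
      rw [abs_le]; constructor <;> linarith [this.1, this.2]
  have hle : (1 + a) ^ m * volume.real A ≤ ∫ x in A, |1 + u x| ^ m := by
    have h := integral_mono_ae (integrable_const ((1 + a) ^ m)) h_integ (by
      filter_upwards [ae_restrict_mem₀ hAn] with x hx
      have h1 : a < u x := hx.2.1
      refine Real.rpow_le_rpow (by linarith) ?_ hm
      exact le_trans (by linarith) (le_abs_self _))
    rw [integral_const, measureReal_restrict_apply_univ, smul_eq_mul] at h
    linarith
  have h2 : volume.real A ≤ ((1 + a) ^ m)⁻¹ * ∫ x in A, |1 + u x| ^ m := by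
    rw [inv_mul_eq_div, le_div_iff₀ hpos]; linarith
  calc volume.real (Metric.ball 0 r ∩ {x | a < u x})
      ≤ volume.real (A ∪ Metric.ball 0 r ∩ {x | θ < u x}) := by
        refine measureReal_mono (fun x hx => ?_) (by
          exact (measure_union_lt_top hAfin.lt_top (hfin _).lt_top).ne)
        by_cases h : θ < u x
        · exact Or.inr ⟨hx.1, h⟩
        · exact Or.inl ⟨hx.1, hx.2, (not_lt.1 h).trans hb⟩
    _ ≤ volume.real A + volume.real (Metric.ball 0 r ∩ {x | θ < u x}) := measureReal_union_le _ _
    _ ≤ _ := by gcongr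
end
end DensityEstimates

open DensityEstimates in
/-- The order of the quantifiers, and the arguments of the functions `δ`, `Rstar`, `ct`, record what
each constant depends on: `c` on `m, θ_*`; `δ` on `s₀, n, p, m, c₁, θ_*, c₀, α, M`; `Rstar` on
`s₀, n, p, m, c₁, θ_*, r₀`; `ct` on `s₀, n, p, m, Λ, c₁, θ_*, r₀, c₀, α, M`, where `M` is any
bound for `[u]_{B,α}`. -/
theorem mainTheorem2 (m θlow : ℝ) (hθlow : -1 < θlow) :
    ∃ c : ℝ, 0 < c ∧
    ∀ (n : ℕ) (p s₀ c₁ : ℝ), 1 ≤ n → 1 < p → p ≤ m → 1 / p < s₀ → s₀ < 1 → 0 < c₁ →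
    ∃ (δ : (c₀ α : ℝ) → (M : NNReal) → ℝ) (Rstar : (r₀ : ℝ) → ℝ)
      (ct : (Lam r₀ c₀ α : ℝ) → (M : NNReal) → ℝ),
      (∀ c₀ α M, 0 < δ c₀ α M) ∧
      (∀ r₀, r₀ ≤ Rstar r₀) ∧
      (∀ Lam r₀ c₀ α M, 0 < ct Lam r₀ c₀ α M ∧ ct Lam r₀ c₀ α M < 1) ∧
      ∀ (s : ℝ), s₀ ≤ s → s < 1 →
      ∀ (W : ℝ → ℝ) (lam Lam θ q : ℝ), IsPotential W m lam Lam θ q c₁ →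
      ∀ (θ₁ θ₂ : ℝ), θ₁ ∈ Set.Ioc (-1) θ → θ₂ ∈ Set.Ioc (-1) θ →
        θlow = min θ₁ (min θ₂ (-1 + q)) →
      ∀ (Ω : Set (E n)), IsOpen Ω →
      ∀ (α : ℝ) (M : NNReal), 0 < α → α < 1 →
      ∀ (u : E n → ℝ), MemCB α Ω u → MemX s p Ω u → ballHolderSeminorm α u Ω ≤ M →
      ∀ (c₀ r₀ : ℝ), 0 < c₀ → 0 < r₀ → Metric.ball 0 r₀ ⊆ Ω →
        c₀ < volume.real (Metric.ball 0 r₀ ∩ {x | θ₁ < u x}) →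
      ∀ (ε : ℝ), 0 ≤ ε → ε < δ c₀ α M → IsEpsMinimizer W s p ε Ω u →
      ∀ (r : ℝ), Rstar r₀ ≤ r → Metric.ball 0 (4 * r) ⊆ Ω →
        ct Lam r₀ c₀ α M * r ^ n <
          c * (∫ x in Metric.ball 0 r ∩
                {x | θlow < u x ∧ u x ≤ max θ₁ (max θ₂ (-1 + q))}, |1 + u x| ^ m)
            + volume.real (Metric.ball 0 r ∩ {x | θ₂ < u x}) := by
  refine ⟨((1 + θlow) ^ m)⁻¹, inv_pos.2 (Real.rpow_pos_of_pos (by linarith) _), ?_⟩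
  intro n p s₀ c₁ hn hp hpm hs₀ _ hc₁
  have hs₀p : 1 < s₀ * p := by rwa [div_lt_iff₀ (by linarith)] at hs₀
  -- The constants must be total functions of their parameters; outside the admissible range they
  -- take the dummy values 1 and 1/2.
  have hδ : ∀ (c₀ α : ℝ) (M : NNReal), ∃ δ : ℝ, 0 < δ ∧ ∀ Lam r₀ : ℝ, ∃ ct : ℝ, 0 < ct ∧ ct < 1 ∧
      (0 < c₀ → 0 < α → 1 ≤ Lam → 0 < r₀ →
      ∀ s, s₀ ≤ s → s < 1 → ∀ (W : ℝ → ℝ) (lam θ q : ℝ),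
      IsPotential W m lam Lam θ q c₁ → θlow ≤ -1 + q → ∀ (Ω : Set (E n)), IsOpen Ω →
      ∀ u : E n → ℝ, ballHolderSeminorm α u Ω ≤ M →
      c₀ < volume.real (Metric.ball 0 r₀ ∩ {x | θlow < u x}) →
      ∀ ε, 0 ≤ ε → ε < δ → IsEpsMinimizer W s p ε Ω u → ∀ r, r₀ ≤ r →
      Metric.ball 0 (4 * r) ⊆ Ω →
      ct * r ^ n < volume.real (Metric.ball 0 r ∩ {x | θlow < u x})) := by
    intro c₀ α M
    by_cases h : 0 < c₀ ∧ 0 < α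
    · obtain ⟨δ, hδ, H⟩ := exists_density_estimate hn hp hpm hs₀p hc₁ hθlow h.1 h.2 M
      refine ⟨δ, hδ, fun Lam r₀ => ?_⟩
      by_cases h' : 1 ≤ Lam ∧ 0 < r₀
      · obtain ⟨ct, h1, h2, H'⟩ := H Lam r₀ h'.1 h'.2
        exact ⟨ct, h1, h2, fun _ _ _ _ => H'⟩
      · exact ⟨1 / 2, by norm_num, by norm_num, fun _ _ h1 h2 => absurd ⟨h1, h2⟩ h'⟩
    · exact ⟨1, one_pos, fun _ _ => ⟨1 / 2, by norm_num, by norm_num,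
        fun h1 h2 => absurd ⟨h1, h2⟩ h⟩⟩
  choose δ hδ0 ct hct0 hct1 H using hδ
  -- The density bound already holds from radius r₀ on, so R^* = r₀.
  refine ⟨δ, fun r₀ => r₀, fun Lam r₀ c₀ α M => ct c₀ α M Lam r₀, hδ0, fun _ => le_rfl,
    fun Lam r₀ c₀ α M => ⟨hct0 c₀ α M Lam r₀, hct1 c₀ α M Lam r₀⟩, ?_⟩
  intro s hs hs1 W lam Lam θ q hW θ₁ θ₂ _ _ hθ Ω hΩ α M hα _ u _ huX huM c₀ r₀ hc₀ hr₀ _ hu₀ ε hε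
    hεδ hmin r hr hrΩ
  have hθ₁ : θlow ≤ θ₁ := by rw [hθ]; exact min_le_left _ _
  have hq : θlow ≤ -1 + q := by rw [hθ]; exact (min_le_right _ _).trans (min_le_right _ _)
  have hu₀' : c₀ < volume.real (Metric.ball 0 r₀ ∩ {x | θlow < u x}) :=
    hu₀.trans_le (measureReal_mono
      (Set.inter_subset_inter_right _ fun x hx => lt_of_le_of_lt hθ₁ hx)
      (measure_ne_top_of_subset Set.inter_subset_left measure_ball_lt_top.ne))
  refine (H c₀ α M Lam r₀ hc₀ hα hW.one_le_Lam hr₀ s hs hs1 W lam θ q hW hq Ω hΩ u huM hu₀' ε hε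
    hεδ hmin r hr hrΩ).trans_le ?_
  exact volume_superlevel_le (by linarith) hθlow ((le_max_left _ _).trans (le_max_right _ _))
    huX.aemeasurable huX.bound
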